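/- Let $\lambda>0$ and $\mu<1$ be real, and let all complex powers be principal. For $a\in\mathbb C\setminus\{0\}$ with $|\arg a|<\pi/2$ put \[S_\mu^+(a;\lambda)=\sum_{n=0}^\infty\frac{e^{-\lambda n}}{(n^2+a^2)^\mu},\qquad J_\mu(a;\lambda)=\int_0^\infty\frac{e^{-\lambda t}}{(t^2+a^2)^\mu}\,dt,\] \[H_\mu^+(a;\lambda)=a^{1-2\mu}\int_0^1 e^{-\pi au}\,\frac{\sin\lambda au}{\sinh\pi au}\,\frac{du}{(1-u^2)^\mu},\] \[\hat X_k^{\pm}=(2k+2)\pi a\pm i\lambda a,\qquad F(X)=\frac{K_{1/2-\mu}(X)}{X^{1/2-\mu}},\] \[\hat T_\mu(a;\lambda)=2^{3/2-\mu}\sqrt\pi\,a^{1-2\mu}\,\frac{\Gamma(1-\mu)}{\pi}\sum_{k=0}^\infty \frac12\Big(i e^{-\pi i\mu}F(\hat X_k^+)-i e^{\pi i\mu}F(\hat X_k^-)\Big),\] where $K_\nu(z)$ is the modified Bessel function of the second kind (principal branch on $|\arg z|<\pi$). Note that $\Gamma(1-\mu)/\pi=1/(\Gamma(\mu)\sin\pi\mu)$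 if $\mu\notin\mathbb Z$. (1) For every $a\neq0$ with $|\arg a|<\pi/2$ both series converge absolutely, both integrals converge absolutely, and \[S_\mu^+(a;\lambda)=\frac1{2a^{2\mu}}+J_\mu(a;\lambda)+H_\mu^+(a;\lambda)+\hat T_\mu(a;\lambda),\] \[J_\mu(a;\lambda)=\frac{\sqrt\pi\,a^{1-2\mu}\,\Gamma(1-\mu)}{2(\frac12\lambda a)^{1/2-\mu}}\,{\bf K}_{1/2-\mu}(\lambda a),\] where ${\bf K}_\nu={\bf H}_\nu-Y_\nu$, with ${\bf H}_\nu$ the Struve function and $Y_\nu$ the Bessel function of the second kind. (2) If $a>0$, then, with $\hat X_k=\hat X_k^+$ and $\hat\theta_k=\arg\big(\hat X_k^{\mu-1/2}K_{1/2-\mu}(\hat X_k)\big)$, \[\hat T_\mu(a;\lambda)=\frac{2^{3/2-\mu}\sqrt\pi}{a^{2\mu-1}}\,\frac{\Gamma(1-\mu)}{\pi}\sum_{k=0}^\infty\sin(\pi\mu-\hat\theta_k)\left|\frac{K_{1/2-\mu}(\hat X_k)}{\hat X_k^{1/2-\mu}}\right|\] with an absolutely convergent series, and for $\mu\notin\mathbb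 Z$ \[\hat T_\mu(a;\lambda)=\frac{2^{3/2-\mu}\sqrt\pi}{a^{2\mu-1}\,\Gamma(\mu)}\sum_{k=0}^\infty\frac{\sin(\pi\mu-\hat\theta_k)}{\sin\pi\mu}\left|\frac{K_{1/2-\mu}(\hat X_k)}{\hat X_k^{1/2-\mu}}\right|.\] (3) For fixed $\lambda,\mu$, $\hat T_\mu(a;\lambda)=O(a^{1-2\mu}e^{-2\pi a})$ as $a\to+\infty$. More generally, for each $\delta<\pi/2$, $\hat T_\mu(a;\lambda)=O\big(|a|^{1-2\mu}e^{-2\pi\operatorname{Re}a+\lambda|\operatorname{Im}a|}\big)$ as $|a|\to\infty$ in $|\arg a|\le\delta$. -/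

import Mathlib

open Filter Topology MeasureTheory Asymptotics Set

noncomputable section

namespace MathieuExp

/-- The Bessel function of the first kind `J_ν(z)` (real order, principal branch of `(z/2)^ν`).
`Real.Gamma` is `0` at its poles, so that the reciprocal there has its correct value `0`. -/
def besselJ (ν : ℝ) (z : ℂ) : ℂ :=
  (z / 2) ^ (ν : ℂ) *
    ∑' m : ℕ, (-1 : ℂ) ^ m * (z / 2) ^ (2 * m) *
      (((m.factorial : ℝ) * Real.Gamma (ν + m + 1))⁻¹ : ℝ)

/-- The modified Bessel function of the first kind `I_ν(z)`. -/
def besselI (ν : ℝ) (z : ℂ) : ℂ :=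
  (z / 2) ^ (ν : ℂ) *
    ∑' m : ℕ, (z / 2) ^ (2 * m) * (((m.factorial : ℝ) * Real.Gamma (ν + m + 1))⁻¹ : ℝ)

/-- The quotient `(J_ν(z) cos νπ - J_{-ν}(z)) / sin νπ`. -/
def besselYQuot (ν : ℝ) (z : ℂ) : ℂ :=
  (besselJ ν z * (Real.cos (ν * Real.pi) : ℂ) - besselJ (-ν) z) / (Real.sin (ν * Real.pi) : ℂ)

open Classical in
/-- The Bessel function of the second kind `Y_ν(z)`; its value at an integer order is the limit
of the quotient over orders tending to that integer. -/
def besselY (ν : ℝ) (z : ℂ) : ℂ :=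
  if ∃ n : ℤ, ν = n then limUnder (𝓝[≠] ν) (fun ν' : ℝ => besselYQuot ν' z)
  else besselYQuot ν z

/-- The quotient `(π/2) (I_{-ν}(z) - I_ν(z)) / sin νπ`. -/
def besselKQuot (ν : ℝ) (z : ℂ) : ℂ :=
  (Real.pi / 2 : ℂ) * (besselI (-ν) z - besselI ν z) / (Real.sin (ν * Real.pi) : ℂ)

open Classical in
/-- The modified Bessel function of the second kind `K_ν(z)` (principal branch); its value at an
integer order is the limit of the quotient over orders tending to that integer. -/
def besselK (ν : ℝ) (z : ℂ) : ℂ :=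
  if ∃ n : ℤ, ν = n then limUnder (𝓝[≠] ν) (fun ν' : ℝ => besselKQuot ν' z)
  else besselKQuot ν z

/-- The Struve function `𝐇_ν(z)`. -/
def struveH (ν : ℝ) (z : ℂ) : ℂ :=
  (z / 2) ^ ((ν + 1 : ℝ) : ℂ) *
    ∑' m : ℕ, (-1 : ℂ) ^ m * (z / 2) ^ (2 * m) *
      ((Real.Gamma (m + 3 / 2) * Real.Gamma (m + ν + 3 / 2))⁻¹ : ℝ)

/-- The Struve function `𝐊_ν(z) = 𝐇_ν(z) - Y_ν(z)`. -/
def struveK (ν : ℝ) (z : ℂ) : ℂ := struveH ν z - besselY ν z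

/-- The `n`-th term `e^{-λ n} / (n² + a²)^μ` of the series `S_μ^+(a;λ)`. -/
def sTerm (lam μ : ℝ) (a : ℂ) (n : ℕ) : ℂ :=
  (Real.exp (-lam * n) : ℂ) / ((n : ℂ) ^ 2 + a ^ 2) ^ (μ : ℂ)

/-- The series `S_μ^+(a;λ)`. -/
def S (lam μ : ℝ) (a : ℂ) : ℂ := ∑' n : ℕ, sTerm lam μ a n

/-- The integrand `e^{-λ t} / (t² + a²)^μ` of `J_μ(a;λ)`. -/
def jIntegrand (lam μ : ℝ) (a : ℂ) (t : ℝ) : ℂ :=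
  (Real.exp (-lam * t) : ℂ) / ((t : ℂ) ^ 2 + a ^ 2) ^ (μ : ℂ)

/-- The integral `J_μ(a;λ)`. -/
def J (lam μ : ℝ) (a : ℂ) : ℂ := ∫ t in Ioi (0 : ℝ), jIntegrand lam μ a t

/-- The integrand `e^{-π a u} (sin λau / sinh πau) (1-u²)^{-μ}` of `H_μ^+(a;λ)`. -/
def hIntegrand (lam μ : ℝ) (a : ℂ) (u : ℝ) : ℂ :=
  Complex.exp (-(Real.pi * a * u)) *
    (Complex.sin (lam * a * u) / Complex.sinh (Real.pi * a * u)) * (((1 - u ^ 2) ^ (-μ) : ℝ) : ℂ)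

/-- The term `H_μ^+(a;λ)`. -/
def H (lam μ : ℝ) (a : ℂ) : ℂ :=
  a ^ ((1 - 2 * μ : ℝ) : ℂ) * ∫ u in Ioo (0 : ℝ) 1, hIntegrand lam μ a u

/-- `X̂_k = (2k+2)πa + iλa`. -/
def Xhat (lam : ℝ) (a : ℂ) (k : ℕ) : ℂ :=
  (2 * k + 2) * Real.pi * a + Complex.I * lam * a

/-- `K_{1/2-μ}(X) / X^{1/2-μ}`. -/
def kRatio (μ : ℝ) (X : ℂ) : ℂ :=
  besselK (1 / 2 - μ) X / X ^ ((1 / 2 - μ : ℝ) : ℂ)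

/-- The sum of the two terms, from the two branch points `±ia`, that carry the index `k`; the
second one is obtained from `i e^{-πiμ} K(X̂_k)/X̂_k^{1/2-μ}` by changing `i` into `-i` with `a`
kept, so that it is the complex conjugate of the first one when `a > 0`. -/
def tTerm (lam μ : ℝ) (a : ℂ) (k : ℕ) : ℂ :=
  (Complex.I * Complex.exp (-(Complex.I * Real.pi * μ)) * kRatio μ (Xhat lam a k)
    - Complex.I * Complex.exp (Complex.I * Real.pi * μ) * kRatio μ (Xhat (-lam) a k)) / 2

/-- The term `T̂_μ(a;λ)`. The factor `1 / (Γ(μ) sin πμ)` is written `Γ(1-μ)/π`, which is its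
value for non-integer `μ` and its limit at the integers `μ ≤ 0`. -/
def That (lam μ : ℝ) (a : ℂ) : ℂ :=
  (((2 : ℝ) ^ (3 / 2 - μ) * Real.sqrt Real.pi * (Real.Gamma (1 - μ) / Real.pi) : ℝ) : ℂ) *
    a ^ ((1 - 2 * μ : ℝ) : ℂ) * ∑' k : ℕ, tTerm lam μ a k

/-- `θ̂_k = arg (X̂_k^{μ-1/2} K_{1/2-μ}(X̂_k))`. -/
def thetaHat (lam μ : ℝ) (a : ℂ) (k : ℕ) : ℝ :=
  Complex.arg (Xhat lam a k ^ ((μ - 1 / 2 : ℝ) : ℂ) * besselK (1 / 2 - μ) (Xhat lam a k))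

end MathieuExp

end

open Filter Topology MeasureTheory Asymptotics Set

noncomputable section

namespace MathieuExp

/-! For real `a > 0` the identity is Poisson summation for the even function `g(x) = e^{-λ|x|} (x² +
a²)^{-μ}`. The sum over the integers is `2S - a^{-2μ}`, and the zeroth Fourier coefficient is `2J`.
The coefficient at `±(k+1)` is `a^{1-2μ}` times twice the real part of `L(-i X̂_k)`, where `L(p) =
∫_0^∞ e^{-px} (1 + x²)^{-μ} dx` is `laplaceHalf (-μ)`.

The contour of `L` is rotated onto the positive imaginary axis (`laplaceHalf_rotate`), where it
meets the branch point `i`. The segment from `0` to `i` contributes sine integrals whose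
exponentials `e^{-2π(k+1)au}` sum over `k` as a geometric series; this produces `H`. Beyond `i` the
power acquires the phase `e^{-πiμ}` and leaves `∫_1^∞ e^{-Xt} (t² - 1)^{-μ} dt` at `X = X̂_k`, which
is `K_{1/2-μ}(X̂_k)` up to elementary factors; this produces `T̂`. All terms are holomorphic in `Re
a > 0`, so the identity theorem passes from positive `a` to the sector (`S_ofReal`, then `S_eq`).

The Bessel functions are defined by power series and, at integer orders, by limits, so their
integral representations have to be proved. The Laplace integral and the series of `I_ν` and
`I_{-ν}`, all divided by `x^ν`, solve one second-order equation. For `-1/2 < ν < 0` the values and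
weighted derivatives of these solutions have explicit limits at `0`, and a Wronskian argument yields
the connection formula on a short interval (`exists_laplaceTail_connection`). Analytic continuation
in the argument and then in the order extends it to the slit plane and to `Re ν > -1/2`
(`laplaceTailExt_connection`); the condition `μ < 1` says exactly that `ν = 1/2 - μ` lies in this
range. Continuity in `ν` settles the integer orders. The same formula at `iz` gives `Y_ν`, and the
even and odd power moments on the segment give the `J_ν` and Struve series, so that the rotated
integral becomes `𝐇_ν - Y_ν` (`laplaceHalf_eq_struveK`), which evaluates `J`.

The estimates rest on a bound for the Laplace integral that is uniform in `k`: each `X̂_k` is `a`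
times a number of positive real part, and the series is dominated by a geometric one of ratio
`e^{-2π Re a}`. -/

open scoped FourierTransform

/-! ### Holomorphic parameter integrals and the identity theorem. -/

/-- Differentiation under the integral sign for a locally dominated family of holomorphic
functions. -/
theorem hasDerivAt_integral_of_locally_dominated {U : Set ℂ} (hU : IsOpen U) {S : Set ℝ}
    (hS : MeasurableSet S) {F : ℂ → ℝ → ℂ}
    (hmeas : ∀ z, AEStronglyMeasurable (F z) (volume.restrict S))
    (hd : ∀ t ∈ S, DifferentiableOn ℂ (fun z => F z t) U) {z₀ : ℂ} (hz₀ : z₀ ∈ U) {bound : ℝ → ℝ}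
    (hbi : IntegrableOn bound S) (hb : ∀ᶠ z in 𝓝 z₀, ∀ t ∈ S, ‖F z t‖ ≤ bound t) :
    HasDerivAt (fun z => ∫ t in S, F z t) (∫ t in S, deriv (fun z => F z t) z₀) z₀ := by
  obtain ⟨r, hr, hball⟩ := Metric.mem_nhds_iff.1 (inter_mem (hU.mem_nhds hz₀) hb)
  have hdiff : ∀ t ∈ S, ∀ x ∈ Metric.ball z₀ r,
      HasDerivAt (fun z => F z t) (deriv (fun z => F z t) x) x := fun t ht x hx =>
    ((hd t ht).differentiableAt (hU.mem_nhds (hball hx).1)).hasDerivAt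
  have hsub : Metric.ball z₀ (r / 2) ⊆ Metric.ball z₀ r := Metric.ball_subset_ball (by linarith)
  refine (hasDerivAt_integral_of_dominated_loc_of_deriv_le
    (F' := fun x t => deriv (fun z => F z t) x) (bound := fun t => bound t / (r / 2))
    (Metric.ball_mem_nhds z₀ (half_pos hr)) (Eventually.of_forall hmeas) ?_ ?_ ?_
    (hbi.div_const _) ?_).2
  · refine Integrable.mono' hbi (hmeas z₀) ?_
    exact (ae_restrict_mem hS).mono fun t ht => (hball (Metric.mem_ball_self hr)).2 t ht
  -- The derivative is measurable in `t` as a pointwise limit of difference quotients.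
  · have hm : ∀ h : ℂ, AEStronglyMeasurable (fun t => h⁻¹ • (F (z₀ + h) t - F z₀ t))
        (volume.restrict S) := fun h =>
      AEStronglyMeasurable.const_smul ((hmeas (z₀ + h)).sub (hmeas z₀)) (h⁻¹)
    have hlim : ∀ᵐ t ∂(volume.restrict S),
        Tendsto (fun h : ℂ => h⁻¹ • (F (z₀ + h) t - F z₀ t)) (𝓝[≠] 0)
          (𝓝 (deriv (fun z => F z t) z₀)) :=
      (ae_restrict_mem hS).mono fun t ht =>
        (hdiff t ht z₀ (Metric.mem_ball_self hr)).tendsto_slope_zero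
    exact aestronglyMeasurable_of_tendsto_ae (𝓝[≠] (0 : ℂ)) hm hlim
  · refine (ae_restrict_mem hS).mono fun t ht x hx => ?_
    have hc : Metric.closedBall x (r / 2) ⊆ Metric.ball z₀ r := fun y hy => by
      have h1 := Metric.mem_ball.1 hx
      have h2 := Metric.mem_closedBall.1 hy
      have := dist_triangle y x z₀
      exact Metric.mem_ball.2 (by linarith)
    -- Cauchy's estimate on a circle of radius `r / 2` turns the bound on `F` into one on its
    -- derivative.
    refine Complex.norm_deriv_le_of_forall_mem_sphere_norm_le (half_pos hr) ?_ ?_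
    · exact ((hd t ht).mono fun y hy => (hball hy).1).diffContOnCl_ball hc
    · exact fun y hy => (hball (hc (Metric.sphere_subset_closedBall hy))).2 t ht
  · exact (ae_restrict_mem hS).mono fun t ht x hx => hdiff t ht x (hsub hx)

theorem differentiableOn_integral_of_locally_dominated {U : Set ℂ} (hU : IsOpen U) {S : Set ℝ}
    (hS : MeasurableSet S) {F : ℂ → ℝ → ℂ}
    (hmeas : ∀ z, AEStronglyMeasurable (F z) (volume.restrict S))
    (hd : ∀ t ∈ S, DifferentiableOn ℂ (fun z => F z t) U)
    (hb : ∀ z₀ ∈ U, ∃ bound : ℝ → ℝ, IntegrableOn bound S ∧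
      ∀ᶠ z in 𝓝 z₀, ∀ t ∈ S, ‖F z t‖ ≤ bound t) :
    DifferentiableOn ℂ (fun z => ∫ t in S, F z t) U := fun z hz => by
  obtain ⟨b, hbi, hb⟩ := hb z hz
  exact (hasDerivAt_integral_of_locally_dominated hU hS hmeas hd hz hbi
    hb).differentiableAt.differentiableWithinAt

/-- A version of the identity theorem: holomorphic functions on a preconnected open set that
agree along a real segment inside the set are equal. -/
theorem eqOn_of_eq_on_real_Ioo {U : Set ℂ} (hU : IsOpen U) (hc : IsPreconnected U) {f g : ℂ → ℂ}
    (hf : DifferentiableOn ℂ f U) (hg : DifferentiableOn ℂ g U) {l r : ℝ} (hlr : l < r)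
    (hsub : ∀ x : ℝ, l < x → x < r → (x : ℂ) ∈ U)
    (h : ∀ x : ℝ, l < x → x < r → f x = g x) : EqOn f g U := by
  have hm : l < (l + r) / 2 ∧ (l + r) / 2 < r := by constructor <;> linarith
  refine (hf.analyticOnNhd hU).eqOn_of_preconnected_of_frequently_eq (hg.analyticOnNhd hU) hc
    (hsub _ hm.1 hm.2) ?_
  have ht : Tendsto (fun x : ℝ => (x : ℂ)) (𝓝[≠] ((l + r) / 2)) (𝓝[≠] (((l + r) / 2 : ℝ) : ℂ)) := by
    refine tendsto_nhdsWithin_iff.2 ⟨?_, ?_⟩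
    · exact (Complex.continuous_ofReal.tendsto _).mono_left nhdsWithin_le_nhds
    · filter_upwards [self_mem_nhdsWithin] with x hx
      exact fun h => hx (Complex.ofReal_injective h)
  refine ht.frequently (Eventually.frequently ?_)
  filter_upwards [nhdsWithin_le_nhds (Ioo_mem_nhds hm.1 hm.2)] with x hx
  exact h x hx.1 hx.2

theorem eqOn_of_eqOn_open {U V : Set ℂ} (hU : IsOpen U) (hc : IsPreconnected U) {f g : ℂ → ℂ}
    (hf : DifferentiableOn ℂ f U) (hg : DifferentiableOn ℂ g U) (hV : IsOpen V) {z : ℂ}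
    (hzU : z ∈ U) (hzV : z ∈ V) (h : ∀ w ∈ V, f w = g w) : EqOn f g U :=
  (hf.analyticOnNhd hU).eqOn_of_preconnected_of_eventuallyEq (hg.analyticOnNhd hU) hc hzU
    (by filter_upwards [hV.mem_nhds hzV] with w hw using h w hw)

/-! ### Elementary bounds for real powers and integrable majorants. -/

/-- The power is monotone in one direction or the other, so the sum of the end values serves for
both signs of `p`. -/
theorem rpow_le_add_of_mem_Icc {c r C : ℝ} (p : ℝ) (hc : 0 < c) (h1 : c ≤ r) (h2 : r ≤ C) :
    r ^ p ≤ c ^ p + C ^ p := by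
  have hr : 0 < r := hc.trans_le h1
  rcases le_total 0 p with hp | hp
  · have := Real.rpow_le_rpow hr.le h2 hp
    have := Real.rpow_nonneg hc.le p
    linarith
  · have := Real.rpow_le_rpow_of_nonpos hc h1 hp
    have := Real.rpow_nonneg (hr.le.trans h2) p
    linarith

theorem rpow_le_add_of_exponent_mem_Icc {r p₀ p p₁ : ℝ} (hr : 0 < r) (h0 : p₀ ≤ p) (h1 : p ≤ p₁) :
    r ^ p ≤ r ^ p₀ + r ^ p₁ := by
  rcases le_total 1 r with h | h
  · have := Real.rpow_le_rpow_of_exponent_le h h1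
    have := Real.rpow_nonneg hr.le p₀
    linarith
  · have := Real.rpow_le_rpow_of_exponent_ge hr h h0
    have := Real.rpow_nonneg hr.le p₁
    linarith

/-- Separates a constant from a pure power of `c`, so that only Gamma integrals remain against
`e^{-w} w^s`. For `p < 0` the constant suffices, and the last term is switched off. -/
theorem add_rpow_le_of_pos {b c : ℝ} (p : ℝ) (hb : 0 < b) (hc : 0 ≤ c) :
    (b + c) ^ p ≤ b ^ p + (2 * b) ^ p + (2 * c) ^ |p| * (if 0 ≤ p then 1 else 0) := by
  split_ifs with hp
  · rw [abs_of_nonneg hp, mul_one]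
    have hbp := Real.rpow_nonneg hb.le p
    rcases le_total b c with h | h
    · have := Real.rpow_le_rpow (by positivity) (show b + c ≤ 2 * c by linarith) hp
      have := Real.rpow_nonneg (show 0 ≤ 2 * b by positivity) p
      linarith
    · have := Real.rpow_le_rpow (by positivity) (show b + c ≤ 2 * b by linarith) hp
      have := Real.rpow_nonneg (show 0 ≤ 2 * c by positivity) p
      linarith
  · have := Real.rpow_le_rpow_of_nonpos hb (show b ≤ b + c by linarith) (not_le.1 hp).le
    have := Real.rpow_nonneg (show 0 ≤ 2 * b by positivity) p
    linarith

theorem integrableOn_exp_mul_rpow_mul_add_rpow {s b c : ℝ} (p : ℝ) (hs : -1 < s) (hb : 0 < b)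
    (hc : 0 ≤ c) :
    IntegrableOn (fun w : ℝ => Real.exp (-w) * w ^ s * (b + c * w) ^ p) (Ioi 0) := by
  have hG : ∀ q : ℝ, -1 < q → IntegrableOn (fun w : ℝ => Real.exp (-w) * w ^ q) (Ioi 0) := by
    intro q hq
    have := Real.GammaIntegral_convergent (s := q + 1) (by linarith)
    simpa using this
  have h1 := (hG s hs).mul_const (b ^ p + (2 * b) ^ p)
  have h2 := (hG (s + |p|) (by have := abs_nonneg p; linarith)).mul_const
    ((2 * c) ^ |p| * (if 0 ≤ p then 1 else 0))
  refine Integrable.mono' (h1.add h2) ?_ ?_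
  · exact Measurable.aestronglyMeasurable (by fun_prop)
  · refine (ae_restrict_mem measurableSet_Ioi).mono fun w hw => ?_
    have hw : 0 < w := hw
    rw [Real.norm_of_nonneg (by positivity)]
    have h := add_rpow_le_of_pos p hb (show 0 ≤ c * w by positivity)
    have := mul_le_mul_of_nonneg_left h (show 0 ≤ Real.exp (-w) * w ^ s by positivity)
    refine this.trans (le_of_eq ?_)
    simp only [Pi.add_apply]
    rw [Real.rpow_add hw, ← mul_assoc 2, Real.mul_rpow (by positivity) hw.le]
    ring

/-! ### The power series behind `I_ν` and `J_ν`. -/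

/-- The regularized confluent hypergeometric limit function
`∑ w^m / (m! Γ(ν+m+1))`, in terms of which `I_ν` and `J_ν` are expressed. -/
def hyp01 (ν w : ℂ) : ℂ :=
  ∑' m : ℕ, w ^ m * ((m.factorial : ℂ) * Complex.Gamma (ν + m + 1))⁻¹

/-- As `1/Γ` is entire, each of the finitely many indices `m ≤ N`, with `N ≥ R`, has a bound on the
disc. Beyond them `1/Γ(z) = z/Γ(z+1)` with `|z| ≥ 1` shows that the size no longer grows with `m`.
-/
theorem exists_norm_inv_Gamma_add_nat_le (R : ℝ) :
    ∃ C : ℝ, 0 ≤ C ∧ ∀ ν : ℂ, ‖ν‖ ≤ R → ∀ m : ℕ, ‖(Complex.Gamma (ν + m + 1))⁻¹‖ ≤ C := by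
  have hb : ∀ m : ℕ, ∃ C : ℝ, ∀ ν : ℂ, ‖ν‖ ≤ R → ‖(Complex.Gamma (ν + m + 1))⁻¹‖ ≤ C := by
    intro m
    have hcont : Continuous fun ν : ℂ => (Complex.Gamma (ν + m + 1))⁻¹ :=
      Complex.differentiable_one_div_Gamma.continuous.comp (by fun_prop)
    obtain ⟨C, hC⟩ := (isCompact_closedBall (0 : ℂ) R).exists_bound_of_continuousOn
      hcont.continuousOn
    exact ⟨C, fun ν hν => hC ν (by simpa using hν)⟩
  choose c hc using hb
  obtain ⟨N, hN⟩ := exists_nat_ge R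
  refine ⟨∑ m ∈ Finset.range (N + 1), |c m|, Finset.sum_nonneg fun _ _ => abs_nonneg _,
    fun ν hν m => ?_⟩
  have hsmall : ∀ m ≤ N, ‖(Complex.Gamma (ν + m + 1))⁻¹‖ ≤ ∑ m ∈ Finset.range (N + 1), |c m| := by
    intro m hm
    refine (hc m ν hν).trans ((le_abs_self _).trans ?_)
    exact Finset.single_le_sum (f := fun m => |c m|) (fun _ _ => abs_nonneg _)
      (Finset.mem_range.2 (by omega))
  induction m with
  | zero => exact hsmall 0 (Nat.zero_le _)
  | succ m ih =>
    rcases le_or_gt (m + 1) N with h | h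
    · exact hsmall _ h
    · refine le_trans ?_ ih
      rw [Complex.one_div_Gamma_eq_self_mul_one_div_Gamma_add_one (ν + m + 1), norm_mul]
      have h1 : (1 : ℝ) ≤ ‖ν + m + 1‖ := by
        have h2 : ‖((m : ℂ) + 1)‖ = m + 1 := by
          rw [← Nat.cast_succ, Complex.norm_natCast, Nat.cast_succ]
        have h3 := norm_sub_norm_le ((m : ℂ) + 1) (-ν)
        rw [norm_neg, h2] at h3
        have h4 : (N : ℝ) ≤ m := by exact_mod_cast Nat.lt_succ_iff.1 h
        rw [show (m : ℂ) + 1 - -ν = ν + m + 1 by ring] at h3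
        linarith
      push_cast
      rw [← add_assoc]
      exact le_mul_of_one_le_left (norm_nonneg _) h1

theorem norm_hyp01_term_le {C r : ℝ} {ν w : ℂ} (hw : ‖w‖ ≤ r) {m : ℕ}
    (h : ‖(Complex.Gamma (ν + m + 1))⁻¹‖ ≤ C) :
    ‖w ^ m * ((m.factorial : ℂ) * Complex.Gamma (ν + m + 1))⁻¹‖ ≤ C * (r ^ m / m.factorial) := by
  rw [mul_inv, norm_mul, norm_mul, norm_pow, norm_inv, Complex.norm_natCast]
  have : ‖w‖ ^ m ≤ r ^ m := pow_le_pow_left₀ (norm_nonneg _) hw m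
  calc _ = ‖w‖ ^ m * (m.factorial : ℝ)⁻¹ * ‖(Complex.Gamma (ν + m + 1))⁻¹‖ := by ring
    _ ≤ r ^ m * (m.factorial : ℝ)⁻¹ * C := by
        have := (norm_nonneg w).trans hw
        gcongr
    _ = _ := by ring

theorem summable_hyp01 (ν w : ℂ) :
    Summable fun m : ℕ => w ^ m * ((m.factorial : ℂ) * Complex.Gamma (ν + m + 1))⁻¹ := by
  obtain ⟨C, -, hC⟩ := exists_norm_inv_Gamma_add_nat_le ‖ν‖
  exact Summable.of_norm_bounded ((Real.summable_pow_div_factorial ‖w‖).mul_left C)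
    fun m => norm_hyp01_term_le le_rfl (hC ν le_rfl m)

/-- Regularity in the order serves the continuation of the connection formula in `ν` and the limit
that defines `Y_ν` at integers. -/
theorem differentiable_hyp01_left (w : ℂ) : Differentiable ℂ fun ν => hyp01 ν w := by
  intro ν
  obtain ⟨C, -, hC⟩ := exists_norm_inv_Gamma_add_nat_le (‖ν‖ + 1)
  have := Complex.differentiableOn_tsum_of_summable_norm
    (F := fun (m : ℕ) (ν : ℂ) => w ^ m * ((m.factorial : ℂ) * Complex.Gamma (ν + m + 1))⁻¹)
    (U := Metric.ball 0 (‖ν‖ + 1)) ((Real.summable_pow_div_factorial ‖w‖).mul_left C) ?_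
    Metric.isOpen_ball fun m x hx => norm_hyp01_term_le le_rfl
      (hC x (by simpa using (Metric.mem_ball.1 hx).le) m)
  · exact this.differentiableAt (Metric.isOpen_ball.mem_nhds (by simp))
  · intro m
    have h : Differentiable ℂ fun ν : ℂ => (Complex.Gamma (ν + m + 1))⁻¹ :=
      Complex.differentiable_one_div_Gamma.comp (by fun_prop)
    simp_rw [mul_inv]
    exact ((h.const_mul _).const_mul _).differentiableOn

theorem hasDerivAt_hyp01 (ν w : ℂ) : HasDerivAt (hyp01 ν) (hyp01 (ν + 1) w) w := by
  obtain ⟨C, -, hC⟩ := exists_norm_inv_Gamma_add_nat_le ‖ν‖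
  have hs := (Real.summable_pow_div_factorial (‖w‖ + 1)).mul_left C
  have hw : w ∈ Metric.ball (0 : ℂ) (‖w‖ + 1) := by simp
  have hd : ∀ m : ℕ, DifferentiableOn ℂ
      (fun w : ℂ => w ^ m * ((m.factorial : ℂ) * Complex.Gamma (ν + m + 1))⁻¹)
      (Metric.ball 0 (‖w‖ + 1)) := fun m => by fun_prop
  have hb : ∀ (m : ℕ) (z : ℂ), z ∈ Metric.ball (0 : ℂ) (‖w‖ + 1) →
      ‖z ^ m * ((m.factorial : ℂ) * Complex.Gamma (ν + m + 1))⁻¹‖ ≤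
        C * ((‖w‖ + 1) ^ m / m.factorial) := fun m z hz =>
    norm_hyp01_term_le (by simpa using (Metric.mem_ball.1 hz).le) (hC ν le_rfl m)
  have h1 := Complex.differentiableOn_tsum_of_summable_norm hs hd Metric.isOpen_ball hb
  have h2 := Complex.hasSum_deriv_of_summable_norm hs hd Metric.isOpen_ball hb hw
  have h3 : HasDerivAt (hyp01 ν) _ w :=
    (h1.differentiableAt (Metric.isOpen_ball.mem_nhds hw)).hasDerivAt
  convert h3 using 1
  rw [← h2.tsum_eq, h2.summable.tsum_eq_zero_add]
  simp only [pow_zero, one_mul, deriv_const, zero_add, hyp01]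
  refine tsum_congr fun m => ?_
  rw [deriv_mul_const (by fun_prop), deriv_pow_field, Nat.factorial_succ]
  push_cast
  rw [show ν + 1 + (m : ℂ) + 1 = ν + (m + 1) + 1 by ring, mul_inv, mul_inv, mul_inv]
  have : (m : ℂ) + 1 ≠ 0 := by exact_mod_cast Nat.succ_ne_zero m
  field_simp

theorem differentiable_hyp01 (ν : ℂ) : Differentiable ℂ (hyp01 ν) := fun w =>
  (hasDerivAt_hyp01 ν w).differentiableAt

/-- The recurrence of `1/Γ` splits each term into a multiple by `ν` and a multiple by `m`; the
latter cancels against `m!` and shifts the index. With `hasDerivAt_hyp01` this contiguous relation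
is Bessel's equation. -/
theorem hyp01_sub_one (ν w : ℂ) :
    hyp01 (ν - 1) w = ν * hyp01 ν w + w * hyp01 (ν + 1) w := by
  have h1 : ∀ m : ℕ, w ^ m * ((m.factorial : ℂ) * Complex.Gamma (ν - 1 + m + 1))⁻¹ =
      ν * (w ^ m * ((m.factorial : ℂ) * Complex.Gamma (ν + m + 1))⁻¹) +
        m * (w ^ m * ((m.factorial : ℂ) * Complex.Gamma (ν + m + 1))⁻¹) := by
    intro m
    rw [show ν - 1 + (m : ℂ) + 1 = ν + m by ring, mul_inv, mul_inv,
      Complex.one_div_Gamma_eq_self_mul_one_div_Gamma_add_one (ν + m)]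
    ring
  have hs := summable_hyp01 ν w
  have hs' := summable_hyp01 (ν - 1) w
  have hsm : Summable fun m : ℕ =>
      (m : ℂ) * (w ^ m * ((m.factorial : ℂ) * Complex.Gamma (ν + m + 1))⁻¹) :=
    (hs'.sub (hs.mul_left ν)).congr fun m => by rw [h1]; ring
  rw [hyp01, tsum_congr h1, (hs.mul_left ν).tsum_add hsm, tsum_mul_left, hsm.tsum_eq_zero_add]
  simp only [hyp01, Nat.cast_zero, zero_mul, zero_add, ← tsum_mul_left]
  congr 1
  refine tsum_congr fun m => ?_
  rw [Nat.factorial_succ]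
  push_cast
  rw [show ν + 1 + (m : ℂ) + 1 = ν + (m + 1) + 1 by ring, mul_inv, mul_inv, mul_inv]
  have : (m : ℂ) + 1 ≠ 0 := by exact_mod_cast Nat.succ_ne_zero m
  rw [pow_succ]
  field_simp

theorem hyp01_zero (ν : ℂ) : hyp01 ν 0 = (Complex.Gamma (ν + 1))⁻¹ := by
  rw [hyp01, tsum_eq_single 0]
  · simp
  · intro m hm
    simp [hm]

theorem besselI_eq (ν : ℝ) (z : ℂ) :
    besselI ν z = (z / 2) ^ (ν : ℂ) * hyp01 ν (z ^ 2 / 4) := by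
  rw [besselI, hyp01]
  congr 1
  refine tsum_congr fun m => ?_
  rw [pow_mul]
  push_cast
  rw [← Complex.Gamma_ofReal]
  push_cast
  congr 2
  ring

theorem besselJ_eq (ν : ℝ) (z : ℂ) :
    besselJ ν z = (z / 2) ^ (ν : ℂ) * hyp01 ν (-(z ^ 2 / 4)) := by
  rw [besselJ, hyp01]
  congr 1
  refine tsum_congr fun m => ?_
  rw [pow_mul, ← mul_pow]
  push_cast
  rw [← Complex.Gamma_ofReal]
  push_cast
  congr 2
  ring

/-! ### The Laplace-type integral on the slit plane. -/

/-- The numerator of `(2a + w/ζ)/a` has real part at least `2 Re a`. The bound does not involve `ζ`,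
which later makes the estimates uniform over all `X̂_k`. -/
theorem le_norm_two_add_div {ζ a : ℂ} (hζ : 0 < ζ.re) (ha : 0 < a.re) {w : ℝ} (hw : 0 ≤ w) :
    2 * a.re / ‖a‖ ≤ ‖2 + w / (ζ * a)‖ := by
  have ha0 : a ≠ 0 := fun h => by simp [h] at ha
  have hζ0 : ζ ≠ 0 := fun h => by simp [h] at hζ
  rw [show 2 + (w : ℂ) / (ζ * a) = (2 * a + w / ζ) / a by field_simp, norm_div]
  gcongr
  refine le_trans ?_ (Complex.re_le_norm _)
  have : 0 ≤ ((w : ℂ) / ζ).re := by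
    rw [Complex.div_re]
    simp only [Complex.ofReal_re, Complex.ofReal_im, zero_mul, zero_div, add_zero]
    have := Complex.normSq_nonneg ζ
    positivity
  simp only [Complex.add_re, Complex.mul_re, Complex.re_ofNat, Complex.im_ofNat, zero_mul, sub_zero]
  linarith

theorem two_add_div_mem_slitPlane {X : ℂ} (hX : X ∈ Complex.slitPlane) {w : ℝ} (hw : 0 ≤ w) :
    2 + w / X ∈ Complex.slitPlane := by
  have hi : X⁻¹ ∈ Complex.slitPlane := by
    have hn := inv_pos.2 (Complex.normSq_pos.2 (Complex.slitPlane_ne_zero hX))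
    rw [Complex.mem_slitPlane_iff, Complex.inv_re, Complex.inv_im, div_eq_mul_inv, div_eq_mul_inv]
    rcases Complex.mem_slitPlane_iff.1 hX with h | h
    · exact Or.inl (mul_pos h hn)
    · exact Or.inr (mul_ne_zero (neg_ne_zero.2 h) hn.ne')
  rw [div_eq_mul_inv, Complex.mem_slitPlane_iff]
  simp only [Complex.add_re, Complex.re_ofNat, Complex.re_ofReal_mul, Complex.add_im,
    Complex.im_ofNat, Complex.im_ofReal_mul, zero_add]
  rcases hw.eq_or_lt with rfl | hw
  · left; simp
  · rcases Complex.mem_slitPlane_iff.1 hi with h | h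
    · left; positivity
    · right; exact mul_ne_zero hw.ne' h

/-- Every point of the slit plane is a product of two points of the right half plane. -/
theorem exists_factor_of_mem_slitPlane {X : ℂ} (hX : X ∈ Complex.slitPlane) :
    0 < (X + ‖X‖).re ∧ 0 < (X / (X + ‖X‖)).re ∧ X / (X + ‖X‖) * (X + ‖X‖) = X := by
  -- The number `X + ‖X‖` has half the argument of `X`, so it and the quotient both have argument
  -- below `π/2` in modulus.
  have hX0 : X ≠ 0 := Complex.slitPlane_ne_zero hX
  have h1 : 0 < (X + ‖X‖).re := by
    simp only [Complex.add_re, Complex.ofReal_re]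
    have h := Complex.abs_re_le_norm X
    rcases (neg_le_of_abs_le h).eq_or_lt with he | hl
    · exfalso
      have h2 := Complex.sq_norm X
      rw [Complex.normSq_apply] at h2
      have h3 : X.im = 0 := by
        rw [← he] at h2
        nlinarith
      rcases Complex.mem_slitPlane_iff.1 hX with h4 | h4
      · have := norm_nonneg X
        linarith
      · exact h4 h3
    · linarith
  have h0 : X + ‖X‖ ≠ 0 := fun h => by rw [h] at h1; simp at h1
  refine ⟨h1, ?_, div_mul_cancel₀ _ h0⟩
  rw [Complex.div_re, ← add_div]
  refine div_pos ?_ (Complex.normSq_pos.2 h0)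
  have h2 := Complex.sq_norm X
  rw [Complex.normSq_apply] at h2
  simp only [Complex.add_re, Complex.ofReal_re, Complex.add_im, Complex.ofReal_im, add_zero] at *
  have := norm_pos_iff.2 hX0
  nlinarith

/-- The Laplace-type integral `∫_0^∞ e^{-w} w^s (2 + w/X)^s dw`; up to elementary factors it is
`K_{s+1/2}(X)`. -/
def laplaceK (s X : ℂ) : ℂ :=
  ∫ w in Ioi (0 : ℝ), Complex.exp (-w) * (w : ℂ) ^ s * (2 + w / X) ^ s

theorem norm_cpow_le_mul_exp (z s : ℂ) : ‖z ^ s‖ ≤ ‖z‖ ^ s.re * Real.exp (Real.pi * |s.im|) := by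
  refine (Complex.norm_cpow_le z s).trans ?_
  rw [div_eq_mul_inv, ← Real.exp_neg]
  gcongr
  refine (neg_le_abs _).trans ?_
  rw [abs_mul]
  gcongr
  exact Complex.abs_arg_le_pi z

theorem norm_laplaceK_integrand_le (s : ℂ) {ζ a : ℂ} (hζ : 0 < ζ.re) (ha : 0 < a.re) {c b w : ℝ}
    (hc : 0 < c) (hca : c ≤ 2 * a.re / ‖a‖) (hb : ‖ζ * a‖⁻¹ ≤ b) (hw : 0 < w) :
    ‖Complex.exp (-w) * (w : ℂ) ^ s * (2 + w / (ζ * a)) ^ s‖ ≤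
      Real.exp (-w) * w ^ s.re * (c ^ s.re + (2 + b * w) ^ s.re) *
        Real.exp (Real.pi * |s.im|) := by
  rw [norm_mul, norm_mul, Complex.norm_cpow_eq_rpow_re_of_pos hw, ← Complex.ofReal_neg,
    Complex.norm_exp_ofReal, mul_assoc (_ * _)]
  gcongr
  refine (norm_cpow_le_mul_exp _ _).trans ?_
  gcongr
  refine rpow_le_add_of_mem_Icc _ hc (hca.trans (le_norm_two_add_div hζ ha hw.le)) ?_
  refine (norm_add_le _ _).trans ?_
  rw [norm_div, Complex.norm_real, Real.norm_of_nonneg hw.le, div_eq_inv_mul]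
  simp only [Complex.norm_ofNat]
  gcongr

theorem integrableOn_laplaceK_bound {c b σ : ℝ} (τ : ℝ) (hσ : -1 < σ) (hb : 0 ≤ b) :
    IntegrableOn (fun w : ℝ => Real.exp (-w) * w ^ σ * (c ^ τ + (2 + b * w) ^ τ)) (Ioi 0) := by
  have h1 := (integrableOn_exp_mul_rpow_mul_add_rpow (c := 0) 0 hσ one_pos le_rfl).mul_const (c ^ τ)
  have h2 := integrableOn_exp_mul_rpow_mul_add_rpow τ hσ two_pos hb
  refine IntegrableOn.congr_fun (h1.add h2) (fun w _ => ?_) measurableSet_Ioi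
  simp [mul_add]

theorem aestronglyMeasurable_laplaceK_integrand (s X : ℂ) :
    AEStronglyMeasurable (fun w : ℝ => Complex.exp (-w) * (w : ℂ) ^ s * (2 + w / X) ^ s)
      (volume.restrict (Ioi 0)) :=
  Measurable.aestronglyMeasurable (by fun_prop)

theorem differentiableOn_laplaceK_right {s : ℂ} (hs : -1 < s.re) :
    DifferentiableOn ℂ (fun X => laplaceK s X) Complex.slitPlane := by
  refine differentiableOn_integral_of_locally_dominated Complex.isOpen_slitPlane measurableSet_Ioi
    (fun X => aestronglyMeasurable_laplaceK_integrand s X) (fun w hw X hX => ?_) (fun X₀ hX₀ => ?_)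
  · refine DifferentiableAt.differentiableWithinAt ?_
    have hX0 := Complex.slitPlane_ne_zero hX
    refine DifferentiableAt.const_mul ?_ _
    refine DifferentiableAt.cpow_const ?_ (two_add_div_mem_slitPlane hX (le_of_lt hw))
    fun_prop (disch := assumption)
  · obtain ⟨h1, h2, h3⟩ := exists_factor_of_mem_slitPlane hX₀
    set c := 2 * (X₀ + ‖X₀‖).re / ‖X₀ + ‖X₀‖‖ with hc
    have hn : 0 < ‖X₀ + ‖X₀‖‖ := h1.trans_le (Complex.re_le_norm _)
    have hc0 : 0 < c := by positivity
    have hX0 := norm_pos_iff.2 (Complex.slitPlane_ne_zero hX₀)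
    refine ⟨_, (integrableOn_laplaceK_bound (c := c / 2) (b := 2 * ‖X₀‖⁻¹) s.re hs
      (by positivity)).mul_const (Real.exp (Real.pi * |s.im|)), ?_⟩
    have e1 : ∀ᶠ X : ℂ in 𝓝 X₀, c / 2 < 2 * (X + ‖X‖).re / ‖X + ‖X‖‖ := by
      have : ContinuousAt (fun X : ℂ => 2 * (X + ‖X‖).re / ‖X + ‖X‖‖) X₀ := by
        refine ContinuousAt.div ?_ ?_ hn.ne' <;> fun_prop
      exact this.eventually (lt_mem_nhds (half_lt_self hc0))
    have e2 : ∀ᶠ X in 𝓝 X₀, ‖X‖⁻¹ < 2 * ‖X₀‖⁻¹ := by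
      have : ContinuousAt (fun X : ℂ => ‖X‖⁻¹) X₀ := by
        refine ContinuousAt.inv₀ ?_ hX0.ne'; fun_prop
      exact this.eventually (gt_mem_nhds (by have := inv_pos.2 hX0; linarith))
    filter_upwards [e1, e2, Complex.isOpen_slitPlane.mem_nhds hX₀] with X h1 h2 hX w hw
    obtain ⟨f1, f2, f3⟩ := exists_factor_of_mem_slitPlane hX
    have := norm_laplaceK_integrand_le s f2 f1 (half_pos hc0) h1.le (b := 2 * ‖X₀‖⁻¹)
      (by rw [f3]; exact h2.le) hw
    rwa [f3] at this

theorem differentiableOn_laplaceK_left {X : ℂ} (hX : X ∈ Complex.slitPlane) :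
    DifferentiableOn ℂ (fun s => laplaceK s X) {s | -1 < s.re} := by
  have hX0 := Complex.slitPlane_ne_zero hX
  refine differentiableOn_integral_of_locally_dominated
    (isOpen_lt continuous_const Complex.continuous_re) measurableSet_Ioi
    (fun s => aestronglyMeasurable_laplaceK_integrand s X) (fun w hw s _ => ?_) (fun s₀ hs₀ => ?_)
  · refine DifferentiableAt.differentiableWithinAt ?_
    have h1 : (w : ℂ) ≠ 0 := Complex.ofReal_ne_zero.2 (ne_of_gt hw)
    have h2 := Complex.slitPlane_ne_zero (two_add_div_mem_slitPlane hX (le_of_lt hw))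
    refine ((DifferentiableAt.const_cpow differentiableAt_id (Or.inl h1)).const_mul _).mul
      (DifferentiableAt.const_cpow differentiableAt_id (Or.inl h2))
  · have hs₀ : -1 < s₀.re := hs₀
    obtain ⟨f1, f2, f3⟩ := exists_factor_of_mem_slitPlane hX
    set c := 2 * (X + ‖X‖).re / ‖X + ‖X‖‖ with hc
    have hn : 0 < ‖X + ‖X‖‖ := f1.trans_le (Complex.re_le_norm _)
    have hc0 : 0 < c := by positivity
    have hb := fun σ τ hσ => integrableOn_laplaceK_bound (c := c) (b := ‖X‖⁻¹) (σ := σ) τ hσ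
      (by positivity)
    -- The midpoint of `-1` and `Re s₀`, hence still above `-1`. For exponents between `p` and `q`
    -- each power is at most the sum of its values at `p` and `q`, so the product of two powers of
    -- `w` and of the base needs four majorants.
    set p := (s₀.re - 1) / 2
    set q := s₀.re + 1
    refine ⟨_, ((((hb p p (by simp only [p]; linarith)).add (hb p q (by simp only [p]; linarith))).add
      (hb q p (by simp only [q]; linarith))).add (hb q q (by simp only [q]; linarith))).mul_const
      (Real.exp (Real.pi * (|s₀.im| + 1))), ?_⟩
    have e1 : ∀ᶠ s : ℂ in 𝓝 s₀, p < s.re := Complex.continuous_re.continuousAt.eventually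
      (lt_mem_nhds (by simp only [p]; linarith))
    have e2 : ∀ᶠ s : ℂ in 𝓝 s₀, s.re < q := Complex.continuous_re.continuousAt.eventually
      (gt_mem_nhds (by simp only [q]; linarith))
    have e3 : ∀ᶠ s : ℂ in 𝓝 s₀, |s.im| < |s₀.im| + 1 :=
      (Complex.continuous_im.abs).continuousAt.eventually (gt_mem_nhds (by linarith))
    filter_upwards [e1, e2, e3] with s h1 h2 h3 w hw
    have hw : 0 < w := hw
    have := norm_laplaceK_integrand_le s f2 f1 hc0 le_rfl (b := ‖X‖⁻¹) (by rw [f3]) hw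
    rw [f3] at this
    refine this.trans ?_
    have hx : 0 ≤ ‖X‖⁻¹ := by positivity
    have i1 := rpow_le_add_of_exponent_mem_Icc hw h1.le h2.le
    have i2 := rpow_le_add_of_exponent_mem_Icc hc0 h1.le h2.le
    have i3 := rpow_le_add_of_exponent_mem_Icc (show 0 < 2 + ‖X‖⁻¹ * w by positivity) h1.le h2.le
    calc _ ≤ Real.exp (-w) * (w ^ p + w ^ q) * ((c ^ p + c ^ q) +
          ((2 + ‖X‖⁻¹ * w) ^ p + (2 + ‖X‖⁻¹ * w) ^ q)) * Real.exp (Real.pi * (|s₀.im| + 1)) := by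
            gcongr
      _ = _ := by simp only [Pi.add_apply]; ring

/-- One constant serves every `ζ` in the right half plane; it will be applied with `ζ = (2k+2)π ±
iλ` for all `k` at once. -/
theorem exists_norm_laplaceK_le {s : ℝ} (hs : -1 < s) {c b : ℝ} (hc : 0 < c) (hb : 0 ≤ b) :
    ∃ C : ℝ, 0 ≤ C ∧ ∀ ζ a : ℂ, 0 < ζ.re → 0 < a.re → c ≤ 2 * a.re / ‖a‖ → ‖ζ * a‖⁻¹ ≤ b →
      ‖laplaceK s (ζ * a)‖ ≤ C := by
  refine ⟨∫ w in Ioi (0 : ℝ), Real.exp (-w) * w ^ s * (c ^ s + (2 + b * w) ^ s),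
    setIntegral_nonneg measurableSet_Ioi fun w hw => ?_, fun ζ a hζ ha hca hba => ?_⟩
  · have : 0 < w := hw
    positivity
  · refine norm_integral_le_of_norm_le (integrableOn_laplaceK_bound s hs hb) ?_
    refine (ae_restrict_mem measurableSet_Ioi).mono fun w hw => ?_
    simpa using norm_laplaceK_integrand_le s hζ ha hc hca hba hw

theorem conj_cpow_ofReal {z : ℂ} (hz : z.arg ≠ Real.pi) (s : ℝ) :
    starRingEnd ℂ z ^ (s : ℂ) = starRingEnd ℂ (z ^ (s : ℂ)) := by
  rw [Complex.conj_cpow _ _ hz, Complex.conj_ofReal]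

theorem laplaceK_conj {s : ℝ} {X : ℂ} (hX : X ∈ Complex.slitPlane) :
    laplaceK s (starRingEnd ℂ X) = starRingEnd ℂ (laplaceK s X) := by
  rw [laplaceK, laplaceK, ← integral_conj]
  refine setIntegral_congr_fun measurableSet_Ioi fun w hw => ?_
  have hw : 0 < w := hw
  have h : (2 + (w : ℂ) / X).arg ≠ Real.pi :=
    Complex.mem_slitPlane_iff_arg.1 (two_add_div_mem_slitPlane hX hw.le) |>.1
  have h2 : (w : ℂ).arg ≠ Real.pi := by
    rw [Complex.arg_ofReal_of_nonneg hw.le]; exact Real.pi_pos.ne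
  simp only [map_mul]
  rw [← Complex.exp_conj, ← conj_cpow_ofReal h, ← conj_cpow_ofReal h2]
  have h3 : starRingEnd ℂ 2 = 2 := Complex.conj_ofReal 2
  simp [h3]

/-! ### The Laplace integral over `(1, ∞)`: the substitution `t = 1 + w/x` and differential
relations. -/

theorem image_one_add_div_Ioi {x : ℝ} (hx : 0 < x) : (fun w => 1 + w / x) '' Ioi 0 = Ioi 1 := by
  ext t
  constructor
  · rintro ⟨w, hw, rfl⟩
    have : 0 < w / x := div_pos hw hx
    exact (lt_add_iff_pos_right 1).2 this
  · intro ht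
    have ht : 1 < t := ht
    exact ⟨x * (t - 1), mul_pos hx (sub_pos.2 ht), by field_simp; ring⟩

theorem hasDerivAt_one_add_div (x w : ℝ) : HasDerivAt (fun w => 1 + w / x) x⁻¹ w := by
  simpa using ((hasDerivAt_id w).div_const x).const_add 1

theorem injOn_one_add_div {x : ℝ} (hx : 0 < x) : InjOn (fun w => 1 + w / x) (Ioi 0) := by
  intro w _ v _ h
  simpa [hx.ne'] using h

theorem integrableOn_Ioi_one_iff {x : ℝ} (hx : 0 < x) (g : ℝ → ℂ) :
    IntegrableOn g (Ioi 1) ↔ IntegrableOn (fun w => g (1 + w / x)) (Ioi 0) := by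
  rw [← image_one_add_div_Ioi hx, integrableOn_image_iff_integrableOn_abs_deriv_smul
    measurableSet_Ioi (fun w _ => (hasDerivAt_one_add_div x w).hasDerivWithinAt)
    (injOn_one_add_div hx)]
  exact integrable_smul_iff (abs_pos.2 (inv_ne_zero hx.ne')).ne' _

theorem integral_Ioi_one_eq {x : ℝ} (hx : 0 < x) (g : ℝ → ℂ) :
    ∫ t in Ioi (1 : ℝ), g t = x⁻¹ * ∫ w in Ioi (0 : ℝ), g (1 + w / x) := by
  rw [← image_one_add_div_Ioi hx, integral_image_eq_integral_abs_deriv_smul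
    measurableSet_Ioi (fun w _ => (hasDerivAt_one_add_div x w).hasDerivWithinAt)
    (injOn_one_add_div hx), integral_smul, abs_of_pos (inv_pos.2 hx)]
  simp

/-- The Laplace integral `∫_1^∞ e^{-Xt} (t² - 1)^s dt`. -/
def laplaceTail (s : ℝ) (X : ℂ) : ℂ :=
  ∫ t in Ioi (1 : ℝ), Complex.exp (-(X * t)) * (((t ^ 2 - 1) ^ s : ℝ) : ℂ)

theorem sq_sub_one_rpow {x w : ℝ} (s : ℝ) (hx : 0 < x) (hw : 0 < w) :
    ((1 + w / x) ^ 2 - 1) ^ s = x ^ (-(2 * s)) * (w ^ s * (2 * x + w) ^ s) := by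
  rw [show (1 + w / x) ^ 2 - 1 = (x ^ 2)⁻¹ * (w * (2 * x + w)) by field_simp; ring,
    Real.mul_rpow (by positivity) (by positivity), Real.mul_rpow hw.le (by positivity),
    Real.inv_rpow (by positivity), ← Real.rpow_natCast, ← Real.rpow_mul hx.le, Real.rpow_neg hx.le]
  norm_num

theorem laplaceTail_integrand_comp {s x w : ℝ} (hx : 0 < x) (hw : 0 < w) :
    Complex.exp (-(x * (1 + w / x : ℝ))) * ((((1 + w / x) ^ 2 - 1) ^ s : ℝ) : ℂ) =
      ((Real.exp (-x) * x ^ (-(2 * s)) : ℝ) : ℂ) *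
        ((Real.exp (-w) * w ^ s * (2 * x + w) ^ s : ℝ) : ℂ) := by
  rw [sq_sub_one_rpow s hx hw, show -((x : ℂ) * (1 + w / x : ℝ)) = ((-x + -w : ℝ) : ℂ) by
    push_cast
    have : (x : ℂ) ≠ 0 := Complex.ofReal_ne_zero.2 hx.ne'
    field_simp
    ring, ← Complex.ofReal_exp, Real.exp_add]
  push_cast
  ring

theorem integrableOn_laplaceTail_ofReal {s x : ℝ} (hs : -1 < s) (hx : 0 < x) :
    IntegrableOn (fun t : ℝ => Complex.exp (-((x : ℂ) * t)) * (((t ^ 2 - 1) ^ s : ℝ) : ℂ))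
      (Ioi 1) := by
  rw [integrableOn_Ioi_one_iff hx]
  have h := (integrableOn_exp_mul_rpow_mul_add_rpow (b := 2 * x) (c := 1) s hs (by positivity)
    zero_le_one).ofReal (𝕜 := ℂ)
  refine IntegrableOn.congr_fun (h.const_mul ((Real.exp (-x) * x ^ (-(2 * s)) : ℝ) : ℂ))
    (fun w hw => ?_) measurableSet_Ioi
  rw [laplaceTail_integrand_comp hx hw]
  simp

theorem laplaceTail_ofReal {s x : ℝ} (hx : 0 < x) :
    laplaceTail s x = ((Real.exp (-x) * x ^ (-(2 * s + 1)) *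
      ∫ w in Ioi (0 : ℝ), Real.exp (-w) * w ^ s * (2 * x + w) ^ s : ℝ) : ℂ) := by
  rw [laplaceTail, integral_Ioi_one_eq hx, setIntegral_congr_fun measurableSet_Ioi
    (fun w hw => laplaceTail_integrand_comp hx hw), integral_const_mul,
    Complex.ofReal_mul (Real.exp (-x) * x ^ (-(2 * s + 1))), ← integral_complex_ofReal, neg_add, Real.rpow_add hx, Real.rpow_neg_one]
  push_cast
  ring

theorem laplaceK_ofReal {s x : ℝ} (hx : 0 < x) :
    laplaceK s x = ((x ^ (-s) * ∫ w in Ioi (0 : ℝ), Real.exp (-w) * w ^ s * (2 * x + w) ^ s : ℝ) :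
      ℂ) := by
  rw [laplaceK, Complex.ofReal_mul, ← integral_complex_ofReal, ← integral_const_mul]
  refine setIntegral_congr_fun measurableSet_Ioi fun w hw => ?_
  have hw : 0 < w := hw
  have : (2 + w / x) = x⁻¹ * (2 * x + w) := by field_simp
  rw [← Complex.ofReal_cpow hw.le, show 2 + (w : ℂ) / x = ((2 + w / x : ℝ) : ℂ) by push_cast; rfl,
    ← Complex.ofReal_cpow (by positivity), this, Real.mul_rpow (by positivity) (by positivity),
    Real.inv_rpow hx.le, Real.rpow_neg hx.le]
  push_cast
  ring

theorem norm_exp_neg_mul_ofReal_le {X : ℂ} {r t : ℝ} (hr : r ≤ X.re) (ht : 0 ≤ t) :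
    ‖Complex.exp (-(X * t))‖ ≤ Real.exp (-(r * t)) := by
  rw [Complex.norm_exp]
  simp only [Complex.neg_re, Complex.mul_re, Complex.ofReal_re, Complex.ofReal_im, mul_zero,
    sub_zero]
  gcongr

theorem norm_laplaceTail_integrand_le {s : ℝ} {X : ℂ} {r t : ℝ} (hr : r ≤ X.re) (ht : 1 < t) :
    ‖Complex.exp (-(X * t)) * (((t ^ 2 - 1) ^ s : ℝ) : ℂ)‖ ≤
      ‖Complex.exp (-((r : ℂ) * t)) * (((t ^ 2 - 1) ^ s : ℝ) : ℂ)‖ := by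
  rw [norm_mul, norm_mul]
  gcongr ?_ * _
  refine (norm_exp_neg_mul_ofReal_le hr (by linarith)).trans (le_of_eq ?_)
  rw [Complex.norm_exp]
  simp

theorem aestronglyMeasurable_laplaceTail_integrand (s : ℝ) (X : ℂ) :
    AEStronglyMeasurable (fun t : ℝ => Complex.exp (-(X * t)) * (((t ^ 2 - 1) ^ s : ℝ) : ℂ))
      (volume.restrict (Ioi 1)) :=
  Measurable.aestronglyMeasurable (by fun_prop)

theorem integrableOn_laplaceTail {s : ℝ} {X : ℂ} (hs : -1 < s) (hX : 0 < X.re) :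
    IntegrableOn (fun t : ℝ => Complex.exp (-(X * t)) * (((t ^ 2 - 1) ^ s : ℝ) : ℂ)) (Ioi 1) :=
  Integrable.mono' (integrableOn_laplaceTail_ofReal hs hX).norm
    (aestronglyMeasurable_laplaceTail_integrand s X)
    ((ae_restrict_mem measurableSet_Ioi).mono fun _ ht => norm_laplaceTail_integrand_le le_rfl ht)

theorem isOpen_re_pos : IsOpen {z : ℂ | 0 < z.re} :=
  isOpen_lt continuous_const Complex.continuous_re

theorem isPreconnected_re_pos : IsPreconnected {z : ℂ | 0 < z.re} :=
  (convex_halfSpace_re_gt 0).isPreconnected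

theorem hasDerivAt_laplaceTail_integrand (s : ℝ) (X : ℂ) (t : ℝ) :
    HasDerivAt (fun X : ℂ => Complex.exp (-(X * t)) * (((t ^ 2 - 1) ^ s : ℝ) : ℂ))
      (-(t * (Complex.exp (-(X * t)) * (((t ^ 2 - 1) ^ s : ℝ) : ℂ)))) X := by
  have := (((hasDerivAt_id X).mul_const (t : ℂ)).neg.cexp).mul_const (((t ^ 2 - 1) ^ s : ℝ) : ℂ)
  refine this.congr_deriv ?_
  simp
  ring

theorem hasDerivAt_laplaceTail {s : ℝ} {X : ℂ} (hs : -1 < s) (hX : 0 < X.re) :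
    HasDerivAt (laplaceTail s)
      (-∫ t in Ioi (1 : ℝ), t * (Complex.exp (-(X * t)) * (((t ^ 2 - 1) ^ s : ℝ) : ℂ))) X := by
  have h := hasDerivAt_integral_of_locally_dominated isOpen_re_pos measurableSet_Ioi
    (fun X => aestronglyMeasurable_laplaceTail_integrand s X)
    (fun t _ X _ => (hasDerivAt_laplaceTail_integrand s X
      t).differentiableAt.differentiableWithinAt) (show X ∈ {z : ℂ | 0 < z.re} from hX)
    (integrableOn_laplaceTail_ofReal hs (half_pos hX)).norm ?_
  · rw [← integral_neg]
    have h' : HasDerivAt (laplaceTail s) _ X := h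
    simpa only [(hasDerivAt_laplaceTail_integrand s X _).deriv] using h'
  · filter_upwards [Complex.continuous_re.continuousAt.eventually
      (lt_mem_nhds (half_lt_self hX))] with Y hY t ht
    exact norm_laplaceTail_integrand_le hY.le ht

/-- For real `X` this is the substitution `t = 1 + w/X`; complex `X` follow by the identity theorem,
with no deformation of the contour. -/
theorem laplaceTail_eq_laplaceK {s : ℝ} (hs : -1 < s) {X : ℂ} (hX : 0 < X.re) :
    laplaceTail s X = Complex.exp (-X) * X ^ ((-(s + 1) : ℝ) : ℂ) * laplaceK s X := by
  have hsub : {z : ℂ | 0 < z.re} ⊆ Complex.slitPlane := fun z hz => Or.inl hz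
  refine eqOn_of_eq_on_real_Ioo (g := fun X => Complex.exp (-X) * X ^ ((-(s + 1) : ℝ) : ℂ) *
    laplaceK s X) isOpen_re_pos isPreconnected_re_pos
    (fun X hX => (hasDerivAt_laplaceTail hs hX).differentiableAt.differentiableWithinAt) ?_
    (zero_lt_one) (fun x hx _ => by simpa using hx) (fun x hx _ => ?_) hX
  · refine DifferentiableOn.mul (fun X hX => ?_)
      ((differentiableOn_laplaceK_right (by simpa using hs)).mono hsub)
    refine DifferentiableAt.differentiableWithinAt (DifferentiableAt.mul (by fun_prop) ?_)
    exact differentiableAt_id.cpow_const (hsub hX)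
  · rw [laplaceTail_ofReal hx, laplaceK_ofReal hx, ← Complex.ofReal_cpow hx.le,
      ← Complex.ofReal_neg, ← Complex.ofReal_exp, show -(2 * s + 1) = -(s + 1) + -s by ring,
      Real.rpow_add hx]
    push_cast
    ring

theorem integrableOn_mul_laplaceTail {s : ℝ} {X : ℂ} (hs : -1 < s) (hX : 0 < X.re) :
    IntegrableOn (fun t : ℝ => t * (Complex.exp (-(X * t)) * (((t ^ 2 - 1) ^ s : ℝ) : ℂ)))
      (Ioi 1) := by
  refine Integrable.mono' ((integrableOn_laplaceTail_ofReal hs (half_pos hX)).norm.const_mul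
    (2 / X.re)) (Measurable.aestronglyMeasurable (by fun_prop))
    ((ae_restrict_mem measurableSet_Ioi).mono fun t ht => ?_)
  have ht : 1 < t := ht
  rw [norm_mul, norm_mul, norm_mul, ← mul_assoc, ← mul_assoc, Complex.norm_real,
    Real.norm_of_nonneg (by linarith)]
  gcongr ?_ * _
  rw [Complex.norm_exp, Complex.norm_exp]
  simp only [Complex.neg_re, Complex.mul_re, Complex.ofReal_re, Complex.ofReal_im, mul_zero,
    sub_zero]
  have h1 : X.re / 2 * t ≤ Real.exp (X.re / 2 * t) := by
    have := Real.add_one_le_exp (X.re / 2 * t); linarith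
  have h2 : t ≤ 2 / X.re * Real.exp (X.re / 2 * t) := by
    rw [div_mul_eq_mul_div, le_div_iff₀ hX]
    linarith
  calc t * Real.exp (-(X.re * t)) ≤ 2 / X.re * Real.exp (X.re / 2 * t) * Real.exp (-(X.re * t)) := by
        gcongr
    _ = _ := by
      rw [mul_assoc, ← Real.exp_add]
      congr 2
      ring

theorem hasDerivAt_ofReal_sq_sub_one_rpow {s t : ℝ} (ht : 1 < t) :
    HasDerivAt (fun t : ℝ => (((t ^ 2 - 1) ^ (s + 1) : ℝ) : ℂ))
      (2 * (s + 1) * t * (((t ^ 2 - 1) ^ s : ℝ) : ℂ)) t := by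
  have h1 : t ^ 2 - 1 ≠ 0 := by nlinarith
  have h := ((((hasDerivAt_id t).pow 2).sub_const 1).rpow_const (p := s + 1) (Or.inl h1)).ofReal_comp
  refine h.congr_deriv ?_
  simp
  left
  ring

theorem sq_sub_one_rpow_add_one {s t : ℝ} (ht : 1 < t) :
    (((t ^ 2 - 1) ^ (s + 1) : ℝ) : ℂ) = ((t : ℂ) ^ 2 - 1) * (((t ^ 2 - 1) ^ s : ℝ) : ℂ) := by
  have h1 : 0 < t ^ 2 - 1 := by nlinarith
  rw [Real.rpow_add_one h1.ne']
  push_cast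
  ring

theorem hasDerivAt_cexp_neg_mul_ofReal (X : ℂ) (t : ℝ) :
    HasDerivAt (fun t : ℝ => Complex.exp (-(X * t))) (-X * Complex.exp (-(X * t))) t := by
  have := ((Complex.ofRealCLM.hasDerivAt (x := t)).const_mul X).neg.cexp
  refine this.congr_deriv ?_
  simp
  ring

/-- The factor `t` is included so that one limit disposes of the boundary terms at infinity in both
integrations by parts below. -/
theorem tendsto_exp_mul_sq_sub_one_rpow {X : ℂ} (hX : 0 < X.re) (s : ℝ) :
    Tendsto (fun t : ℝ => t * (Complex.exp (-(X * t)) * (((t ^ 2 - 1) ^ (s + 1) : ℝ) : ℂ))) atTop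
      (𝓝 0) := by
  rw [tendsto_zero_iff_norm_tendsto_zero]
  have h := tendsto_rpow_mul_exp_neg_mul_atTop_nhds_zero (2 * |s + 1| + 1) X.re hX
  refine squeeze_zero' (Eventually.of_forall fun _ => norm_nonneg _) ?_ h
  filter_upwards [eventually_ge_atTop 2] with t ht
  rw [norm_mul, norm_mul, Complex.norm_exp, Complex.norm_real, Complex.norm_real,
    Real.norm_of_nonneg (by linarith), Real.norm_of_nonneg (Real.rpow_nonneg (by nlinarith) _)]
  simp only [Complex.neg_re, Complex.mul_re, Complex.ofReal_re, Complex.ofReal_im, mul_zero,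
    sub_zero]
  have h1 : (t ^ 2 - 1) ^ (s + 1) ≤ t ^ (2 * |s + 1|) := by
    have h1 : 1 ≤ t ^ 2 - 1 := by nlinarith
    calc (t ^ 2 - 1) ^ (s + 1) ≤ (t ^ 2 - 1) ^ |s + 1| :=
          Real.rpow_le_rpow_of_exponent_le h1 (le_abs_self _)
      _ ≤ (t ^ 2) ^ |s + 1| := Real.rpow_le_rpow (by linarith) (by linarith) (abs_nonneg _)
      _ = _ := by rw [← Real.rpow_natCast, ← Real.rpow_mul (by linarith)]; norm_num
  have h2 : t ^ (2 * |s + 1| + 1) = t ^ (2 * |s + 1|) * t := Real.rpow_add_one (by positivity) _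
  rw [h2]
  calc _ ≤ t * (Real.exp (-(X.re * t)) * t ^ (2 * |s + 1|)) := by gcongr
    _ = _ := by rw [neg_mul]; ring

theorem continuousAt_ofReal_sq_sub_one_rpow {s : ℝ} (hs : -1 < s) :
    ContinuousAt (fun t : ℝ => (((t ^ 2 - 1) ^ (s + 1) : ℝ) : ℂ)) 1 := by
  refine Complex.continuous_ofReal.continuousAt.comp ?_
  exact ContinuousAt.rpow_const (by fun_prop) (Or.inr (by linarith))

/-- Integration by parts, as `2(s+1) t (t²-1)^s` is the derivative of `(t²-1)^{s+1}`. The boundary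
term at `1` vanishes because `s + 1 > 0`. -/
theorem integral_mul_laplaceTail {s : ℝ} {X : ℂ} (hs : -1 < s) (hX : 0 < X.re) :
    2 * (s + 1) * ∫ t in Ioi (1 : ℝ), t * (Complex.exp (-(X * t)) * (((t ^ 2 - 1) ^ s : ℝ) : ℂ)) =
      X * laplaceTail (s + 1) X := by
  have h := integral_Ioi_of_hasDerivAt_of_tendsto (a := 1) (m := 0)
    (f := fun t : ℝ => Complex.exp (-(X * t)) * (((t ^ 2 - 1) ^ (s + 1) : ℝ) : ℂ))
    (f' := fun t : ℝ => 2 * (s + 1) *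
        (t * (Complex.exp (-(X * t)) * (((t ^ 2 - 1) ^ s : ℝ) : ℂ))) -
      X * (Complex.exp (-(X * t)) * (((t ^ 2 - 1) ^ (s + 1) : ℝ) : ℂ))) ?_ ?_ ?_ ?_
  · rw [integral_sub ((integrableOn_mul_laplaceTail hs hX).const_mul _)
      ((integrableOn_laplaceTail (by linarith) hX).const_mul _), integral_const_mul,
      integral_const_mul] at h
    have h0 : ((1 : ℝ) ^ 2 - 1) ^ (s + 1) = 0 := by
      rw [one_pow, sub_self, Real.zero_rpow (by linarith)]
    rw [h0, Complex.ofReal_zero, mul_zero, sub_zero] at h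
    rw [laplaceTail]
    linear_combination h
  · refine ContinuousAt.continuousWithinAt ?_
    exact (hasDerivAt_cexp_neg_mul_ofReal X 1).continuousAt.mul
      (continuousAt_ofReal_sq_sub_one_rpow hs)
  · intro t ht
    refine ((hasDerivAt_cexp_neg_mul_ofReal X t).mul
      (hasDerivAt_ofReal_sq_sub_one_rpow ht)).congr_deriv ?_
    ring
  · exact ((integrableOn_mul_laplaceTail hs hX).const_mul _).sub
      ((integrableOn_laplaceTail (by linarith) hX).const_mul _)
  · have h := tendsto_exp_mul_sq_sub_one_rpow hX s
    rw [tendsto_zero_iff_norm_tendsto_zero] at h ⊢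
    refine squeeze_zero' (Eventually.of_forall fun _ => norm_nonneg _) ?_ h
    filter_upwards [eventually_ge_atTop 1] with t ht
    rw [norm_mul (t : ℂ), Complex.norm_real, Real.norm_of_nonneg (by linarith)]
    exact le_mul_of_one_le_left (norm_nonneg _) ht

theorem hasDerivAt_laplaceTail' {s : ℝ} {X : ℂ} (hs : -1 < s) (hX : 0 < X.re) :
    HasDerivAt (laplaceTail s) (-(X / (2 * (s + 1)) * laplaceTail (s + 1) X)) X := by
  have h0 : (s : ℂ) + 1 ≠ 0 := by
    rw [← Complex.ofReal_one, ← Complex.ofReal_add]; exact Complex.ofReal_ne_zero.2 (by linarith)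
  convert hasDerivAt_laplaceTail hs hX using 1
  rw [div_mul_eq_mul_div, ← integral_mul_laplaceTail hs hX,
    mul_div_cancel_left₀ _ (mul_ne_zero two_ne_zero h0)]

/-- With `hasDerivAt_laplaceTail'` this is the first-order system equivalent to the modified Bessel
equation. -/
theorem laplaceTail_add_one_relation {s : ℝ} {X : ℂ} (hs : -1 < s) (hX : 0 < X.re) :
    HasDerivAt (fun X => X * laplaceTail (s + 1) X)
      (-(2 * (s + 1)) * (laplaceTail (s + 1) X + laplaceTail s X)) X := by
  have hs' : -1 < s + 1 := by linarith
  have hd := hasDerivAt_laplaceTail hs' hX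
  refine ((hasDerivAt_id X).mul hd).congr_deriv ?_
  have i0 := integrableOn_laplaceTail hs hX
  have i1 := integrableOn_laplaceTail hs' hX
  have i2 := integrableOn_mul_laplaceTail hs' hX
  -- In the derivative of `t e^{-Xt} (t²-1)^{s+1}` the factor `t²` is written `(t²-1) + 1`; hence
  -- the coefficient `2s + 3 = 1 + 2(s+1)`.
  have h := integral_Ioi_of_hasDerivAt_of_tendsto (a := 1) (m := 0)
    (f := fun t : ℝ => t * (Complex.exp (-(X * t)) * (((t ^ 2 - 1) ^ (s + 1) : ℝ) : ℂ)))
    (f' := fun t : ℝ =>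
      ((2 * s + 3) * (Complex.exp (-(X * t)) * (((t ^ 2 - 1) ^ (s + 1) : ℝ) : ℂ)) -
      X * (t * (Complex.exp (-(X * t)) * (((t ^ 2 - 1) ^ (s + 1) : ℝ) : ℂ)))) +
      2 * (s + 1) * (Complex.exp (-(X * t)) * (((t ^ 2 - 1) ^ s : ℝ) : ℂ))) ?_ ?_ ?_ ?_
  · have e := integral_add ((i1.const_mul (2 * s + 3 : ℂ)).sub (i2.const_mul X))
      (i0.const_mul (2 * (s + 1) : ℂ))
    simp only [Pi.sub_apply] at e
    rw [e, integral_sub (i1.const_mul _) (i2.const_mul _), integral_const_mul, integral_const_mul,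
      integral_const_mul] at h
    have h0 : ((1 : ℝ) ^ 2 - 1) ^ (s + 1) = 0 := by
      rw [one_pow, sub_self, Real.zero_rpow (by linarith)]
    rw [h0, Complex.ofReal_zero, mul_zero, mul_zero, sub_zero] at h
    simp only [laplaceTail, id]
    linear_combination h
  · refine ContinuousAt.continuousWithinAt ?_
    exact Complex.continuous_ofReal.continuousAt.mul
      ((hasDerivAt_cexp_neg_mul_ofReal X 1).continuousAt.mul
        (continuousAt_ofReal_sq_sub_one_rpow hs))
  · intro t ht
    refine ((Complex.ofRealCLM.hasDerivAt (x := t)).mul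
      ((hasDerivAt_cexp_neg_mul_ofReal X t).mul
      (hasDerivAt_ofReal_sq_sub_one_rpow ht))).congr_deriv ?_
    simp only [Complex.ofRealCLM_apply, Pi.mul_apply, sq_sub_one_rpow_add_one ht]
    push_cast
    ring
  · exact ((i1.const_mul _).sub (i2.const_mul _)).add (i0.const_mul _)
  · exact tendsto_exp_mul_sq_sub_one_rpow hX s

/-! ### Beta integrals and the behaviour of the Laplace integral at the origin. -/

theorem integrableOn_beta {α β : ℝ} (hα : 0 < α) (hβ : 0 < β) :
    IntegrableOn (fun u : ℝ => u ^ (α - 1) * (1 - u) ^ (β - 1)) (Ioo 0 1) := by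
  have h := Complex.betaIntegral_convergent (u := α) (v := β) (by simpa) (by simpa)
  rw [intervalIntegrable_iff_integrableOn_Ioo_of_le zero_le_one] at h
  refine IntegrableOn.congr_fun (Integrable.re h) (fun u hu => ?_) measurableSet_Ioo
  rw [← Complex.ofReal_one, ← Complex.ofReal_sub, ← Complex.ofReal_sub, ← Complex.ofReal_sub,
    ← Complex.ofReal_cpow hu.1.le, ← Complex.ofReal_cpow (sub_nonneg.2 hu.2.le),
    ← Complex.ofReal_mul]
  simp

theorem integral_beta {α β : ℝ} (hα : 0 < α) (hβ : 0 < β) :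
    ∫ u in Ioo (0 : ℝ) 1, u ^ (α - 1) * (1 - u) ^ (β - 1) =
      Real.Gamma α * Real.Gamma β / Real.Gamma (α + β) := by
  have h := Complex.betaIntegral_eq_Gamma_mul_div α β (by simpa) (by simpa)
  rw [Complex.betaIntegral, intervalIntegral.integral_of_le zero_le_one,
    integral_Ioc_eq_integral_Ioo] at h
  have h2 : ∫ u in Ioo (0 : ℝ) 1, (u : ℂ) ^ ((α : ℂ) - 1) * (1 - u) ^ ((β : ℂ) - 1) =
      ∫ u in Ioo (0 : ℝ) 1, ((u ^ (α - 1) * (1 - u) ^ (β - 1) : ℝ) : ℂ) := by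
    refine setIntegral_congr_fun measurableSet_Ioo fun u hu => ?_
    rw [Complex.ofReal_mul, Complex.ofReal_cpow hu.1.le,
      Complex.ofReal_cpow (sub_nonneg.2 hu.2.le)]
    push_cast
    rfl
  rw [h2, integral_complex_ofReal] at h
  apply Complex.ofReal_injective
  rw [h]
  push_cast
  simp only [← Complex.Gamma_ofReal]
  push_cast
  rfl

theorem image_rpow_neg_half : (fun u : ℝ => u ^ (-(1 / 2) : ℝ)) '' Ioo 0 1 = Ioi 1 := by
  ext t
  constructor
  · rintro ⟨u, hu, rfl⟩
    exact Real.one_lt_rpow_of_pos_of_lt_one_of_neg hu.1 hu.2 (by norm_num)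
  · intro ht
    have ht : 1 < t := ht
    refine ⟨t ^ (-2 : ℝ), ⟨by positivity, Real.rpow_lt_one_of_one_lt_of_neg ht (by norm_num)⟩, ?_⟩
    simp only
    rw [← Real.rpow_mul (by linarith)]
    norm_num

theorem beta_tail_subst {s u : ℝ} (hu : u ∈ Ioo (0 : ℝ) 1) :
    |(-(1 / 2) : ℝ) * u ^ (-(1 / 2) - 1 : ℝ)| • (((u ^ (-(1 / 2) : ℝ)) ^ 2 - 1) ^ s) =
      1 / 2 * (u ^ (-s - 1 / 2 - 1) * (1 - u) ^ (s + 1 - 1)) := by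
  have hu0 := hu.1
  have h1 : (u ^ (-(1 / 2) : ℝ)) ^ 2 - 1 = u ^ (-1 : ℝ) * (1 - u) := by
    rw [← Real.rpow_natCast, ← Real.rpow_mul hu0.le, mul_sub, ← Real.rpow_add_one hu0.ne']
    norm_num
  rw [h1, Real.mul_rpow (by positivity) (sub_nonneg.2 hu.2.le), ← Real.rpow_mul hu0.le, abs_mul,
    abs_of_pos (show 0 < u ^ (-(1 / 2) - 1 : ℝ) by positivity), smul_eq_mul,
    show -s - 1 / 2 - 1 = (-(1 / 2) - 1) + -1 * s by ring, Real.rpow_add hu0]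
  norm_num
  ring

/-- The substitution `t = u^{-1/2}` gives a beta integral; `s > -1` is convergence at `1`, and `s <
-1/2` convergence at infinity. -/
theorem integrableOn_and_integral_beta_tail {s : ℝ} (hs : -1 < s) (hs' : s < -(1 / 2)) :
    IntegrableOn (fun t : ℝ => (t ^ 2 - 1) ^ s) (Ioi 1) ∧
      ∫ t in Ioi (1 : ℝ), (t ^ 2 - 1) ^ s =
        1 / 2 * (Real.Gamma (-s - 1 / 2) * Real.Gamma (s + 1) / Real.Gamma (1 / 2)) := by
  have hd : ∀ u ∈ Ioo (0 : ℝ) 1, HasDerivWithinAt (fun u : ℝ => u ^ (-(1 / 2) : ℝ))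
      (-(1 / 2) * u ^ (-(1 / 2) - 1 : ℝ)) (Ioo 0 1) u := fun u hu =>
    (Real.hasDerivAt_rpow_const (Or.inl hu.1.ne')).hasDerivWithinAt
  have hi : InjOn (fun u : ℝ => u ^ (-(1 / 2) : ℝ)) (Ioo 0 1) :=
    (Real.rpow_left_injOn (by norm_num)).mono fun u hu => hu.1.le
  have ha : 0 < -s - 1 / 2 := by linarith
  have hb : 0 < s + 1 := by linarith
  rw [← image_rpow_neg_half, integrableOn_image_iff_integrableOn_abs_deriv_smul measurableSet_Ioo
    hd hi, integral_image_eq_integral_abs_deriv_smul measurableSet_Ioo hd hi,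
    setIntegral_congr_fun measurableSet_Ioo (fun u hu => beta_tail_subst hu), integral_const_mul,
    integral_beta ha hb]
  constructor
  · exact IntegrableOn.congr_fun ((integrableOn_beta ha hb).const_mul (1 / 2))
      (fun u hu => (beta_tail_subst hu).symm) measurableSet_Ioo
  · congr 4
    ring

theorem tendsto_laplaceTail_zero {s : ℝ} (hs : -1 < s) (hs' : s < -(1 / 2)) :
    Tendsto (fun x : ℝ => laplaceTail s x) (𝓝[>] 0)
      (𝓝 ((1 / 2 * (Real.Gamma (-s - 1 / 2) * Real.Gamma (s + 1) / Real.Gamma (1 / 2)) : ℝ) :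
        ℂ)) := by
  obtain ⟨hi, he⟩ := integrableOn_and_integral_beta_tail hs hs'
  rw [← he, ← integral_complex_ofReal]
  refine tendsto_integral_filter_of_dominated_convergence _
    (Eventually.of_forall fun x => aestronglyMeasurable_laplaceTail_integrand s x) ?_ hi ?_
  · filter_upwards [self_mem_nhdsWithin] with x hx
    refine (ae_restrict_mem measurableSet_Ioi).mono fun t ht => ?_
    have ht : 1 < t := ht
    have hx : 0 < x := hx
    rw [norm_mul, Complex.norm_real, Real.norm_of_nonneg (Real.rpow_nonneg (by nlinarith) _)]
    refine mul_le_of_le_one_left (Real.rpow_nonneg (by nlinarith) _) ?_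
    refine (norm_exp_neg_mul_ofReal_le (r := 0) (by simpa using hx.le) (by linarith)).trans ?_
    simp
  · refine Eventually.of_forall fun t => ?_
    have : Continuous fun x : ℝ => Complex.exp (-((x : ℂ) * t)) * (((t ^ 2 - 1) ^ s : ℝ) : ℂ) := by
      fun_prop
    have := (this.tendsto 0).mono_left (nhdsWithin_le_nhds (s := Ioi 0))
    simpa using this

/-- Once the power of `x` is scaled out, the integrand `e^{-w} w^σ (2x + w)^σ` tends to `e^{-w}
w^{2σ}`, a Gamma integrand. -/
theorem tendsto_rpow_mul_laplaceTail {σ : ℝ} (hσ : 0 < σ) :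
    Tendsto (fun x : ℝ => ((x ^ (2 * σ + 1) : ℝ) : ℂ) * laplaceTail σ x) (𝓝[>] 0)
      (𝓝 (Real.Gamma (2 * σ + 1) : ℂ)) := by
  have h1 : Tendsto (fun x : ℝ => ∫ w in Ioi (0 : ℝ), Real.exp (-w) * w ^ σ * (2 * x + w) ^ σ)
      (𝓝[>] 0) (𝓝 (Real.Gamma (2 * σ + 1))) := by
    have e : Real.Gamma (2 * σ + 1) =
        ∫ w in Ioi (0 : ℝ), Real.exp (-w) * w ^ σ * (2 * 0 + w) ^ σ := by
      rw [Real.Gamma_eq_integral (by linarith)]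
      refine setIntegral_congr_fun measurableSet_Ioi fun w hw => ?_
      have hw : 0 < w := hw
      simp only [mul_zero, zero_add, add_sub_cancel_right]
      rw [mul_assoc, ← Real.rpow_add hw, two_mul]
    rw [e]
    refine tendsto_integral_filter_of_dominated_convergence _
      (Eventually.of_forall fun x => Measurable.aestronglyMeasurable (by fun_prop)) ?_
      (integrableOn_exp_mul_rpow_mul_add_rpow (s := σ) (b := 2) (c := 1) σ (by linarith) two_pos
        zero_le_one) ?_
    · filter_upwards [Ioo_mem_nhdsGT (zero_lt_one' ℝ)] with x hx
      refine (ae_restrict_mem measurableSet_Ioi).mono fun w hw => ?_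
      have hw : 0 < w := hw
      have := hx.1
      rw [Real.norm_of_nonneg (by positivity)]
      gcongr
      · linarith [hx.2]
      · linarith
    · refine (ae_restrict_mem measurableSet_Ioi).mono fun w hw => ?_
      have : Continuous fun x : ℝ => Real.exp (-w) * w ^ σ * (2 * x + w) ^ σ :=
        continuous_const.mul (Continuous.rpow_const (by fun_prop) fun x => Or.inr hσ.le)
      exact (this.tendsto 0).mono_left nhdsWithin_le_nhds
  have h2 : Tendsto (fun x : ℝ => Real.exp (-x)) (𝓝[>] 0) (𝓝 1) := by
    have : Continuous fun x : ℝ => Real.exp (-x) := by fun_prop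
    simpa using (this.tendsto 0).mono_left (nhdsWithin_le_nhds (s := Ioi 0))
  have h3 := (Complex.continuous_ofReal.tendsto _).comp (h2.mul h1)
  rw [one_mul] at h3
  refine h3.congr' ?_
  filter_upwards [self_mem_nhdsWithin] with x hx
  have hx : 0 < x := hx
  rw [laplaceTail_ofReal hx, ← Complex.ofReal_mul, Function.comp_apply]
  congr 1
  rw [Real.rpow_neg hx.le]
  have : 0 < x ^ (2 * σ + 1) := by positivity
  field_simp

/-! ### Wronskians and the connection formula near the origin. -/

/-- Pairs `(D, x^q D')` for the solutions `D` of the modified Bessel equation in the form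
`(x^q D')' = x^q D` on the positive half line. -/
def IsBesselPair (q : ℝ) (D M : ℝ → ℂ) : Prop :=
  ∀ x : ℝ, 0 < x → HasDerivAt D (((x ^ (-q) : ℝ) : ℂ) * M x) x ∧
    HasDerivAt M (((x ^ q : ℝ) : ℂ) * D x) x

theorem IsBesselPair.sub {q : ℝ} {D M A N : ℝ → ℂ} (h : IsBesselPair q D M)
    (h' : IsBesselPair q A N) : IsBesselPair q (fun x => D x - A x) (fun x => M x - N x) :=
  fun x hx => ⟨((h x hx).1.sub (h' x hx).1).congr_deriv (by ring),
    ((h x hx).2.sub (h' x hx).2).congr_deriv (by ring)⟩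

theorem IsBesselPair.const_mul {q : ℝ} {D M : ℝ → ℂ} (h : IsBesselPair q D M) (c : ℂ) :
    IsBesselPair q (fun x => c * D x) (fun x => c * M x) :=
  fun x hx => ⟨((h x hx).1.const_mul c).congr_deriv (by ring),
    ((h x hx).2.const_mul c).congr_deriv (by ring)⟩

theorem eq_of_hasDerivAt_zero_of_tendsto {W : ℝ → ℂ} {ε : ℝ} {c : ℂ}
    (hW : ∀ x ∈ Ioo 0 ε, HasDerivAt W 0 x) (h0 : Tendsto W (𝓝[>] 0) (𝓝 c)) :
    ∀ x ∈ Ioo 0 ε, W x = c := by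
  intro x hx
  have hconst : ∀ y ∈ Ioo 0 ε, W y = W x := fun y hy =>
    (convex_Ioo 0 ε).is_const_of_fderivWithin_eq_zero (𝕜 := ℝ)
      (fun z hz => (hW z hz).differentiableAt.differentiableWithinAt)
      (fun z hz => by
        rw [fderivWithin_of_isOpen isOpen_Ioo hz]
        ext
        simp [(hW z hz).deriv]) hy hx
  refine tendsto_nhds_unique (tendsto_const_nhds.congr' ?_) h0
  filter_upwards [Ioo_mem_nhdsGT (hx.1.trans hx.2)] with y hy
  exact (hconst y hy).symm

/-- The Wronskian `D N - M A` is constant with limit `0`, hence zero; so `D/A` is constant where `A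
≠ 0`, again with limit `0`. A short interval is enough, because analytic continuation takes over. -/
theorem IsBesselPair.exists_eq_zero {q : ℝ} {D M A N : ℝ → ℂ} {a n : ℂ} (h : IsBesselPair q D M)
    (h' : IsBesselPair q A N) (hD : Tendsto D (𝓝[>] 0) (𝓝 0)) (hM : Tendsto M (𝓝[>] 0) (𝓝 0))
    (hA : Tendsto A (𝓝[>] 0) (𝓝 a)) (hN : Tendsto N (𝓝[>] 0) (𝓝 n)) (ha : a ≠ 0) :
    ∃ ε > 0, ∀ x ∈ Ioo 0 ε, D x = 0 := by
  obtain ⟨ε, hε, hεA⟩ := mem_nhdsGT_iff_exists_Ioo_subset.1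
    (hA.eventually (isOpen_ne.mem_nhds ha))
  have hε : 0 < ε := hε
  have hw : ∀ x ∈ Ioo 0 ε, D x * N x - M x * A x = 0 := by
    refine eq_of_hasDerivAt_zero_of_tendsto (W := fun x => D x * N x - M x * A x)
      (fun x hx => ?_) ?_
    · refine (((h x hx.1).1.mul (h' x hx.1).2).sub ((h x hx.1).2.mul (h' x hx.1).1)).congr_deriv ?_
      ring
    · simpa using (hD.mul hN).sub (hM.mul hA)
  refine ⟨ε, hε, fun x hx => ?_⟩
  have := eq_of_hasDerivAt_zero_of_tendsto (W := fun x => D x / A x) (c := 0) (ε := ε)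
    (fun x hx => ?_) (by have := hD.div hA ha; rwa [zero_div] at this) x hx
  · exact (div_eq_zero_iff.1 this).resolve_right (hεA hx)
  · have hne : A x ≠ 0 := hεA hx
    refine ((h x hx.1).1.div (h' x hx.1).1 hne).congr_deriv ?_
    rw [div_eq_zero_iff]
    left
    linear_combination (-((x ^ (-q) : ℝ) : ℂ)) * hw x hx

theorem hasDerivAt_hyp01_sq (ν : ℂ) (x : ℝ) :
    HasDerivAt (fun x : ℝ => hyp01 ν ((x : ℂ) ^ 2 / 4))
      (x / 2 * hyp01 (ν + 1) ((x : ℂ) ^ 2 / 4)) x := by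
  have h1 : HasDerivAt (fun z : ℂ => z ^ 2 / 4) ((x : ℂ) / 2) x := by
    refine ((hasDerivAt_pow 2 (x : ℂ)).div_const 4).congr_deriv ?_
    norm_num
    ring
  refine ((hasDerivAt_hyp01 ν ((x : ℂ) ^ 2 / 4)).comp (x : ℂ) h1).comp_ofReal.congr_deriv ?_
  ring

theorem hasDerivAt_ofReal_rpow (p : ℝ) {x : ℝ} (hx : 0 < x) :
    HasDerivAt (fun x : ℝ => ((x ^ p : ℝ) : ℂ)) (p * ((x ^ (p - 1) : ℝ) : ℂ)) x := by
  refine (Real.hasDerivAt_rpow_const (Or.inl hx.ne')).ofReal_comp.congr_deriv ?_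
  push_cast
  rfl

theorem ofReal_rpow_ne_zero {x : ℝ} (hx : 0 < x) (p : ℝ) : ((x ^ p : ℝ) : ℂ) ≠ 0 :=
  Complex.ofReal_ne_zero.2 (Real.rpow_pos_of_pos hx p).ne'

/-- Up to a constant the solution is `x^{-ν} I_ν(x)`. The weight `x^{2ν+1}` is the one that also
fits `x^{-ν} I_{-ν}` and `x^{-ν} K_ν`. -/
theorem isBesselPair_hyp01 (ν : ℝ) :
    IsBesselPair (2 * ν + 1) (fun x => hyp01 ν ((x : ℂ) ^ 2 / 4))
      (fun x => ((x ^ (2 * ν + 2) : ℝ) : ℂ) * (1 / 2 * hyp01 (ν + 1) ((x : ℂ) ^ 2 / 4))) := by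
  intro x hx
  have e1 : x ^ (2 * ν + 2) = x ^ (2 * ν + 1) * x := by
    rw [← Real.rpow_add_one hx.ne']; ring_nf
  have h0 := ofReal_rpow_ne_zero hx (2 * ν + 1)
  constructor
  · refine (hasDerivAt_hyp01_sq ν x).congr_deriv ?_
    simp only [e1, Real.rpow_neg hx.le]
    push_cast
    field_simp
  · refine ((hasDerivAt_ofReal_rpow (2 * ν + 2) hx).mul
      ((hasDerivAt_hyp01_sq (ν + 1) x).const_mul (1 / 2))).congr_deriv ?_
    have h := hyp01_sub_one (ν + 1) ((x : ℂ) ^ 2 / 4)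
    rw [add_sub_cancel_right] at h
    simp only [e1, h]
    rw [show 2 * ν + 2 - 1 = 2 * ν + 1 by ring]
    push_cast
    ring

/-- Up to a constant this is `x^{-ν} I_{-ν}(x)`. The weight cancels the powers of `x` in the
derivative, which therefore has a finite limit at `0`. -/
theorem isBesselPair_hyp01_neg (ν : ℝ) :
    IsBesselPair (2 * ν + 1)
      (fun x => ((x ^ (-(2 * ν)) : ℝ) : ℂ) * hyp01 (-ν) ((x : ℂ) ^ 2 / 4))
      (fun x => 2 * hyp01 (-ν - 1) ((x : ℂ) ^ 2 / 4)) := by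
  intro x hx
  have e1 : x ^ (-(2 * ν)) = x ^ (-(2 * ν + 1)) * x := by
    rw [← Real.rpow_add_one hx.ne']; ring_nf
  constructor
  · refine ((hasDerivAt_ofReal_rpow (-(2 * ν)) hx).mul
      (hasDerivAt_hyp01_sq (-ν) x)).congr_deriv ?_
    simp only [hyp01_sub_one (-ν) ((x : ℂ) ^ 2 / 4), e1]
    rw [show -(2 * ν) - 1 = -(2 * ν + 1) by ring]
    push_cast
    ring
  · refine ((hasDerivAt_hyp01_sq (-ν - 1) x).const_mul 2).congr_deriv ?_
    have e2 : x ^ (2 * ν + 1) * x ^ (-(2 * ν)) = x := by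
      rw [← Real.rpow_add hx]; ring_nf; exact Real.rpow_one x
    simp only
    rw [← mul_assoc (((x ^ (2 * ν + 1) : ℝ) : ℂ)), ← Complex.ofReal_mul, e2, sub_add_cancel]
    ring

theorem isBesselPair_laplaceTail {s : ℝ} (hs : -1 < s) :
    IsBesselPair (2 * s + 2) (fun x => laplaceTail s x)
      (fun x => ((x ^ (2 * s + 2) : ℝ) : ℂ) *
        (-(1 / (2 * (s + 1))) * (x * laplaceTail (s + 1) x))) := by
  intro x hx
  have h0 : (s : ℂ) + 1 ≠ 0 := by
    rw [← Complex.ofReal_one, ← Complex.ofReal_add]; exact Complex.ofReal_ne_zero.2 (by linarith)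
  have h1 := ofReal_rpow_ne_zero hx (2 * s + 2)
  have hX : 0 < (x : ℂ).re := by simpa using hx
  constructor
  · refine (hasDerivAt_laplaceTail' hs hX).comp_ofReal.congr_deriv ?_
    simp only
    rw [← mul_assoc, ← Complex.ofReal_mul, Real.rpow_neg hx.le,
      inv_mul_cancel₀ (Real.rpow_pos_of_pos hx _).ne', Complex.ofReal_one]
    field_simp
  · refine ((hasDerivAt_ofReal_rpow (2 * s + 2) hx).mul
      ((laplaceTail_add_one_relation hs hX).comp_ofReal.const_mul
        (-(1 / (2 * ((s : ℂ) + 1)))))).congr_deriv ?_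
    have e1 : x ^ (2 * s + 2) = x ^ (2 * s + 2 - 1) * x := by
      rw [← Real.rpow_add_one hx.ne']; ring_nf
    rw [e1]
    push_cast
    field_simp
    ring

theorem tendsto_hyp01_sq_zero (ν : ℂ) :
    Tendsto (fun x : ℝ => hyp01 ν ((x : ℂ) ^ 2 / 4)) (𝓝[>] 0) (𝓝 (Complex.Gamma (ν + 1))⁻¹) := by
  have h : Continuous fun x : ℝ => hyp01 ν ((x : ℂ) ^ 2 / 4) :=
    (differentiable_hyp01 ν).continuous.comp (by fun_prop)
  have := (h.tendsto 0).mono_left (nhdsWithin_le_nhds (s := Ioi 0))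
  simpa [hyp01_zero] using this

theorem tendsto_ofReal_rpow_zero {p : ℝ} (hp : 0 < p) :
    Tendsto (fun x : ℝ => ((x ^ p : ℝ) : ℂ)) (𝓝[>] 0) (𝓝 0) := by
  have h : Continuous fun x : ℝ => ((x ^ p : ℝ) : ℂ) :=
    Complex.continuous_ofReal.comp (Real.continuous_rpow_const hp.le)
  have := (h.tendsto 0).mono_left (nhdsWithin_le_nhds (s := Ioi 0))
  simpa [Real.zero_rpow hp.ne'] using this

/-- In this range of `ν` all three solutions and their weighted derivatives have finite limits at
`0`: `ν < 0` makes `x^{-2ν}` tend to `0` and the beta integral converge, and `ν > -1/2` makes the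
tail integrable at `1`. The difference of the two sides has both limits zero, so it vanishes by the
Wronskian argument with `x^{-ν} I_ν` as the comparison solution. -/
theorem exists_laplaceTail_connection {ν : ℝ} (h1 : -(1 / 2) < ν) (h2 : ν < 0) :
    ∃ ε > (0 : ℝ), ∀ x : ℝ, x ∈ Ioo 0 ε →
      ((Real.sin (Real.pi * ν) * (Real.sqrt Real.pi * 2 ^ (-ν) * (Real.Gamma (ν + 1 / 2))⁻¹) : ℝ) :
        ℂ) * laplaceTail (ν - 1 / 2) x =
      ((Real.pi / 2 * 2 ^ ν : ℝ) : ℂ) * (((x ^ (-(2 * ν)) : ℝ) : ℂ) *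
        hyp01 (-ν) ((x : ℂ) ^ 2 / 4)) -
      ((Real.pi / 2 * 2 ^ (-ν) : ℝ) : ℂ) * hyp01 ν ((x : ℂ) ^ 2 / 4) := by
  have hs : -1 < ν - 1 / 2 := by linarith
  have hG0 : 0 < Real.Gamma (ν + 1 / 2) := Real.Gamma_pos_of_pos (by linarith)
  have hG1 : 0 < Real.Gamma (ν + 1) := Real.Gamma_pos_of_pos (by linarith)
  have hG2 : 0 < Real.Gamma (-ν) := Real.Gamma_pos_of_pos (by linarith)
  have hpi := Real.pi_pos
  have hrefl : Real.sin (Real.pi * ν) * (Real.Gamma (-ν) * Real.Gamma (ν + 1)) = -Real.pi := by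
    have h := Real.Gamma_mul_Gamma_one_sub (-ν)
    rw [sub_neg_eq_add, add_comm 1 ν, mul_neg, Real.sin_neg] at h
    have hsin : Real.sin (Real.pi * ν) ≠ 0 := by
      refine (Real.sin_neg_of_neg_of_neg_pi_lt ?_ ?_).ne <;> nlinarith
    rw [h]
    field_simp
  have hdup : Real.Gamma (ν + 1 / 2) * Real.Gamma (ν + 1) =
      Real.Gamma (2 * ν + 1) * 2 ^ (-(2 * ν)) * Real.sqrt Real.pi := by
    have := Real.Gamma_mul_Gamma_add_half (ν + 1 / 2)
    rw [show ν + 1 / 2 + 1 / 2 = ν + 1 by ring, show 2 * (ν + 1 / 2) = 2 * ν + 1 by ring,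
      show 1 - (2 * ν + 1) = -(2 * ν) by ring] at this
    exact this
  set c : ℝ := Real.sin (Real.pi * ν) * (Real.sqrt Real.pi * 2 ^ (-ν) *
    (Real.Gamma (ν + 1 / 2))⁻¹) with hc
  have hF := isBesselPair_laplaceTail hs
  rw [show 2 * (ν - 1 / 2) + 2 = 2 * ν + 1 by ring, show ν - 1 / 2 + 1 = ν + 1 / 2 by ring] at hF
  have hA := isBesselPair_hyp01 ν
  have hB := isBesselPair_hyp01_neg ν
  have hD := (hF.const_mul c).sub ((hB.const_mul ((Real.pi / 2 * 2 ^ ν : ℝ) : ℂ)).sub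
    (hA.const_mul ((Real.pi / 2 * 2 ^ (-ν) : ℝ) : ℂ)))
  have tA := tendsto_hyp01_sq_zero (ν : ℂ)
  have tN := (tendsto_ofReal_rpow_zero (show 0 < 2 * ν + 2 by linarith)).mul
    ((tendsto_hyp01_sq_zero ((ν : ℂ) + 1)).const_mul (1 / 2))
  have tB := (tendsto_ofReal_rpow_zero (show 0 < -(2 * ν) by linarith)).mul
    (tendsto_hyp01_sq_zero (-(ν : ℂ)))
  have tB' := (tendsto_hyp01_sq_zero (-(ν : ℂ) - 1)).const_mul 2
  have tF := tendsto_laplaceTail_zero hs (by linarith)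
  have tF' : Tendsto (fun x : ℝ => ((x ^ (2 * ν + 1) : ℝ) : ℂ) *
      (-(1 / (2 * (((ν - 1 / 2 : ℝ) : ℂ) + 1))) * (x * laplaceTail (ν + 1 / 2) x))) (𝓝[>] 0)
      (𝓝 (-(Real.Gamma (2 * ν + 1) : ℂ))) := by
    have h := (tendsto_rpow_mul_laplaceTail (show 0 < ν + 1 / 2 by linarith)).const_mul
      (-(1 / (2 * (((ν - 1 / 2 : ℝ) : ℂ) + 1))))
    have hne : 2 * ν + 1 ≠ 0 := by linarith
    have e : -(1 / (2 * (((ν - 1 / 2 : ℝ) : ℂ) + 1))) *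
        (Real.Gamma (2 * (ν + 1 / 2) + 1) : ℂ) = -(Real.Gamma (2 * ν + 1) : ℂ) := by
      rw [show 2 * (ν + 1 / 2) + 1 = (2 * ν + 1) + 1 by ring, Real.Gamma_add_one hne]
      have : (2 * ν + 1 : ℂ) ≠ 0 := by exact_mod_cast hne
      push_cast
      rw [show 2 * ((ν : ℂ) - 1 / 2 + 1) = 2 * ν + 1 by ring]
      field_simp
    rw [e] at h
    refine h.congr' ?_
    filter_upwards [self_mem_nhdsWithin] with x hx
    have hx : 0 < x := hx
    rw [show 2 * (ν + 1 / 2) + 1 = 2 * ν + 1 + 1 by ring, Real.rpow_add_one hx.ne']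
    push_cast
    ring
  have hg : (ν : ℂ) + 1 = ((ν + 1 : ℝ) : ℂ) := by push_cast; rfl
  have g1 := (tF.const_mul (c : ℂ)).sub ((tB.const_mul ((Real.pi / 2 * 2 ^ ν : ℝ) : ℂ)).sub
    (tA.const_mul ((Real.pi / 2 * 2 ^ (-ν) : ℝ) : ℂ)))
  rw [hg, Complex.Gamma_ofReal, zero_mul,
    mul_zero, zero_sub, sub_neg_eq_add, ← Complex.ofReal_inv, ← Complex.ofReal_mul,
    ← Complex.ofReal_mul, ← Complex.ofReal_add,
    show -(ν - 1 / 2) - 1 / 2 = -ν by ring, show ν - 1 / 2 + 1 = ν + 1 / 2 by ring,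
    Real.Gamma_one_half_eq] at g1
  -- The values match by the reflection formula.
  have v1 : c * (1 / 2 * (Real.Gamma (-ν) * Real.Gamma (ν + 1 / 2) / Real.sqrt Real.pi)) +
      Real.pi / 2 * 2 ^ (-ν) * (Real.Gamma (ν + 1))⁻¹ = 0 := by
    have hr : 0 < Real.sqrt Real.pi := Real.sqrt_pos.2 hpi
    rw [hc]
    clear_value c
    generalize Real.Gamma (ν + 1 / 2) = A at *
    generalize Real.Gamma (ν + 1) = B at *
    field_simp
    linear_combination 2 ^ (-ν) * hrefl
  rw [v1, Complex.ofReal_zero] at g1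
  have g2 := (tF'.const_mul (c : ℂ)).sub ((tB'.const_mul ((Real.pi / 2 * 2 ^ ν : ℝ) : ℂ)).sub
    (tN.const_mul ((Real.pi / 2 * 2 ^ (-ν) : ℝ) : ℂ)))
  -- The weighted derivatives match by the duplication formula together with the reflection formula.
  have v2 : c * -Real.Gamma (2 * ν + 1) -
      Real.pi / 2 * 2 ^ ν * (2 * (Real.Gamma (-ν))⁻¹) = 0 := by
    have e : (2 : ℝ) ^ (-(2 * ν)) = (2 ^ (-ν)) * 2 ^ (-ν) := by
      rw [← Real.rpow_add two_pos]; ring_nf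
    have e' : (2 : ℝ) ^ ν = (2 ^ (-ν))⁻¹ := by
      rw [← Real.rpow_neg two_pos.le, neg_neg]
    have hp : (0 : ℝ) < 2 ^ (-ν) := by positivity
    rw [hc, e']
    rw [e] at hdup
    clear_value c
    generalize Real.Gamma (ν + 1 / 2) = A at *
    generalize Real.Gamma (ν + 1) = B at *
    generalize Real.Gamma (2 * ν + 1) = C at *
    field_simp
    linear_combination Real.sin (Real.pi * ν) * Real.Gamma (-ν) * hdup - A * hrefl
  have v2' : (c : ℂ) * -(Real.Gamma (2 * ν + 1) : ℂ) - (((Real.pi / 2 * 2 ^ ν : ℝ) : ℂ) *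
      (2 * (Complex.Gamma (-ν - 1 + 1))⁻¹) - ((Real.pi / 2 * 2 ^ (-ν) : ℝ) : ℂ) *
      (0 * (1 / 2 * (Complex.Gamma (ν + 1 + 1))⁻¹))) = 0 := by
    rw [zero_mul, mul_zero, sub_zero, sub_add_cancel,
      show -(ν : ℂ) = ((-ν : ℝ) : ℂ) by push_cast; rfl, Complex.Gamma_ofReal]
    exact_mod_cast congrArg (fun r : ℝ => (r : ℂ)) v2
  rw [v2'] at g2
  obtain ⟨ε, hε, h⟩ := hD.exists_eq_zero hA g1 g2 tA tN (by
    rw [hg, Complex.Gamma_ofReal]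
    exact inv_ne_zero (Complex.ofReal_ne_zero.2 hG1.ne'))
  exact ⟨ε, hε, fun x hx => by linear_combination h x hx⟩

/-! ### Continuation of the connection formula and the integral for `K_ν`. -/

theorem ofReal_mul_cpow {r : ℝ} (hr : 0 < r) {z : ℂ} (hz : z ≠ 0) (s : ℂ) :
    ((r : ℂ) * z) ^ s = (r : ℂ) ^ s * z ^ s := by
  have hr0 : (r : ℂ) ≠ 0 := Complex.ofReal_ne_zero.2 hr.ne'
  rw [Complex.cpow_def_of_ne_zero (mul_ne_zero hr0 hz), Complex.cpow_def_of_ne_zero hr0,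
    Complex.cpow_def_of_ne_zero hz, ← Complex.exp_add, Complex.log_ofReal_mul hr hz,
    Complex.ofReal_log hr.le]
  ring_nf

theorem div_two_cpow {z : ℂ} (hz : z ≠ 0) (s : ℂ) : (z / 2) ^ s = 2 ^ (-s) * z ^ s := by
  have h := ofReal_mul_cpow (show (0 : ℝ) < 2⁻¹ by norm_num) hz s
  rw [show ((2⁻¹ : ℝ) : ℂ) * z = z / 2 by push_cast; ring] at h
  rw [h]
  congr 1
  rw [Complex.ofReal_inv, Complex.ofReal_ofNat, Complex.inv_cpow _ _ ?_, Complex.cpow_neg]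
  rw [← Complex.ofReal_ofNat, Complex.arg_ofReal_of_nonneg two_pos.le]
  exact Real.pi_pos.ne

/-- `e^{-X} X^{-(ν+1/2)} ∫_0^∞ e^{-w} w^{ν-1/2} (2 + w/X)^{ν-1/2} dw`, the continuation of
`laplaceTail (ν - 1/2)` to the slit plane and to complex orders. -/
def laplaceTailExt (ν X : ℂ) : ℂ :=
  Complex.exp (-X) * X ^ (-(ν + 1 / 2)) * laplaceK (ν - 1 / 2) X

theorem laplaceTail_eq_ext {s : ℝ} (hs : -1 < s) {X : ℂ} (hX : 0 < X.re) :
    laplaceTail s X = laplaceTailExt (s + 1 / 2) X := by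
  rw [laplaceTail_eq_laplaceK hs hX, laplaceTailExt]
  congr 2
  · congr 1; push_cast; ring
  · ring

theorem differentiableOn_laplaceTailExt_right {ν : ℂ} (hν : -(1 / 2) < ν.re) :
    DifferentiableOn ℂ (fun X => laplaceTailExt ν X) Complex.slitPlane := by
  refine DifferentiableOn.mul (fun X hX => ?_) (differentiableOn_laplaceK_right ?_)
  · refine DifferentiableAt.differentiableWithinAt (DifferentiableAt.mul (by fun_prop) ?_)
    exact differentiableAt_id.cpow_const hX
  · norm_num
    linarith

theorem differentiableOn_laplaceTailExt_left {X : ℂ} (hX : X ∈ Complex.slitPlane) :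
    DifferentiableOn ℂ (fun ν => laplaceTailExt ν X) {ν | -(1 / 2) < ν.re} := by
  refine DifferentiableOn.mul (fun ν hν => ?_) ?_
  · refine DifferentiableAt.differentiableWithinAt (DifferentiableAt.const_mul ?_ _)
    exact DifferentiableAt.const_cpow (by fun_prop) (Or.inl (Complex.slitPlane_ne_zero hX))
  · refine (differentiableOn_laplaceK_left hX).comp (f := fun ν : ℂ => ν - 1 / 2) (by fun_prop)
      fun ν hν => ?_
    have hν : -(1 / 2) < ν.re := hν
    show -1 < (ν - 1 / 2).re
    norm_num
    linarith

theorem ofReal_two_rpow (p : ℝ) : (((2 : ℝ) ^ p : ℝ) : ℂ) = 2 ^ (p : ℂ) := by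
  rw [Complex.ofReal_cpow two_pos.le, Complex.ofReal_ofNat]

theorem isPreconnected_slitPlane : IsPreconnected Complex.slitPlane :=
  (Complex.starConvex_one_slitPlane.isPathConnected Complex.one_mem_slitPlane).isConnected
    |>.isPreconnected

/-- The connection formula between the Laplace integral for `K_ν` and the power series of `I_ν` and
`I_{-ν}`. -/
theorem laplaceTailExt_connection {ν X : ℂ} (hν : -(1 / 2) < ν.re) (hX : X ∈ Complex.slitPlane) :
    Complex.sin (Real.pi * ν) * (Real.sqrt Real.pi * 2 ^ (-ν) * (Complex.Gamma (ν + 1 / 2))⁻¹) *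
      laplaceTailExt ν X =
    Real.pi / 2 * 2 ^ ν * (X ^ (-(2 * ν)) * hyp01 (-ν) (X ^ 2 / 4)) -
      Real.pi / 2 * 2 ^ (-ν) * hyp01 ν (X ^ 2 / 4) := by
  have hX0 := Complex.slitPlane_ne_zero hX
  -- Two continuations are nested: the outer one in `ν`, from the real segment `(-1/2, 0)`, and for
  -- each such `ν` an inner one in `X`, from a short positive interval. The factor `sin πν` stays on
  -- the left, so that both sides are holomorphic in `ν` at the integers as well.
  refine eqOn_of_eq_on_real_Ioo (U := {ν : ℂ | -(1 / 2) < ν.re})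
    (f := fun ν : ℂ => Complex.sin (Real.pi * ν) *
      (Real.sqrt Real.pi * 2 ^ (-ν) * (Complex.Gamma (ν + 1 / 2))⁻¹) * laplaceTailExt ν X)
    (g := fun ν : ℂ => Real.pi / 2 * 2 ^ ν * (X ^ (-(2 * ν)) * hyp01 (-ν) (X ^ 2 / 4)) -
      Real.pi / 2 * 2 ^ (-ν) * hyp01 ν (X ^ 2 / 4))
    (isOpen_lt continuous_const Complex.continuous_re)
    (convex_halfSpace_re_gt _).isPreconnected ?_ ?_ (show -(1 / 2) < (0 : ℝ) by norm_num)
    (fun x hx _ => by simpa using hx) (fun ν h1 h2 => ?_) hν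
  · refine DifferentiableOn.mul (Differentiable.differentiableOn ?_)
      (differentiableOn_laplaceTailExt_left hX)
    refine Differentiable.mul (by fun_prop) (Differentiable.mul (Differentiable.const_mul ?_ _) ?_)
    · exact fun ν => DifferentiableAt.const_cpow (by fun_prop) (Or.inl two_ne_zero)
    · exact Complex.differentiable_one_div_Gamma.comp (by fun_prop)
  · refine Differentiable.differentiableOn (Differentiable.sub ?_ ?_)
    · refine Differentiable.mul (Differentiable.const_mul ?_ _) (Differentiable.mul ?_ ?_)
      · exact fun ν => DifferentiableAt.const_cpow (by fun_prop) (Or.inl two_ne_zero)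
      · exact fun ν => DifferentiableAt.const_cpow (by fun_prop) (Or.inl hX0)
      · exact (differentiable_hyp01_left (X ^ 2 / 4)).comp differentiable_neg
    · refine Differentiable.mul (Differentiable.const_mul ?_ _) (differentiable_hyp01_left _)
      exact fun ν => DifferentiableAt.const_cpow (by fun_prop) (Or.inl two_ne_zero)
  · obtain ⟨ε, hε, h⟩ := exists_laplaceTail_connection h1 h2
    refine eqOn_of_eq_on_real_Ioo (U := Complex.slitPlane)
      (f := fun X : ℂ => Complex.sin (Real.pi * ν) *
        (Real.sqrt Real.pi * 2 ^ (-(ν : ℂ)) * (Complex.Gamma (ν + 1 / 2))⁻¹) * laplaceTailExt ν X)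
      (g := fun X : ℂ => Real.pi / 2 * 2 ^ (ν : ℂ) * (X ^ (-(2 * ν : ℂ)) *
        hyp01 (-ν) (X ^ 2 / 4)) - Real.pi / 2 * 2 ^ (-(ν : ℂ)) * hyp01 ν (X ^ 2 / 4))
      Complex.isOpen_slitPlane isPreconnected_slitPlane ?_ ?_ hε
      (fun x hx _ => Or.inl (by simpa using hx)) (fun x hx1 hx2 => ?_) hX
    · exact (differentiableOn_laplaceTailExt_right (by simpa using h1)).const_mul _
    · have hd : ∀ κ : ℂ, Differentiable ℂ fun X : ℂ => hyp01 κ (X ^ 2 / 4) := fun κ =>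
        (differentiable_hyp01 κ).comp (by fun_prop)
      refine DifferentiableOn.sub (DifferentiableOn.const_mul (DifferentiableOn.mul ?_
        (hd _).differentiableOn) _) ((hd _).differentiableOn.const_mul _)
      exact fun X hX => (differentiableAt_id.cpow_const hX).differentiableWithinAt
    · have := h x ⟨hx1, hx2⟩
      rw [laplaceTail_eq_ext (by linarith) (by simpa using hx1)] at this
      push_cast [ofReal_two_rpow, Complex.ofReal_cpow hx1.le, ← Complex.Gamma_ofReal] at this ⊢
      rw [sub_add_cancel] at this
      linear_combination this

/-- The value of `K_ν` given by the Laplace integral. -/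
def besselKExt (ν : ℝ) (z : ℂ) : ℂ :=
  Real.sqrt Real.pi * 2 ^ (-(ν : ℂ)) * (Complex.Gamma (ν + 1 / 2))⁻¹ * z ^ (ν : ℂ) *
    laplaceTailExt ν z

theorem sin_ofReal_mul_pi_ne_zero {ν : ℝ} (hν : ¬∃ n : ℤ, ν = n) : Real.sin (ν * Real.pi) ≠ 0 := by
  intro h
  obtain ⟨n, hn⟩ := Real.sin_eq_zero_iff.1 h
  exact hν ⟨n, (mul_right_cancel₀ Real.pi_ne_zero hn).symm⟩

theorem besselKQuot_eq {ν : ℝ} (h : -(1 / 2) < ν) (hν : ¬∃ n : ℤ, ν = n) {z : ℂ}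
    (hz : z ∈ Complex.slitPlane) : besselKQuot ν z = besselKExt ν z := by
  have hz0 := Complex.slitPlane_ne_zero hz
  have hs := sin_ofReal_mul_pi_ne_zero hν
  have hc := laplaceTailExt_connection (ν := ν) (by simpa using h) hz
  rw [besselKQuot, besselKExt, besselI_eq, besselI_eq, div_two_cpow hz0, div_two_cpow hz0,
    div_eq_iff (Complex.ofReal_ne_zero.2 hs)]
  push_cast
  rw [neg_neg, mul_comm (ν : ℂ)]
  have e : z ^ (-(ν : ℂ)) = z ^ (ν : ℂ) * z ^ (-(2 * ν : ℂ)) := by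
    rw [← Complex.cpow_add _ _ hz0]; congr 1; ring
  rw [e]
  linear_combination -(z ^ (ν : ℂ)) * hc

theorem eventually_nhdsNE_not_int (ν : ℝ) : ∀ᶠ x : ℝ in 𝓝[≠] ν, ¬∃ n : ℤ, x = n := by
  have h1 : (ν : ℝ) ∉ (range ((↑) : ℤ → ℝ)) \ {ν} := by simp
  have h2 : IsClosed ((range ((↑) : ℤ → ℝ)) \ {ν}) := by
    have : (range ((↑) : ℤ → ℝ)) \ {ν} = ((↑) : ℤ → ℝ) '' {n : ℤ | (n : ℝ) ≠ ν} := by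
      ext x
      constructor
      · rintro ⟨⟨n, rfl⟩, hn⟩; exact ⟨n, hn, rfl⟩
      · rintro ⟨n, hn, rfl⟩; exact ⟨⟨n, rfl⟩, hn⟩
    rw [this]
    exact Int.isClosedEmbedding_coe_real.isClosedMap _ (isClosed_discrete _)
  filter_upwards [nhdsWithin_le_nhds (h2.isOpen_compl.mem_nhds h1), self_mem_nhdsWithin]
    with x hx hx' ⟨n, hn⟩
  exact hx ⟨⟨n, hn.symm⟩, hx'⟩

theorem continuousAt_laplaceTailExt_ofReal {ν : ℝ} (h : -(1 / 2) < ν) {z : ℂ}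
    (hz : z ∈ Complex.slitPlane) : ContinuousAt (fun ν : ℝ => laplaceTailExt ν z) ν := by
  have h1 := ((differentiableOn_laplaceTailExt_left hz).differentiableAt (x := (ν : ℂ))
    ((isOpen_lt continuous_const Complex.continuous_re).mem_nhds (by simpa using h))).continuousAt
  exact h1.comp (f := fun ν : ℝ => (ν : ℂ)) Complex.continuous_ofReal.continuousAt

theorem continuous_const_cpow_ofReal {z : ℂ} (hz : z ≠ 0) {f : ℝ → ℂ} (hf : Continuous f) :
    Continuous fun ν : ℝ => z ^ f ν :=
  hf.const_cpow (Or.inl hz)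

theorem continuous_inv_Gamma_ofReal (c : ℂ) :
    Continuous fun ν : ℝ => (Complex.Gamma ((ν : ℂ) + c))⁻¹ :=
  Complex.differentiable_one_div_Gamma.continuous.comp (by fun_prop)

/-- The punctured limit sees only non-integer orders, so the value of the quotient where its
denominator `sin νπ` vanishes plays no role. -/
theorem limUnder_nhdsNE_eq {ν : ℝ} {f g : ℝ → ℂ} (h : -(1 / 2) < ν) (hg : ContinuousAt g ν)
    (hfg : ∀ x : ℝ, -(1 / 2) < x → (¬∃ n : ℤ, x = n) → f x = g x) :
    limUnder (𝓝[≠] ν) f = g ν := by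
  refine Tendsto.limUnder_eq ((hg.tendsto.mono_left nhdsWithin_le_nhds).congr' ?_)
  filter_upwards [eventually_nhdsNE_not_int ν, nhdsWithin_le_nhds (lt_mem_nhds h)] with x hx h1
  exact (hfg x h1 hx).symm

theorem besselK_eq {ν : ℝ} (h : -(1 / 2) < ν) {z : ℂ} (hz : z ∈ Complex.slitPlane) :
    besselK ν z = besselKExt ν z := by
  rw [besselK]
  split_ifs with hν
  · refine limUnder_nhdsNE_eq h ?_ fun x h1 hx => besselKQuot_eq h1 hx hz
    refine ContinuousAt.mul ?_ (continuousAt_laplaceTailExt_ofReal h hz)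
    refine Continuous.continuousAt ?_
    refine ((continuous_const.mul (continuous_const_cpow_ofReal two_ne_zero (by fun_prop))).mul
      (continuous_inv_Gamma_ofReal _)).mul
      (continuous_const_cpow_ofReal (Complex.slitPlane_ne_zero hz) (by fun_prop))
  · exact besselKQuot_eq h hν hz

theorem kRatio_eq {μ : ℝ} (hμ : μ < 1) {X : ℂ} (hX : X ∈ Complex.slitPlane) :
    kRatio μ X = (Real.sqrt Real.pi * 2 ^ (μ - 1 / 2) * (Real.Gamma (1 - μ))⁻¹ : ℝ) *
      laplaceTailExt ((1 / 2 - μ : ℝ) : ℂ) X := by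
  have hX0 := Complex.slitPlane_ne_zero hX
  have h0 : X ^ ((1 / 2 - μ : ℝ) : ℂ) ≠ 0 := by simp [Complex.cpow_eq_zero_iff, hX0]
  rw [kRatio, besselK_eq (by linarith) hX, besselKExt, div_eq_iff h0]
  push_cast [ofReal_two_rpow, ← Complex.Gamma_ofReal]
  rw [show (1 / 2 - μ + 1 / 2 : ℂ) = 1 - μ by ring, show (-(1 / 2 - μ) : ℂ) = μ - 1 / 2 by ring]
  ring

/-! ### Rotation of the contour past the branch point. -/

theorem integrableOn_exp_neg_mul_mul_add_rpow {β b : ℝ} (p : ℝ) (hβ : 0 < β) (hb : 0 < b) :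
    IntegrableOn (fun y : ℝ => Real.exp (-(β * y)) * (b + y) ^ p) (Ioi 0) := by
  have h := integrableOn_exp_mul_rpow_mul_add_rpow (s := 0) (c := β⁻¹) p (by norm_num) hb
    (inv_pos.2 hβ).le
  have h2 := (integrableOn_Ioi_comp_mul_left_iff
    (fun w : ℝ => Real.exp (-w) * w ^ (0 : ℝ) * (b + β⁻¹ * w) ^ p) 0 hβ).2 (by simpa using h)
  refine IntegrableOn.congr_fun h2 (fun y _ => ?_) measurableSet_Ioi
  simp only [Real.rpow_zero, mul_one]
  rw [inv_mul_cancel_left₀ hβ.ne']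

/-- The imaginary part `2 Re z Im z` vanishes only for real `z`, and then `1 + z² > 0`. -/
theorem one_add_sq_mem_slitPlane {z : ℂ} (hz : 0 < z.re) : 1 + z ^ 2 ∈ Complex.slitPlane := by
  rw [Complex.mem_slitPlane_iff]
  by_cases h : z.im = 0
  · left
    simp [pow_two, h]
    positivity
  · right
    simp only [pow_two, Complex.add_im, Complex.one_im, Complex.mul_im, zero_add]
    have := mul_ne_zero hz.ne' h
    intro h'
    apply this
    linarith

theorem one_add_sq_eq (z : ℂ) : 1 + z ^ 2 = (z - Complex.I) * (z + Complex.I) := by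
  ring_nf
  rw [Complex.I_sq]
  ring

theorem norm_one_add_sq_le (z : ℂ) : ‖1 + z ^ 2‖ ≤ (1 + ‖z‖) ^ 2 := by
  refine (norm_add_le _ _).trans ?_
  rw [norm_one, norm_pow]
  nlinarith [norm_nonneg z]

theorem sq_re_le_norm_one_add_sq {z : ℂ} (hz : 0 < z.re) : z.re ^ 2 ≤ ‖1 + z ^ 2‖ := by
  rw [one_add_sq_eq, norm_mul, pow_two]
  have h1 : z.re ≤ ‖z - Complex.I‖ := by simpa using Complex.re_le_norm (z - Complex.I)
  have h2 : z.re ≤ ‖z + Complex.I‖ := by simpa using Complex.re_le_norm (z + Complex.I)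
  gcongr

/-- The imaginary parts of the factors `z ∓ i` do not depend on `ε`. This gives a majorant near the
branch point that survives `ε → 0`. -/
theorem abs_one_sub_sq_le_norm {ε y : ℝ} (hy : 0 ≤ y) :
    |1 - y ^ 2| ≤ ‖1 + (ε + y * Complex.I) ^ 2‖ := by
  rw [one_add_sq_eq, norm_mul, show 1 - y ^ 2 = (1 - y) * (1 + y) by ring, abs_mul]
  have h1 := Complex.abs_im_le_norm (ε + y * Complex.I - Complex.I)
  have h2 := Complex.abs_im_le_norm (ε + y * Complex.I + Complex.I)
  simp at h1 h2
  rw [abs_sub_comm, add_comm 1 y]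
  gcongr

theorem norm_ofReal_add_ofReal_mul_I_le {x y : ℝ} (hx : 0 ≤ x) (hy : 0 ≤ y) :
    ‖(x : ℂ) + y * Complex.I‖ ≤ x + y := by
  refine (norm_add_le _ _).trans ?_
  simp [abs_of_nonneg hx, abs_of_nonneg hy]

theorem norm_cexp_neg_mul (p : ℂ) (x y : ℝ) :
    ‖Complex.exp (-(p * (x + y * Complex.I)))‖ = Real.exp (-(p.re * x + -p.im * y)) := by
  rw [Complex.norm_exp]
  congr 1
  simp
  ring

theorem norm_shifted_le {s ε x y R : ℝ} (p : ℂ) (hε : 0 < ε) (hx : 0 ≤ x) (hy : 0 ≤ y)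
    (hR : x + y ≤ R) :
    ‖(1 + (x + y * Complex.I + ε) ^ 2) ^ (s : ℂ) * Complex.exp (-(p * (x + y * Complex.I)))‖ ≤
      ((ε ^ 2) ^ s + ((1 + ε + R) ^ 2) ^ s) * Real.exp (-(p.re * x + -p.im * y)) := by
  rw [norm_mul, norm_cexp_neg_mul, Complex.norm_cpow_real]
  gcongr
  have hre : ((x : ℂ) + y * Complex.I + ε).re = x + ε := by simp
  refine rpow_le_add_of_mem_Icc _ (by positivity) ?_ ?_
  · refine le_trans ?_ (sq_re_le_norm_one_add_sq (by rw [hre]; positivity))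
    rw [hre]
    gcongr
    linarith
  · refine (norm_one_add_sq_le _).trans ?_
    have h1 := norm_add_le ((x : ℂ) + y * Complex.I) ε
    have h2 := norm_ofReal_add_ofReal_mul_I_le hx hy
    rw [Complex.norm_real, Real.norm_of_nonneg hε.le] at h1
    exact pow_le_pow_left₀ (by positivity) (by linarith) 2

theorem tendsto_rotation_bound {γ ε : ℝ} (s : ℝ) (hγ : 0 < γ) (hε : 0 < ε) :
    Tendsto (fun R : ℝ => ((ε ^ 2) ^ s + ((1 + ε + 2 * R) ^ 2) ^ s) * Real.exp (-(γ * R)) * R) atTop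
      (𝓝 0) := by
  have h1 := (tendsto_rpow_mul_exp_neg_mul_atTop_nhds_zero 1 γ hγ).const_mul ((ε ^ 2) ^ s)
  have h2 := (tendsto_rpow_mul_exp_neg_mul_atTop_nhds_zero (2 * |s| + 1) γ hγ).const_mul
    ((3 + ε) ^ (2 * |s|))
  have h := h1.add h2
  simp only [mul_zero, add_zero] at h
  refine squeeze_zero' ?_ ?_ h
  · filter_upwards [eventually_ge_atTop 0] with R hR
    positivity
  · filter_upwards [eventually_ge_atTop 1] with R hR
    have hR0 : 0 < R := by linarith
    have h3 : ((1 + ε + 2 * R) ^ 2) ^ s ≤ (3 + ε) ^ (2 * |s|) * R ^ (2 * |s|) := by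
      rw [← Real.mul_rpow (by positivity) hR0.le, Real.rpow_mul (by positivity)]
      norm_num
      have h4 : 1 + ε + 2 * R ≤ (3 + ε) * R := by nlinarith
      have h5 : 1 ≤ (1 + ε + 2 * R) ^ 2 := by nlinarith
      calc _ ≤ ((1 + ε + 2 * R) ^ 2) ^ |s| := Real.rpow_le_rpow_of_exponent_le h5 (le_abs_self s)
        _ ≤ _ := by gcongr
    have h6 : R ^ (2 * |s| + 1) = R ^ (2 * |s|) * R := Real.rpow_add_one hR0.ne' _
    rw [h6, Real.rpow_one, neg_mul]
    calc _ ≤ ((ε ^ 2) ^ s + (3 + ε) ^ (2 * |s|) * R ^ (2 * |s|)) * Real.exp (-(γ * R)) * R := by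
          gcongr
      _ = _ := by ring

/-- The shifted integrand `(1 + (z + ε)²)^s e^{-pz}` of the rotation argument. -/
def shifted (s : ℝ) (p : ℂ) (ε : ℝ) (z : ℂ) : ℂ :=
  (1 + (z + ε) ^ 2) ^ (s : ℂ) * Complex.exp (-(p * z))

theorem differentiableAt_shifted (s : ℝ) (p : ℂ) {ε : ℝ} {z : ℂ} (hz : 0 < z.re + ε) :
    DifferentiableAt ℂ (shifted s p ε) z := by
  refine DifferentiableAt.mul (DifferentiableAt.cpow_const (by fun_prop) ?_) (by fun_prop)
  exact one_add_sq_mem_slitPlane (by simpa using hz)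

theorem integrableOn_shifted_re (s : ℝ) {p : ℂ} {ε : ℝ} (hp : 0 < p.re) (hε : 0 < ε) :
    IntegrableOn (fun x : ℝ => shifted s p ε x) (Ioi 0) := by
  have h1 := (integrableOn_exp_neg_mul_mul_add_rpow 0 hp one_pos).const_mul ((ε ^ 2) ^ s)
  have h2 := integrableOn_exp_neg_mul_mul_add_rpow (2 * s) hp (show 0 < 1 + ε by positivity)
  refine Integrable.mono' (h1.add h2) (Measurable.aestronglyMeasurable (by
    unfold shifted; fun_prop)) ((ae_restrict_mem measurableSet_Ioi).mono fun x hx => ?_)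
  have hx : 0 < x := hx
  have := norm_shifted_le (s := s) p hε hx.le le_rfl (show x + 0 ≤ x by simp)
  simp only [Complex.ofReal_zero, zero_mul, add_zero, mul_zero] at this
  refine this.trans (le_of_eq ?_)
  simp only [Pi.add_apply, Real.rpow_zero, mul_one]
  rw [Real.rpow_mul (by positivity)]
  norm_num
  ring

theorem integrableOn_shifted_im (s : ℝ) {p : ℂ} {ε : ℝ} (hp : p.im < 0) (hε : 0 < ε) :
    IntegrableOn (fun y : ℝ => shifted s p ε (y * Complex.I)) (Ioi 0) := by
  have hp' : 0 < -p.im := by linarith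
  have h1 := (integrableOn_exp_neg_mul_mul_add_rpow 0 hp' one_pos).const_mul ((ε ^ 2) ^ s)
  have h2 := integrableOn_exp_neg_mul_mul_add_rpow (2 * s) hp' (show 0 < 1 + ε by positivity)
  refine Integrable.mono' (h1.add h2) (Measurable.aestronglyMeasurable (by
    unfold shifted; fun_prop)) ((ae_restrict_mem measurableSet_Ioi).mono fun y hy => ?_)
  have hy : 0 < y := hy
  have := norm_shifted_le (s := s) p hε le_rfl hy.le (show 0 + y ≤ y by simp)
  simp only [Complex.ofReal_zero, zero_add, mul_zero] at this
  refine this.trans (le_of_eq ?_)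
  simp only [Pi.add_apply, Real.rpow_zero, mul_one]
  rw [Real.rpow_mul (by positivity)]
  norm_num
  ring

/-- Cauchy's theorem on the square `[0, R]²`. As `Re p` and `-Im p` are positive, `|e^{-pz}| ≤
e^{-γR}` on the two far sides. The shift by `ε` keeps the side on the imaginary axis away from the
cut that starts at `i`. -/
theorem integral_shifted_rotate (s : ℝ) {p : ℂ} {ε : ℝ} (hp : 0 < p.re) (hp' : p.im < 0)
    (hε : 0 < ε) :
    ∫ x in Ioi (0 : ℝ), shifted s p ε x =
      Complex.I * ∫ y in Ioi (0 : ℝ), shifted s p ε (y * Complex.I) := by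
  set γ := min p.re (-p.im) with hγ
  have hγ0 : 0 < γ := lt_min hp (by linarith)
  have t1 := intervalIntegral_tendsto_integral_Ioi 0 (integrableOn_shifted_re s hp hε) tendsto_id
  have t4 := (intervalIntegral_tendsto_integral_Ioi 0 (integrableOn_shifted_im s hp' hε)
    tendsto_id).const_mul Complex.I
  have hb := tendsto_rotation_bound s hγ0 hε
  have hbound : ∀ R x y : ℝ, 0 ≤ x → x ≤ R → 0 ≤ y → y ≤ R → R ≤ x ∨ R ≤ y →
      ‖shifted s p ε (x + y * Complex.I)‖ ≤
        ((ε ^ 2) ^ s + ((1 + ε + 2 * R) ^ 2) ^ s) * Real.exp (-(γ * R)) := by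
    intro R x y hx hxR hy hyR h
    refine (norm_shifted_le p hε hx hy (show x + y ≤ 2 * R by linarith)).trans ?_
    gcongr
    have g1 : γ ≤ p.re := min_le_left _ _
    have g2 : γ ≤ -p.im := min_le_right _ _
    rcases h with h | h
    · have := mul_le_mul g1 h (by linarith) hp.le
      have := mul_nonneg (show 0 ≤ -p.im by linarith) hy
      linarith
    · have := mul_le_mul g2 h (by linarith) (show 0 ≤ -p.im by linarith)
      have := mul_nonneg hp.le hx
      linarith
  have t2 : Tendsto (fun R : ℝ => ∫ x in (0 : ℝ)..R, shifted s p ε (x + R * Complex.I)) atTop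
      (𝓝 0) := by
    rw [tendsto_zero_iff_norm_tendsto_zero]
    refine squeeze_zero' (Eventually.of_forall fun _ => norm_nonneg _) ?_ hb
    filter_upwards [eventually_ge_atTop 0] with R hR
    have := intervalIntegral.norm_integral_le_of_norm_le_const (a := 0) (b := R)
      (f := fun x : ℝ => shifted s p ε (x + R * Complex.I)) fun x hx => by
        rw [uIoc_of_le hR] at hx
        exact hbound R x R hx.1.le hx.2 hR le_rfl (Or.inr le_rfl)
    rwa [sub_zero, abs_of_nonneg hR] at this
  have t3 : Tendsto (fun R : ℝ => Complex.I *
      ∫ y in (0 : ℝ)..R, shifted s p ε (R + y * Complex.I)) atTop (𝓝 0) := by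
    rw [tendsto_zero_iff_norm_tendsto_zero]
    refine squeeze_zero' (Eventually.of_forall fun _ => norm_nonneg _) ?_ hb
    filter_upwards [eventually_ge_atTop 0] with R hR
    have := intervalIntegral.norm_integral_le_of_norm_le_const (a := 0) (b := R)
      (f := fun y : ℝ => shifted s p ε (R + y * Complex.I)) fun y hy => by
        rw [uIoc_of_le hR] at hy
        exact hbound R R y hR le_rfl hy.1.le hy.2 (Or.inl le_rfl)
    rw [norm_mul, Complex.norm_I, one_mul]
    rwa [sub_zero, abs_of_nonneg hR] at this
  have ht := ((t1.sub t2).add t3).sub t4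
  rw [sub_zero, add_zero] at ht
  refine sub_eq_zero.1 (tendsto_nhds_unique ht ?_)
  refine tendsto_const_nhds.congr' ?_
  filter_upwards [eventually_ge_atTop 0] with R hR
  have := Complex.integral_boundary_rect_eq_zero_of_differentiableOn (shifted s p ε) 0
    (R + R * Complex.I) fun z hz => by
      refine (differentiableAt_shifted s p ?_).differentiableWithinAt
      have h1 := hz.1
      simp only [Complex.zero_re, Complex.add_re, Complex.ofReal_re, Complex.mul_re,
        Complex.I_re, mul_zero, Complex.ofReal_im, Complex.I_im, mul_one, sub_self, add_zero,
        uIcc_of_le hR, mem_preimage, mem_Icc] at h1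
      linarith [h1.1]
  simp only [Complex.zero_re, Complex.zero_im, Complex.add_re, Complex.ofReal_re, Complex.mul_re,
    Complex.I_re, mul_zero, Complex.ofReal_im, Complex.I_im, mul_one, sub_self, add_zero,
    Complex.add_im, Complex.mul_im, zero_add, Complex.ofReal_zero, zero_mul, smul_eq_mul] at this
  exact this.symm

/-- The Laplace integral `∫_0^∞ e^{-px} (1 + x²)^s dx`. -/
def laplaceHalf (s : ℝ) (p : ℂ) : ℂ :=
  ∫ x in Ioi (0 : ℝ), Complex.exp (-(p * x)) * (((1 + x ^ 2) ^ s : ℝ) : ℂ)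

/-- The finite Laplace integral `∫_0^1 e^{-Xy} (1 - y²)^s dy`. -/
def laplaceUnit (s : ℝ) (X : ℂ) : ℂ :=
  ∫ y in Ioo (0 : ℝ) 1, Complex.exp (-(X * y)) * (((1 - y ^ 2) ^ s : ℝ) : ℂ)

theorem integrableOn_one_sub_sq_rpow {s : ℝ} (hs : -1 < s) :
    IntegrableOn (fun y : ℝ => (1 - y ^ 2) ^ s) (Ioo 0 1) := by
  have h1 := (integrableOn_beta one_pos (show 0 < s + 1 by linarith)).mul_const (1 + 2 ^ s)
  refine Integrable.mono' h1 (Measurable.aestronglyMeasurable (by fun_prop))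
    ((ae_restrict_mem measurableSet_Ioo).mono fun y hy => ?_)
  have h2 : 0 < 1 - y := sub_pos.2 hy.2
  have h3 : 0 < 1 + y := by linarith [hy.1]
  rw [show 1 - y ^ 2 = (1 - y) * (1 + y) by ring, Real.mul_rpow h2.le h3.le,
    Real.norm_of_nonneg (by positivity)]
  simp only [sub_self, Real.rpow_zero, one_mul, add_sub_cancel_right]
  gcongr
  have := rpow_le_add_of_mem_Icc s one_pos (show 1 ≤ 1 + y by linarith [hy.1])
    (show 1 + y ≤ 2 by linarith [hy.2])
  rwa [Real.one_rpow] at this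

/-- The base has imaginary part `2yε > 0`, so it reaches the negative real `1 - y²` from above,
where the argument is `π`. -/
theorem tendsto_cpow_of_re_neg {s y : ℝ} (hy : 1 < y) :
    Tendsto (fun ε : ℝ => (1 + (y * Complex.I + ε) ^ 2) ^ (s : ℂ)) (𝓝[>] 0)
      (𝓝 (Complex.exp (Complex.I * Real.pi * s) * (((y ^ 2 - 1) ^ s : ℝ) : ℂ))) := by
  have hpos : 0 < y ^ 2 - 1 := by nlinarith
  have hz : (1 + (y * Complex.I + (0 : ℝ)) ^ 2 : ℂ) = ((-(y ^ 2 - 1) : ℝ) : ℂ) := by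
    push_cast
    ring_nf
    rw [Complex.I_sq]
    ring
  have hin : Tendsto (fun ε : ℝ => (1 + (y * Complex.I + ε) ^ 2 : ℂ)) (𝓝[>] 0)
      (𝓝[{z : ℂ | 0 ≤ z.im}] ((-(y ^ 2 - 1) : ℝ) : ℂ)) := by
    refine tendsto_nhdsWithin_iff.2 ⟨?_, ?_⟩
    · have : Continuous fun ε : ℝ => (1 + (y * Complex.I + ε) ^ 2 : ℂ) := by fun_prop
      have := (this.tendsto 0).mono_left (nhdsWithin_le_nhds (s := Ioi 0))
      rwa [hz] at this
    · filter_upwards [self_mem_nhdsWithin] with ε hε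
      have hε : 0 < ε := hε
      simp [pow_two]
      positivity
  have hlog := (Complex.tendsto_log_nhdsWithin_im_nonneg_of_re_neg_of_im_zero
    (z := ((-(y ^ 2 - 1) : ℝ) : ℂ)) (by rw [Complex.ofReal_re]; linarith)
    (Complex.ofReal_im _)).comp hin
  have hexp := (Complex.continuous_exp.tendsto _).comp (hlog.mul_const (s : ℂ))
  have e : Complex.exp ((Real.log ‖((-(y ^ 2 - 1) : ℝ) : ℂ)‖ + Real.pi * Complex.I) * s) =
      Complex.exp (Complex.I * Real.pi * s) * (((y ^ 2 - 1) ^ s : ℝ) : ℂ) := by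
    rw [Complex.norm_real, norm_neg, Real.norm_of_nonneg hpos.le, Real.rpow_def_of_pos hpos,
      Complex.ofReal_exp, ← Complex.exp_add]
    push_cast
    ring_nf
  rw [e] at hexp
  refine hexp.congr' ?_
  filter_upwards [self_mem_nhdsWithin] with ε hε
  have hne : (1 + (y * Complex.I + ε) ^ 2 : ℂ) ≠ 0 :=
    Complex.slitPlane_ne_zero (one_add_sq_mem_slitPlane (by simpa using hε))
  rw [Complex.cpow_def_of_ne_zero hne]
  rfl

theorem tendsto_integral_shifted_re (s : ℝ) {p : ℂ} (hp : 0 < p.re) :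
    Tendsto (fun ε : ℝ => ∫ x in Ioi (0 : ℝ), shifted s p ε x) (𝓝[>] 0) (𝓝 (laplaceHalf s p)) := by
  have h1 := integrableOn_exp_neg_mul_mul_add_rpow 0 hp one_pos
  have h2 := integrableOn_exp_neg_mul_mul_add_rpow (2 * s) hp two_pos
  refine tendsto_integral_filter_of_dominated_convergence _
    (Eventually.of_forall fun ε => Measurable.aestronglyMeasurable (by unfold shifted; fun_prop)) ?_
    (h1.add h2) ?_
  · filter_upwards [Ioo_mem_nhdsGT (zero_lt_one' ℝ)] with ε hε
    refine (ae_restrict_mem measurableSet_Ioi).mono fun x hx => ?_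
    have hx : 0 < x := hx
    have hε0 := hε.1
    have e := norm_cexp_neg_mul p x 0
    simp only [Complex.ofReal_zero, zero_mul, add_zero, mul_zero] at e
    have e2 : (1 + ((x : ℂ) + ε) ^ 2) = ((1 + (x + ε) ^ 2 : ℝ) : ℂ) := by push_cast; rfl
    rw [shifted, norm_mul, e, Complex.norm_cpow_real, e2, Complex.norm_real,
      Real.norm_of_nonneg (by positivity)]
    simp only [Pi.add_apply, Real.rpow_zero, mul_one]
    have := rpow_le_add_of_mem_Icc (c := 1) (C := (2 + x) ^ 2) s one_pos
      (show 1 ≤ 1 + (x + ε) ^ 2 by nlinarith) (by nlinarith [hε.2])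
    rw [Real.one_rpow, ← Real.rpow_natCast (2 + x), ← Real.rpow_mul (by positivity)] at this
    push_cast at this
    calc _ ≤ (1 + (2 + x) ^ (2 * s)) * Real.exp (-(p.re * x)) := by gcongr
      _ = _ := by ring
  · refine (ae_restrict_mem measurableSet_Ioi).mono fun x hx => ?_
    have hx : 0 < x := hx
    have hc : ContinuousAt (fun ε : ℝ => shifted s p ε x) 0 := by
      unfold shifted
      refine ContinuousAt.mul (ContinuousAt.cpow (by fun_prop) continuousAt_const ?_) continuousAt_const
      exact one_add_sq_mem_slitPlane (by simpa using hx)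
    have := hc.tendsto.mono_left (nhdsWithin_le_nhds (s := Ioi 0))
    convert this using 2
    rw [shifted, Complex.ofReal_zero, add_zero, mul_comm, Complex.ofReal_cpow (by positivity)]
    push_cast
    rfl

theorem norm_shifted_mul_I_le {s ε y : ℝ} (p : ℂ) (hε : 0 < ε) (hε1 : ε < 1) (hy : 0 < y)
    (hy1 : y ≠ 1) :
    ‖shifted s p ε (y * Complex.I)‖ ≤
      (|1 - y ^ 2| ^ s + (2 + y) ^ (2 * s)) * Real.exp (-(-p.im * y)) := by
  have e := norm_cexp_neg_mul p 0 y
  simp only [Complex.ofReal_zero, zero_add, mul_zero] at e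
  rw [shifted, norm_mul, e, Complex.norm_cpow_real]
  gcongr
  have h0 : 0 < |1 - y ^ 2| := by
    rw [abs_pos, show 1 - y ^ 2 = (1 - y) * (1 + y) by ring]
    exact mul_ne_zero (sub_ne_zero.2 hy1.symm) (by positivity)
  have h1 := abs_one_sub_sq_le_norm (ε := ε) hy.le
  have h2 := norm_one_add_sq_le (ε + y * Complex.I)
  have h3 := norm_ofReal_add_ofReal_mul_I_le hε.le hy.le
  have := rpow_le_add_of_mem_Icc (C := (2 + y) ^ 2) s h0 h1 
    (h2.trans (pow_le_pow_left₀ (by positivity) (by linarith) 2))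
  rw [← Real.rpow_natCast (2 + y), ← Real.rpow_mul (by positivity)] at this
  push_cast at this
  rwa [add_comm (y * Complex.I : ℂ)]

/-- The limit `ε → 0+` of the shifted rotation, by dominated convergence on each side of the branch
point `y = 1`: below it `1 - y²` is positive, above it the phase `e^{iπs}` appears. The singularity
at `y = 1` is integrable because `s > -1`. -/
theorem laplaceHalf_rotate {s : ℝ} (hs : -1 < s) {p : ℂ} (hp : 0 < p.re) (hp' : p.im < 0) :
    laplaceHalf s p = Complex.I * laplaceUnit s (Complex.I * p) +
      Complex.I * Complex.exp (Complex.I * Real.pi * s) * laplaceTail s (Complex.I * p) := by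
  have hβ : 0 < -p.im := by linarith
  have t1 := tendsto_integral_shifted_re s hp
  have t2 : Tendsto (fun ε : ℝ => ∫ y in Ioo (0 : ℝ) 1, shifted s p ε (y * Complex.I)) (𝓝[>] 0)
      (𝓝 (laplaceUnit s (Complex.I * p))) := by
    have hbd : IntegrableOn (fun y : ℝ => (1 - y ^ 2) ^ s + (1 + 3 ^ (2 * s))) (Ioo 0 1) :=
      (integrableOn_one_sub_sq_rpow hs).add (integrableOn_const (by simp))
    refine tendsto_integral_filter_of_dominated_convergence _
      (Eventually.of_forall fun ε => Measurable.aestronglyMeasurable (by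
        unfold shifted; fun_prop)) ?_ hbd ?_
    · filter_upwards [Ioo_mem_nhdsGT (zero_lt_one' ℝ)] with ε hε
      refine (ae_restrict_mem measurableSet_Ioo).mono fun y hy => ?_
      refine (norm_shifted_mul_I_le p hε.1 hε.2 hy.1 hy.2.ne).trans ?_
      have h1 : 0 < 1 - y ^ 2 := by nlinarith [hy.1, hy.2]
      have h2 : (2 + y) ^ (2 * s) ≤ 1 + 3 ^ (2 * s) := by
        have := rpow_le_add_of_mem_Icc (C := 3) (2 * s) one_pos (show 1 ≤ 2 + y by linarith [hy.1])
          (by linarith [hy.2])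
        rwa [Real.one_rpow] at this
      have h3 : Real.exp (-(-p.im * y)) ≤ 1 := by
        rw [Real.exp_le_one_iff]
        have := mul_pos hβ hy.1
        linarith
      have hy0 := hy.1
      rw [abs_of_pos h1]
      exact (mul_le_of_le_one_right (by positivity) h3).trans (by gcongr)
    · refine (ae_restrict_mem measurableSet_Ioo).mono fun y hy => ?_
      have h1 : 0 < 1 - y ^ 2 := by nlinarith [hy.1, hy.2]
      have hz : (1 + (y * Complex.I + (0 : ℝ)) ^ 2 : ℂ) = ((1 - y ^ 2 : ℝ) : ℂ) := by
        push_cast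
        ring_nf
        rw [Complex.I_sq]
        ring
      have hc : ContinuousAt (fun ε : ℝ => shifted s p ε (y * Complex.I)) 0 := by
        unfold shifted
        refine ContinuousAt.mul (ContinuousAt.cpow (by fun_prop) continuousAt_const ?_) continuousAt_const
        rw [hz]
        exact Or.inl (by rw [Complex.ofReal_re]; exact h1)
      have := hc.tendsto.mono_left (nhdsWithin_le_nhds (s := Ioi 0))
      convert this using 2
      rw [shifted, hz, Complex.ofReal_cpow h1.le, mul_comm]
      congr 2
      ring
  have t3 : Tendsto (fun ε : ℝ => ∫ y in Ioi (1 : ℝ), shifted s p ε (y * Complex.I)) (𝓝[>] 0)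
      (𝓝 (Complex.exp (Complex.I * Real.pi * s) * laplaceTail s (Complex.I * p))) := by
    rw [laplaceTail, ← integral_const_mul]
    have hb1 := (integrableOn_laplaceTail_ofReal hs hβ).norm
    have hb2 := (integrableOn_exp_neg_mul_mul_add_rpow (2 * s) hβ two_pos).mono_set
      (Ioi_subset_Ioi zero_le_one)
    refine tendsto_integral_filter_of_dominated_convergence _
      (Eventually.of_forall fun ε => Measurable.aestronglyMeasurable (by
        unfold shifted; fun_prop)) ?_ (hb1.add hb2) ?_
    · filter_upwards [Ioo_mem_nhdsGT (zero_lt_one' ℝ)] with ε hε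
      refine (ae_restrict_mem measurableSet_Ioi).mono fun y hy => ?_
      have hy : 1 < y := hy
      have hy0 : 0 < y := by linarith
      refine (norm_shifted_mul_I_le p hε.1 hε.2 (by linarith) hy.ne').trans (le_of_eq ?_)
      have h1 : 0 < y ^ 2 - 1 := by nlinarith
      simp only [Pi.add_apply]
      rw [norm_mul, Complex.norm_real, Complex.norm_exp, abs_sub_comm, abs_of_pos h1,
        Real.norm_of_nonneg (by positivity)]
      simp
      ring
    · refine (ae_restrict_mem measurableSet_Ioi).mono fun y hy => ?_
      have := (tendsto_cpow_of_re_neg (s := s) hy).mul_const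
        (Complex.exp (-(p * (y * Complex.I))))
      rw [show -(p * ((y : ℂ) * Complex.I)) = -(Complex.I * p * y) by ring, mul_assoc _ _
        (Complex.exp (-(Complex.I * p * y))), mul_comm _ (Complex.exp (-(Complex.I * p * y)))] at this
      refine this.congr fun ε => ?_
      rw [shifted, show -(p * ((y : ℂ) * Complex.I)) = -(Complex.I * p * y) by ring]
  have t4 := ((t2.add t3).const_mul Complex.I).congr' (f₂ := fun ε : ℝ =>
    ∫ x in Ioi (0 : ℝ), shifted s p ε x) ?_
  · rw [tendsto_nhds_unique t1 t4]
    ring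
  · filter_upwards [self_mem_nhdsWithin] with ε hε
    have hi := integrableOn_shifted_im s hp' hε
    rw [integral_shifted_rotate s hp hp' hε, ← Ioc_union_Ioi_eq_Ioi (zero_le_one' ℝ),
      setIntegral_union Ioc_disjoint_Ioi_same measurableSet_Ioi
        (hi.mono_set Ioc_subset_Ioi_self) (hi.mono_set (Ioi_subset_Ioi zero_le_one)),
      integral_Ioc_eq_integral_Ioo]

/-! ### Moments on the unit segment and the Struve series. -/

theorem image_rpow_half : (fun u : ℝ => u ^ (1 / 2 : ℝ)) '' Ioo 0 1 = Ioo 0 1 := by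
  ext t
  constructor
  · rintro ⟨u, hu, rfl⟩
    exact ⟨Real.rpow_pos_of_pos hu.1 _, Real.rpow_lt_one hu.1.le hu.2 (by norm_num)⟩
  · intro ht
    refine ⟨t ^ (2 : ℝ), ⟨Real.rpow_pos_of_pos ht.1 _,
      Real.rpow_lt_one ht.1.le ht.2 (by norm_num)⟩, ?_⟩
    simp only
    rw [← Real.rpow_mul ht.1.le]
    norm_num

theorem integral_pow_mul_one_sub_sq_rpow {s : ℝ} (hs : -1 < s) (n : ℕ) :
    ∫ y in Ioo (0 : ℝ) 1, y ^ n * (1 - y ^ 2) ^ s =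
      1 / 2 * (Real.Gamma ((n + 1) / 2) * Real.Gamma (s + 1) / Real.Gamma ((n + 1) / 2 + s + 1)) := by
  have hd : ∀ u ∈ Ioo (0 : ℝ) 1, HasDerivWithinAt (fun u : ℝ => u ^ (1 / 2 : ℝ))
      (1 / 2 * u ^ (1 / 2 - 1 : ℝ)) (Ioo 0 1) u := fun u hu =>
    (Real.hasDerivAt_rpow_const (Or.inl hu.1.ne')).hasDerivWithinAt
  have hi : InjOn (fun u : ℝ => u ^ (1 / 2 : ℝ)) (Ioo 0 1) :=
    (Real.rpow_left_injOn (by norm_num)).mono fun u hu => hu.1.le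
  have ha : 0 < ((n : ℝ) + 1) / 2 := by positivity
  rw [← image_rpow_half, integral_image_eq_integral_abs_deriv_smul measurableSet_Ioo hd hi,
    add_assoc _ s, ← integral_beta ha (show 0 < s + 1 by linarith), ← integral_const_mul]
  refine setIntegral_congr_fun measurableSet_Ioo fun u hu => ?_
  have hu0 := hu.1
  have h1 : (u ^ (1 / 2 : ℝ)) ^ 2 = u := by
    rw [← Real.rpow_natCast, ← Real.rpow_mul hu0.le]; norm_num
  have h2 : (u ^ (1 / 2 : ℝ)) ^ n = u ^ ((n : ℝ) / 2) := by
    rw [← Real.rpow_natCast, ← Real.rpow_mul hu0.le]; congr 1; ring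
  rw [h1, h2, abs_of_pos (by positivity), smul_eq_mul, add_sub_cancel_right,
    show ((n : ℝ) + 1) / 2 - 1 = (1 / 2 - 1) + n / 2 by ring, Real.rpow_add hu0]
  ring

theorem hasSum_laplaceUnit {s : ℝ} (hs : -1 < s) (X : ℂ) :
    HasSum (fun n : ℕ => (-X) ^ n / n.factorial * ((1 / 2 * (Real.Gamma ((n + 1) / 2) *
      Real.Gamma (s + 1) / Real.Gamma ((n + 1) / 2 + s + 1)) : ℝ) : ℂ)) (laplaceUnit s X) := by
  have hint := integrableOn_one_sub_sq_rpow hs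
  have hle : ∀ n : ℕ, ∀ y ∈ Ioo (0 : ℝ) 1,
      ‖(-X) ^ n / n.factorial * ((y ^ n * (1 - y ^ 2) ^ s : ℝ) : ℂ)‖ ≤
        ‖X‖ ^ n / n.factorial * (1 - y ^ 2) ^ s := by
    intro n y hy
    have h1 : 0 < 1 - y ^ 2 := by nlinarith [hy.1, hy.2]
    have hy0 := hy.1
    rw [norm_mul, norm_div, norm_pow, norm_neg, Complex.norm_natCast, Complex.norm_real,
      Real.norm_of_nonneg (by positivity)]
    gcongr
    exact mul_le_of_le_one_left (by positivity) (pow_le_one₀ hy0.le hy.2.le)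
  have hF : ∀ n : ℕ, IntegrableOn
      (fun y : ℝ => (-X) ^ n / n.factorial * ((y ^ n * (1 - y ^ 2) ^ s : ℝ) : ℂ)) (Ioo 0 1) :=
    fun n => Integrable.mono' (hint.const_mul (‖X‖ ^ n / n.factorial))
      (Measurable.aestronglyMeasurable (by fun_prop))
      ((ae_restrict_mem measurableSet_Ioo).mono fun y hy => hle n y hy)
  have hsum : Summable fun n : ℕ => ∫ y in Ioo (0 : ℝ) 1,
      ‖(-X) ^ n / n.factorial * ((y ^ n * (1 - y ^ 2) ^ s : ℝ) : ℂ)‖ := by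
    refine Summable.of_nonneg_of_le (fun n => integral_nonneg fun _ => norm_nonneg _) (fun n => ?_)
      ((Real.summable_pow_div_factorial ‖X‖).mul_right (∫ y in Ioo (0 : ℝ) 1, (1 - y ^ 2) ^ s))
    rw [← integral_const_mul]
    exact setIntegral_mono_on (hF n).norm (hint.const_mul _) measurableSet_Ioo (hle n)
  have e1 : (fun n : ℕ => (-X) ^ n / n.factorial * ((1 / 2 * (Real.Gamma ((n + 1) / 2) *
      Real.Gamma (s + 1) / Real.Gamma ((n + 1) / 2 + s + 1)) : ℝ) : ℂ)) = fun n : ℕ =>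
      ∫ y in Ioo (0 : ℝ) 1, (-X) ^ n / n.factorial * ((y ^ n * (1 - y ^ 2) ^ s : ℝ) : ℂ) := by
    funext n
    rw [integral_const_mul, integral_complex_ofReal, integral_pow_mul_one_sub_sq_rpow hs]
  have e2 : laplaceUnit s X = ∫ y in Ioo (0 : ℝ) 1, ∑' n : ℕ,
      (-X) ^ n / n.factorial * ((y ^ n * (1 - y ^ 2) ^ s : ℝ) : ℂ) := by
    refine setIntegral_congr_fun measurableSet_Ioo fun y _ => ?_
    have he := (NormedSpace.expSeries_div_hasSum_exp (-(X * y))).mul_right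
      (((1 - y ^ 2) ^ s : ℝ) : ℂ)
    rw [← Complex.exp_eq_exp_ℂ] at he
    rw [← he.tsum_eq]
    refine tsum_congr fun n => ?_
    push_cast
    rw [← neg_mul, mul_pow]
    ring
  rw [e1, e2]
  exact hasSum_integral_of_summable_integral_norm hF hsum

/-- By duplication `Γ(m + 1/2)/(2m)! = √π/(4^m m!)`, so the even moments are the coefficients of the
`J_ν` series. -/
theorem moment_even (ν : ℝ) (m : ℕ) :
    ((2 * m).factorial : ℝ)⁻¹ * (1 / 2 * (Real.Gamma (((2 * m : ℕ) + 1) / 2) *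
      Real.Gamma (ν - 1 / 2 + 1) / Real.Gamma (((2 * m : ℕ) + 1) / 2 + (ν - 1 / 2) + 1))) =
    Real.sqrt Real.pi / 2 * Real.Gamma (ν + 1 / 2) *
      ((4 ^ m)⁻¹ * (m.factorial * Real.Gamma (ν + m + 1))⁻¹) := by
  have h := Real.Gamma_mul_Gamma_add_half (m + 1 / 2)
  rw [show (m : ℝ) + 1 / 2 + 1 / 2 = m + 1 by ring, Real.Gamma_nat_eq_factorial,
    show 2 * ((m : ℝ) + 1 / 2) = ((2 * m : ℕ) : ℝ) + 1 by push_cast; ring,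
    Real.Gamma_nat_eq_factorial, show (1 : ℝ) - (((2 * m : ℕ) : ℝ) + 1) = -((2 * m : ℕ) : ℝ) by ring,
    Real.rpow_neg two_pos.le, Real.rpow_natCast, pow_mul] at h
  norm_num at h
  have e1 : ((((2 * m : ℕ) : ℝ)) + 1) / 2 = m + 1 / 2 := by push_cast; ring
  rw [e1, show (m : ℝ) + 1 / 2 + (ν - 1 / 2) + 1 = ν + m + 1 by ring,
    show ν - 1 / 2 + 1 = ν + 1 / 2 by ring]
  have hm : (m.factorial : ℝ) ≠ 0 := by positivity
  have hm2 : ((2 * m).factorial : ℝ) ≠ 0 := by positivity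
  have h4 : (4 : ℝ) ^ m ≠ 0 := by positivity
  rw [mul_inv, div_eq_mul_inv (_ * _)]
  generalize Real.Gamma (m + 1 / 2) = G at *
  generalize (Real.Gamma (ν + m + 1))⁻¹ = K at *
  generalize Real.Gamma (ν + 1 / 2) = L at *
  field_simp at h ⊢
  linear_combination L * K * h

/-- By duplication `m!/(2m+1)! = √π/(2·4^m Γ(m + 3/2))`, so the odd moments are the Struve
coefficients. -/
theorem moment_odd (ν : ℝ) (m : ℕ) :
    ((2 * m + 1).factorial : ℝ)⁻¹ * (1 / 2 * (Real.Gamma (((2 * m + 1 : ℕ) + 1) / 2) *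
      Real.Gamma (ν - 1 / 2 + 1) / Real.Gamma (((2 * m + 1 : ℕ) + 1) / 2 + (ν - 1 / 2) + 1))) =
    Real.sqrt Real.pi / 2 * Real.Gamma (ν + 1 / 2) *
      ((2 * 4 ^ m)⁻¹ * (Real.Gamma (m + 3 / 2) * Real.Gamma (m + ν + 3 / 2))⁻¹) := by
  have h := Real.Gamma_mul_Gamma_add_half (m + 1)
  rw [show (m : ℝ) + 1 + 1 / 2 = m + 3 / 2 by ring, Real.Gamma_nat_eq_factorial,
    show 2 * ((m : ℝ) + 1) = ((2 * m + 1 : ℕ) : ℝ) + 1 by push_cast; ring,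
    Real.Gamma_nat_eq_factorial,
    show (1 : ℝ) - (((2 * m + 1 : ℕ) : ℝ) + 1) = -((2 * m + 1 : ℕ) : ℝ) by ring,
    Real.rpow_neg two_pos.le, Real.rpow_natCast, pow_succ, pow_mul] at h
  norm_num at h
  have e1 : ((((2 * m + 1 : ℕ) : ℝ)) + 1) / 2 = m + 1 := by push_cast; ring
  rw [e1, show (m : ℝ) + 1 + (ν - 1 / 2) + 1 = m + ν + 3 / 2 by ring,
    show ν - 1 / 2 + 1 = ν + 1 / 2 by ring, Real.Gamma_nat_eq_factorial]
  have hG : Real.Gamma (m + 3 / 2) ≠ 0 := (Real.Gamma_pos_of_pos (by positivity)).ne'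
  have hm2 : ((2 * m + 1).factorial : ℝ) ≠ 0 := by positivity
  have h4 : (4 : ℝ) ^ m ≠ 0 := by positivity
  rw [mul_inv (Real.Gamma _), div_eq_mul_inv (_ * _)]
  generalize Real.Gamma (m + 3 / 2) = G at *
  generalize (Real.Gamma (m + ν + 3 / 2))⁻¹ = K at *
  generalize Real.Gamma (ν + 1 / 2) = L at *
  field_simp at h ⊢
  linear_combination L * K * h

theorem laplaceUnit_term_even (ν : ℝ) (z : ℂ) (m : ℕ) :
    (-(Complex.I * z)) ^ (2 * m) / (2 * m).factorial *
      ((1 / 2 * (Real.Gamma (((2 * m : ℕ) + 1) / 2) * Real.Gamma (ν - 1 / 2 + 1) /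
        Real.Gamma (((2 * m : ℕ) + 1) / 2 + (ν - 1 / 2) + 1)) : ℝ) : ℂ) =
      ((Real.sqrt Real.pi / 2 * Real.Gamma (ν + 1 / 2) : ℝ) : ℂ) *
        ((-(z ^ 2 / 4)) ^ m * (((m.factorial * Real.Gamma (ν + m + 1))⁻¹ : ℝ) : ℂ)) := by
  have hm := congrArg (fun r : ℝ => (r : ℂ)) (moment_even ν m)
  generalize (1 / 2 * (Real.Gamma (((2 * m : ℕ) + 1) / 2) * Real.Gamma (ν - 1 / 2 + 1) /
        Real.Gamma (((2 * m : ℕ) + 1) / 2 + (ν - 1 / 2) + 1)) : ℝ) = A at *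
  generalize ((m.factorial * Real.Gamma (ν + m + 1))⁻¹ : ℝ) = B at *
  generalize Real.sqrt Real.pi / 2 * Real.Gamma (ν + 1 / 2) = D at *
  push_cast at hm
  have h4 : (4 : ℂ) ^ m * (4 ^ m)⁻¹ = 1 := mul_inv_cancel₀ (pow_ne_zero _ (by norm_num))
  rw [pow_mul, show (-(Complex.I * z)) ^ 2 = 4 * -(z ^ 2 / 4) by
      rw [neg_sq, mul_pow, Complex.I_sq]; ring, mul_pow, div_eq_mul_inv, mul_assoc, hm]
  linear_combination (-(z ^ 2 / 4)) ^ m * D * B * h4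

theorem laplaceUnit_term_odd (ν : ℝ) (z : ℂ) (m : ℕ) :
    (-(Complex.I * z)) ^ (2 * m + 1) / (2 * m + 1).factorial *
      ((1 / 2 * (Real.Gamma (((2 * m + 1 : ℕ) + 1) / 2) * Real.Gamma (ν - 1 / 2 + 1) /
        Real.Gamma (((2 * m + 1 : ℕ) + 1) / 2 + (ν - 1 / 2) + 1)) : ℝ) : ℂ) =
      ((Real.sqrt Real.pi / 2 * Real.Gamma (ν + 1 / 2) : ℝ) : ℂ) * (-Complex.I * (z / 2) *
        ((-1 : ℂ) ^ m * (z / 2) ^ (2 * m) *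
          (((Real.Gamma (m + 3 / 2) * Real.Gamma (m + ν + 3 / 2))⁻¹ : ℝ) : ℂ))) := by
  have hm := congrArg (fun r : ℝ => (r : ℂ)) (moment_odd ν m)
  generalize (1 / 2 * (Real.Gamma (((2 * m + 1 : ℕ) + 1) / 2) * Real.Gamma (ν - 1 / 2 + 1) /
        Real.Gamma (((2 * m + 1 : ℕ) + 1) / 2 + (ν - 1 / 2) + 1)) : ℝ) = A at *
  generalize ((Real.Gamma (m + 3 / 2) * Real.Gamma (m + ν + 3 / 2))⁻¹ : ℝ) = B at *
  generalize Real.sqrt Real.pi / 2 * Real.Gamma (ν + 1 / 2) = D at *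
  push_cast at hm
  have h4 : (4 : ℂ) ^ m * (4 ^ m)⁻¹ = 1 := mul_inv_cancel₀ (pow_ne_zero _ (by norm_num))
  rw [pow_succ, pow_mul, show (-(Complex.I * z)) ^ 2 = 4 * (-1 * (z / 2) ^ 2) by
      rw [neg_sq, mul_pow, Complex.I_sq]; ring, mul_pow, mul_pow, ← pow_mul, div_eq_mul_inv,
      mul_assoc, hm, mul_inv]
  linear_combination -(-1) ^ m * (z / 2) ^ (2 * m) * Complex.I * z / 2 * D * B * h4

theorem hyp01_ofReal (ν : ℝ) (w : ℂ) : hyp01 ν w =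
    ∑' m : ℕ, w ^ m * (((m.factorial * Real.Gamma (ν + m + 1))⁻¹ : ℝ) : ℂ) := by
  rw [hyp01]
  refine tsum_congr fun m => ?_
  push_cast [← Complex.Gamma_ofReal]
  rfl

theorem tsum_laplaceUnit_term (f : ℕ → ℂ) (hs : Summable f) (p q : ℕ → ℂ) (c d : ℂ)
    (hp : ∀ m, f (2 * m) = c * p m) (hq : ∀ m, f (2 * m + 1) = c * (d * q m)) :
    ∑' n, f n = c * (∑' m, p m + d * ∑' m, q m) := by
  have he := hs.comp_injective (i := fun m : ℕ => 2 * m) fun a b h => by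
    simpa using h
  have ho := hs.comp_injective (i := fun m : ℕ => 2 * m + 1) fun a b h => by
    simpa using h
  rw [← tsum_even_add_odd he ho, tsum_congr hp, tsum_congr hq, tsum_mul_left, tsum_mul_left,
    tsum_mul_left, mul_add]

theorem laplaceUnit_eq {ν : ℝ} (hν : -(1 / 2) < ν) {z : ℂ} (hz : z ≠ 0) :
    laplaceUnit (ν - 1 / 2) (Complex.I * z) =
      ((Real.sqrt Real.pi / 2 * Real.Gamma (ν + 1 / 2) : ℝ) : ℂ) *
        (hyp01 ν (-(z ^ 2 / 4)) - Complex.I * ((z / 2) ^ (-(ν : ℂ)) * struveH ν z)) := by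
  have h := hasSum_laplaceUnit (show -1 < ν - 1 / 2 by linarith) (Complex.I * z)
  have hz2 : z / 2 ≠ 0 := div_ne_zero hz two_ne_zero
  have e : (z / 2) ^ (-(ν : ℂ)) * (z / 2) ^ ((ν + 1 : ℝ) : ℂ) = z / 2 := by
    rw [← Complex.cpow_add _ _ hz2]; push_cast; simp
  have h2 := tsum_laplaceUnit_term _ h.summable _ _ _ _ (laplaceUnit_term_even ν z)
    (laplaceUnit_term_odd ν z)
  rw [← h.tsum_eq, h2, hyp01_ofReal, struveH, ← mul_assoc ((z / 2) ^ (-(ν : ℂ))), e]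
  ring

/-! ### The integral for `Y_ν` and for `𝐇_ν - Y_ν`. -/

theorem I_mul_cpow {z : ℂ} (hz : 0 < z.re) (s : ℂ) :
    (Complex.I * z) ^ s = Complex.exp (Complex.I * Real.pi / 2 * s) * z ^ s := by
  have hz0 : z ≠ 0 := fun h => by simp [h] at hz
  have ha := Complex.abs_arg_lt_pi_div_two_iff.2 (Or.inl hz)
  rw [abs_lt] at ha
  have := Real.pi_pos
  rw [Complex.cpow_def_of_ne_zero (mul_ne_zero Complex.I_ne_zero hz0),
    Complex.cpow_def_of_ne_zero hz0, Complex.log_mul Complex.I_ne_zero hz0 ?_, Complex.log_I,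
    ← Complex.exp_add]
  · ring_nf
  · rw [Complex.arg_I]
    exact ⟨by linarith, by linarith⟩

theorem I_mul_mem_slitPlane {z : ℂ} (hz : 0 < z.re) : Complex.I * z ∈ Complex.slitPlane :=
  Or.inr (by simpa using hz.ne')

/-- The value of `Y_ν` given by the Laplace integral. -/
def besselYExt (ν : ℝ) (z : ℂ) : ℂ :=
  -((z / 2) ^ (ν : ℂ) * (Complex.I * hyp01 ν (-(z ^ 2 / 4)) + Complex.exp (Complex.I * Real.pi * ν) *
    (2 / Real.sqrt Real.pi * (Complex.Gamma (ν + 1 / 2))⁻¹ * laplaceTailExt ν (Complex.I * z))))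

/-- The connection formula at `iz`, where `(iz)² = -z²` turns the `I` series into `J` series. Of
`e^{iπν} = cos πν + i sin πν`, the sine part cancels the explicit `i J_ν` term, and the cosine part
remains. -/
theorem besselYQuot_eq {ν : ℝ} (h : -(1 / 2) < ν) (hν : ¬∃ n : ℤ, ν = n) {z : ℂ}
    (hz : 0 < z.re) : besselYQuot ν z = besselYExt ν z := by
  have hz0 : z ≠ 0 := fun h => by simp [h] at hz
  have hs := Complex.ofReal_ne_zero.2 (sin_ofReal_mul_pi_ne_zero hν)
  have hc := laplaceTailExt_connection (ν := ν) (by simpa using h) (I_mul_mem_slitPlane hz)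
  rw [mul_pow, Complex.I_sq, neg_one_mul, neg_div, I_mul_cpow hz] at hc
  rw [besselYQuot, besselYExt, besselJ_eq, besselJ_eq, div_eq_iff hs]
  have e : (z / 2) ^ ((-ν : ℝ) : ℂ) = (z / 2) ^ (ν : ℂ) * (2 ^ (2 * ν : ℂ) * z ^ (-(2 * ν : ℂ))) := by
    have := div_two_cpow hz0 (-(2 * ν : ℂ))
    rw [neg_neg] at this
    rw [← this, ← Complex.cpow_add _ _ (div_ne_zero hz0 two_ne_zero)]
    congr 1
    push_cast
    ring
  have hpi : (Real.pi : ℂ) ≠ 0 := Complex.ofReal_ne_zero.2 Real.pi_ne_zero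
  have hsq : (Real.sqrt Real.pi : ℂ) ^ 2 = Real.pi := by
    rw [← Complex.ofReal_pow, Real.sq_sqrt Real.pi_pos.le]
  have hsq0 : (Real.sqrt Real.pi : ℂ) ≠ 0 := fun h => hpi (by rw [← hsq, h]; simp)
  have h2 : (2 : ℂ) ^ (ν : ℂ) * 2 ^ (-(ν : ℂ)) = 1 := by
    rw [← Complex.cpow_add _ _ two_ne_zero]; simp
  have h22 : (2 : ℂ) ^ (2 * ν : ℂ) = 2 ^ (ν : ℂ) * 2 ^ (ν : ℂ) := by
    rw [← Complex.cpow_add _ _ two_ne_zero]; ring_nf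
  have hexp : Complex.exp (Complex.I * Real.pi * ν) *
      Complex.exp (Complex.I * Real.pi / 2 * -(2 * ν)) = 1 := by
    rw [← Complex.exp_add]; ring_nf; simp
  have hE : Complex.exp (Complex.I * Real.pi * ν) =
      Complex.cos (Real.pi * ν) + Complex.sin (Real.pi * ν) * Complex.I := by
    rw [← Complex.exp_mul_I]; ring_nf
  have hY : Complex.sin (Real.pi * ν) * (2 / Real.sqrt Real.pi * (Complex.Gamma (ν + 1 / 2))⁻¹ *
      laplaceTailExt ν (Complex.I * z)) =
      2 ^ (2 * ν : ℂ) * (Complex.exp (Complex.I * Real.pi / 2 * -(2 * ν)) * z ^ (-(2 * ν : ℂ))) *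
        hyp01 (-ν) (-(z ^ 2 / 4)) - hyp01 ν (-(z ^ 2 / 4)) := by
    rw [h22]
    have : (Real.sqrt Real.pi : ℂ) / Real.pi = 1 / Real.sqrt Real.pi := by
      rw [← hsq]; field_simp
    rw [div_eq_div_iff hpi hsq0] at this
    have hmul := congrArg (fun x => 2 / (Real.pi : ℂ) * 2 ^ (ν : ℂ) * x) hc
    have hx : (2 : ℂ) / Real.sqrt Real.pi = 2 / Real.pi * Real.sqrt Real.pi := by
      rw [← hsq]; field_simp
    rw [hx]
    have hpp : 2 / (Real.pi : ℂ) * (Real.pi / 2) = 1 := by field_simp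
    linear_combination hmul - Complex.sin (Real.pi * ν) * (2 / Real.pi * Real.sqrt Real.pi *
      (Complex.Gamma (ν + 1 / 2))⁻¹ * laplaceTailExt ν (Complex.I * z)) * h2 +
      (2 ^ (ν : ℂ) * 2 ^ (ν : ℂ) * (Complex.exp (Complex.I * Real.pi / 2 * -(2 * ν)) *
        z ^ (-(2 * ν : ℂ))) * hyp01 (-ν) (-(z ^ 2 / 4))) * hpp -
      2 / Real.pi * (Real.pi / 2) * hyp01 ν (-(z ^ 2 / 4)) * h2 - hyp01 ν (-(z ^ 2 / 4)) * hpp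
  rw [e]
  push_cast
  rw [mul_comm (ν : ℂ)]
  generalize laplaceTailExt ν (Complex.I * z) = T at *
  generalize hyp01 (-ν) (-(z ^ 2 / 4)) = B at *
  generalize hyp01 ν (-(z ^ 2 / 4)) = A at *
  linear_combination (z / 2) ^ (ν : ℂ) * Complex.exp (Complex.I * Real.pi * ν) * hY +
    (z / 2) ^ (ν : ℂ) * 2 ^ (2 * ν : ℂ) * z ^ (-(2 * ν : ℂ)) * B * hexp -
    (z / 2) ^ (ν : ℂ) * A * hE

theorem besselY_eq {ν : ℝ} (h : -(1 / 2) < ν) {z : ℂ} (hz : 0 < z.re) :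
    besselY ν z = besselYExt ν z := by
  have hz0 : z / 2 ≠ 0 := div_ne_zero (fun h => by simp [h] at hz) two_ne_zero
  rw [besselY]
  split_ifs with hν
  · refine limUnder_nhdsNE_eq h ?_ fun x h1 hx => besselYQuot_eq h1 hx hz
    refine (ContinuousAt.mul ?_ (ContinuousAt.add ?_ (ContinuousAt.mul ?_ (ContinuousAt.mul ?_
      (continuousAt_laplaceTailExt_ofReal h (I_mul_mem_slitPlane hz)))))).neg
    · exact (continuous_const_cpow_ofReal hz0 (by fun_prop)).continuousAt
    · exact (continuous_const.mul ((differentiable_hyp01_left (-(z ^ 2 / 4))).continuous.comp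
        Complex.continuous_ofReal)).continuousAt
    · fun_prop
    · exact (continuous_const.mul (continuous_inv_Gamma_ofReal _)).continuousAt
  · exact besselYQuot_eq h hν hz

theorem norm_laplaceHalf_integrand_le (s : ℝ) {p : ℂ} {r x : ℝ} (hr : r ≤ p.re) (hx : 0 < x) :
    ‖Complex.exp (-(p * x)) * (((1 + x ^ 2) ^ s : ℝ) : ℂ)‖ ≤
      Real.exp (-(r * x)) * (1 + x) ^ (0 : ℝ) + Real.exp (-(r * x)) * (1 + x) ^ (2 * s) := by
  rw [norm_mul, Complex.norm_real, Real.norm_of_nonneg (by positivity), ← mul_add]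
  gcongr
  · exact norm_exp_neg_mul_ofReal_le hr hx.le
  · have := rpow_le_add_of_mem_Icc (c := 1) (r := 1 + x ^ 2) (C := (1 + x) ^ 2) s one_pos
      (by nlinarith) (by nlinarith)
    rw [← Real.rpow_natCast (1 + x), ← Real.rpow_mul (by positivity), Real.one_rpow] at this
    simpa using this

theorem integrableOn_laplaceHalf_bound (s : ℝ) {r : ℝ} (hr : 0 < r) :
    IntegrableOn (fun x : ℝ => Real.exp (-(r * x)) * (1 + x) ^ (0 : ℝ) +
      Real.exp (-(r * x)) * (1 + x) ^ (2 * s)) (Ioi 0) :=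
  (integrableOn_exp_neg_mul_mul_add_rpow 0 hr one_pos).add
    (integrableOn_exp_neg_mul_mul_add_rpow (2 * s) hr one_pos)

theorem eventually_half_re_le {z₀ : ℂ} (hz : 0 < z₀.re) : ∀ᶠ z : ℂ in 𝓝 z₀, z₀.re / 2 ≤ z.re :=
  (Complex.continuous_re.continuousAt.eventually (lt_mem_nhds (half_lt_self hz))).mono
    fun _ h => h.le

theorem eventually_norm_le_add_one (z₀ : ℂ) : ∀ᶠ z : ℂ in 𝓝 z₀, ‖z‖ ≤ ‖z₀‖ + 1 :=
  (continuous_norm.continuousAt.eventually (gt_mem_nhds (lt_add_one ‖z₀‖))).mono fun _ h => h.le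

theorem differentiableOn_laplaceHalf (s : ℝ) :
    DifferentiableOn ℂ (laplaceHalf s) {p | 0 < p.re} := by
  refine differentiableOn_integral_of_locally_dominated isOpen_re_pos measurableSet_Ioi
    (fun z => Measurable.aestronglyMeasurable (by fun_prop)) (fun t _ => by fun_prop)
    fun z₀ hz₀ => ⟨_, integrableOn_laplaceHalf_bound s (half_pos hz₀), ?_⟩
  filter_upwards [eventually_half_re_le hz₀] with z hz t ht
  exact norm_laplaceHalf_integrand_le s hz ht

theorem norm_laplaceUnit_integrand_le (s : ℝ) {X : ℂ} {R y : ℝ} (hX : ‖X‖ ≤ R)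
    (hy : y ∈ Ioo (0 : ℝ) 1) :
    ‖Complex.exp (-(X * y)) * (((1 - y ^ 2) ^ s : ℝ) : ℂ)‖ ≤ Real.exp R * (1 - y ^ 2) ^ s := by
  have h1 : 0 < 1 - y ^ 2 := by nlinarith [hy.1, hy.2]
  rw [norm_mul, Complex.norm_real, Real.norm_of_nonneg (by positivity)]
  gcongr
  refine (Complex.norm_exp_le_exp_norm _).trans (Real.exp_le_exp.2 ?_)
  rw [norm_neg, norm_mul, Complex.norm_real, Real.norm_of_nonneg hy.1.le]
  exact (mul_le_of_le_one_right (norm_nonneg _) hy.2.le).trans hX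

theorem differentiable_laplaceUnit {s : ℝ} (hs : -1 < s) : Differentiable ℂ (laplaceUnit s) := by
  rw [← differentiableOn_univ]
  refine differentiableOn_integral_of_locally_dominated isOpen_univ measurableSet_Ioo
    (fun z => Measurable.aestronglyMeasurable (by fun_prop)) (fun t _ => by fun_prop)
    fun z₀ _ => ⟨_, (integrableOn_one_sub_sq_rpow hs).const_mul (Real.exp (‖z₀‖ + 1)), ?_⟩
  filter_upwards [eventually_norm_le_add_one z₀] with z hz t ht
  exact norm_laplaceUnit_integrand_le s hz ht

theorem I_mul_exp_I_mul_pi_sub_half (ν : ℝ) :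
    Complex.I * Complex.exp (Complex.I * Real.pi * ((ν - 1 / 2 : ℝ) : ℂ)) =
      Complex.exp (Complex.I * Real.pi * ν) := by
  have : Complex.exp (Complex.I * Real.pi * ν) =
      Complex.exp (Real.pi / 2 * Complex.I) *
        Complex.exp (Complex.I * Real.pi * ((ν - 1 / 2 : ℝ) : ℂ)) := by
    rw [← Complex.exp_add]
    congr 1
    push_cast
    ring
  rw [this, Complex.exp_pi_div_two_mul_I]

/-- The rotation is available only in the quadrant `Re p > 0 > Im p`. With the tail replaced by its
extension to the slit plane, which contains `ip`, both sides are holomorphic for `Re p > 0`; in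
particular real `p` is reached. -/
theorem laplaceHalf_eq {ν : ℝ} (hν : -(1 / 2) < ν) {p : ℂ} (hp : 0 < p.re) :
    laplaceHalf (ν - 1 / 2) p = Complex.I * laplaceUnit (ν - 1 / 2) (Complex.I * p) +
      Complex.exp (Complex.I * Real.pi * ν) * laplaceTailExt ν (Complex.I * p) := by
  have hs : -1 < ν - 1 / 2 := by linarith
  refine eqOn_of_eqOn_open (V := {p : ℂ | 0 < p.re} ∩ {p | p.im < 0}) (z := 1 - Complex.I)
    (f := laplaceHalf (ν - 1 / 2)) (g := fun p => Complex.I * laplaceUnit (ν - 1 / 2)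
      (Complex.I * p) + Complex.exp (Complex.I * Real.pi * ν) * laplaceTailExt ν (Complex.I * p))
    isOpen_re_pos isPreconnected_re_pos
    (differentiableOn_laplaceHalf _) ?_
    (isOpen_re_pos.inter (isOpen_lt Complex.continuous_im continuous_const)) (by simp) (by simp)
    (fun p hp => ?_) hp
  · refine DifferentiableOn.add (Differentiable.differentiableOn ?_) (DifferentiableOn.const_mul ?_ _)
    · exact ((differentiable_laplaceUnit hs).comp (by fun_prop)).const_mul _
    · exact (differentiableOn_laplaceTailExt_right (ν := ν) (by simpa using hν)).comp
        (f := fun p : ℂ => Complex.I * p) (by fun_prop) fun p hp => I_mul_mem_slitPlane hp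
  · have hp1 : 0 < p.re := hp.1
    have hp2 : p.im < 0 := hp.2
    rw [laplaceHalf_rotate hs hp1 hp2, laplaceTail_eq_ext hs (by simpa using hp2),
      I_mul_exp_I_mul_pi_sub_half,
      show ((ν - 1 / 2 : ℝ) : ℂ) + 1 / 2 = ν by push_cast; ring]

/-- The odd part of the segment integral is `𝐇_ν`; its even part, a multiple of `i J_ν`, combines
with the tail to `-Y_ν`. -/
theorem laplaceHalf_eq_struveK {ν : ℝ} (hν : -(1 / 2) < ν) {p : ℂ} (hp : 0 < p.re) :
    laplaceHalf (ν - 1 / 2) p = ((Real.sqrt Real.pi / 2 * Real.Gamma (ν + 1 / 2) : ℝ) : ℂ) *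
      ((p / 2) ^ (-(ν : ℂ)) * struveK ν p) := by
  have hp0 : p ≠ 0 := fun h => by simp [h] at hp
  have hG : (Complex.Gamma (ν + 1 / 2)) = ((Real.Gamma (ν + 1 / 2) : ℝ) : ℂ) := by
    rw [← Complex.Gamma_ofReal]; push_cast; rfl
  have hG0 : ((Real.Gamma (ν + 1 / 2) : ℝ) : ℂ) ≠ 0 :=
    Complex.ofReal_ne_zero.2 (Real.Gamma_pos_of_pos (by linarith)).ne'
  have hsq0 : (Real.sqrt Real.pi : ℂ) ≠ 0 :=
    Complex.ofReal_ne_zero.2 (Real.sqrt_pos.2 Real.pi_pos).ne'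
  have e : (p / 2) ^ (-(ν : ℂ)) * (p / 2) ^ (ν : ℂ) = 1 := by
    rw [← Complex.cpow_add _ _ (div_ne_zero hp0 two_ne_zero)]; simp
  have e2 : (Real.sqrt Real.pi : ℂ) / 2 * (Real.Gamma (ν + 1 / 2) : ℝ) *
      (2 / Real.sqrt Real.pi * ((Real.Gamma (ν + 1 / 2) : ℝ) : ℂ)⁻¹) = 1 := by
    generalize ((Real.Gamma (ν + 1 / 2) : ℝ) : ℂ) = G at *
    field_simp
  rw [laplaceHalf_eq hν hp, laplaceUnit_eq hν hp0, struveK, besselY_eq hν hp, besselYExt, hG]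
  push_cast at e2 ⊢
  generalize ((Real.Gamma (ν + 1 / 2) : ℝ) : ℂ) = G at *
  generalize laplaceTailExt ν (Complex.I * p) = T at *
  generalize struveH ν p = B at *
  generalize hyp01 ν (-(p ^ 2 / 4)) = A at *
  generalize Complex.exp (Complex.I * Real.pi * ν) = E at *
  linear_combination -(Real.sqrt Real.pi / 2 * G * (Complex.I * A + E *
    (2 / Real.sqrt Real.pi * G⁻¹ * T))) * e - E * T * e2 -
    Real.sqrt Real.pi / 2 * G * (p / 2) ^ (-(ν : ℂ)) * B * Complex.I_sq

/-! ### Convergence and holomorphy of `S` and `J`. -/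

theorem ofReal_sq_add_sq_eq (t : ℝ) (a : ℂ) :
    (t : ℂ) ^ 2 + a ^ 2 = (a - t * Complex.I) * (a + t * Complex.I) := by
  ring_nf
  rw [Complex.I_sq]
  ring

theorem ofReal_sq_add_sq_mem_slitPlane (t : ℝ) {a : ℂ} (ha : 0 < a.re) :
    (t : ℂ) ^ 2 + a ^ 2 ∈ Complex.slitPlane := by
  rw [Complex.mem_slitPlane_iff]
  by_cases h : a.im = 0
  · left
    rw [← Complex.ofReal_pow, Complex.add_re, Complex.ofReal_re, pow_two a, Complex.mul_re, h]
    nlinarith [sq_nonneg t]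
  · right
    rw [← Complex.ofReal_pow, Complex.add_im, Complex.ofReal_im, pow_two a, Complex.mul_im, zero_add]
    intro h'
    have : a.re * a.im = 0 := by linarith
    rcases mul_eq_zero.1 this with h1 | h1
    · exact ha.ne' h1
    · exact h h1

/-- Both factors `a ± it` have modulus at least `Re a`. The bound uses only `r` and `R`, hence is
locally uniform in `a`, and serves the series and the integral alike. -/
theorem norm_inv_cpow_ofReal_sq_add_sq_le (μ : ℝ) {a : ℂ} {r R t : ℝ} (hr : 0 < r) (hra : r ≤ a.re)
    (haR : ‖a‖ ≤ R) (ht : 0 ≤ t) :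
    ‖(((t : ℂ) ^ 2 + a ^ 2) ^ (μ : ℂ))⁻¹‖ ≤ (r ^ 2) ^ (-μ) + (R + t) ^ (-(2 * μ)) := by
  have hR : 0 ≤ R := (norm_nonneg a).trans haR
  rw [← Complex.cpow_neg, ← Complex.ofReal_neg, Complex.norm_cpow_real]
  have h1 : r ≤ ‖a - t * Complex.I‖ :=
    hra.trans (by simpa using Complex.re_le_norm (a - t * Complex.I))
  have h2 : r ≤ ‖a + t * Complex.I‖ :=
    hra.trans (by simpa using Complex.re_le_norm (a + t * Complex.I))
  have h3 : ‖(t : ℂ) ^ 2 + a ^ 2‖ ≤ (R + t) ^ 2 := by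
    refine (norm_add_le _ _).trans ?_
    rw [norm_pow, norm_pow, Complex.norm_real, Real.norm_of_nonneg ht]
    nlinarith [norm_nonneg a]
  have h4 : r ^ 2 ≤ ‖(t : ℂ) ^ 2 + a ^ 2‖ := by
    rw [ofReal_sq_add_sq_eq, norm_mul, pow_two]
    gcongr
  have := rpow_le_add_of_mem_Icc (-μ) (by positivity) h4 h3
  rwa [← Real.rpow_natCast (R + t), ← Real.rpow_mul (by positivity),
    show ((2 : ℕ) : ℝ) * -μ = -(2 * μ) by push_cast; ring] at this

theorem norm_jIntegrand_le {lam μ : ℝ} {a : ℂ} {r R t : ℝ} (hr : 0 < r) (hra : r ≤ a.re)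
    (haR : ‖a‖ ≤ R) (ht : 0 ≤ t) :
    ‖jIntegrand lam μ a t‖ ≤ Real.exp (-(lam * t)) * (R + t) ^ (0 : ℝ) * (r ^ 2) ^ (-μ) +
      Real.exp (-(lam * t)) * (R + t) ^ (-(2 * μ)) := by
  rw [jIntegrand, div_eq_mul_inv, norm_mul, Complex.norm_real, Real.norm_of_nonneg (by positivity),
    Real.rpow_zero, mul_one, ← mul_add, neg_mul]
  gcongr
  exact norm_inv_cpow_ofReal_sq_add_sq_le μ hr hra haR ht

theorem measurable_jIntegrand (lam μ : ℝ) (a : ℂ) : Measurable (jIntegrand lam μ a) := by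
  unfold jIntegrand
  fun_prop

theorem integrableOn_jIntegrand_bound {lam : ℝ} (hlam : 0 < lam) (μ r : ℝ) {R : ℝ} (hR : 0 < R) :
    IntegrableOn (fun t : ℝ => Real.exp (-(lam * t)) * (R + t) ^ (0 : ℝ) * (r ^ 2) ^ (-μ) +
      Real.exp (-(lam * t)) * (R + t) ^ (-(2 * μ))) (Ioi 0) :=
  ((integrableOn_exp_neg_mul_mul_add_rpow 0 hlam hR).mul_const _).add
    (integrableOn_exp_neg_mul_mul_add_rpow _ hlam hR)

theorem integrableOn_jIntegrand {lam μ : ℝ} (hlam : 0 < lam) {a : ℂ} (ha : 0 < a.re) :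
    IntegrableOn (jIntegrand lam μ a) (Ioi 0) :=
  Integrable.mono' (integrableOn_jIntegrand_bound hlam μ a.re
    (ha.trans_le (Complex.re_le_norm a))) (measurable_jIntegrand lam μ a).aestronglyMeasurable
    ((ae_restrict_mem measurableSet_Ioi).mono fun _ ht =>
      norm_jIntegrand_le ha le_rfl le_rfl (le_of_lt ht))

theorem differentiableOn_inv_cpow_ofReal_sq_add_sq (t μ : ℝ) (c : ℂ) :
    DifferentiableOn ℂ (fun a : ℂ => c / ((t : ℂ) ^ 2 + a ^ 2) ^ (μ : ℂ)) {a | 0 < a.re} := by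
  intro a ha
  have h := ofReal_sq_add_sq_mem_slitPlane t ha
  refine DifferentiableAt.differentiableWithinAt (DifferentiableAt.fun_div (by fun_prop)
    (DifferentiableAt.cpow_const (by fun_prop) h) ?_)
  simp [Complex.cpow_eq_zero_iff, Complex.slitPlane_ne_zero h]

theorem differentiableOn_J {lam : ℝ} (hlam : 0 < lam) (μ : ℝ) :
    DifferentiableOn ℂ (J lam μ) {a | 0 < a.re} := by
  refine differentiableOn_integral_of_locally_dominated isOpen_re_pos measurableSet_Ioi
    (fun a => (measurable_jIntegrand lam μ a).aestronglyMeasurable)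
    (fun t _ => differentiableOn_inv_cpow_ofReal_sq_add_sq t μ _)
    fun a₀ ha₀ => ⟨_, integrableOn_jIntegrand_bound hlam μ (a₀.re / 2) (R := ‖a₀‖ + 1)
      (by positivity), ?_⟩
  filter_upwards [eventually_half_re_le ha₀, eventually_norm_le_add_one a₀] with a h1 h2 t ht
  exact norm_jIntegrand_le (half_pos ha₀) h1 h2 (le_of_lt ht)

/-- Scaling: `∫_0^∞ e^{-pt} (t² + a²)^{-μ} dt = a^{1-2μ} ∫_0^∞ e^{-pax} (1 + x²)^{-μ} dx`. -/
theorem integral_exp_mul_sq_add_sq_rpow (μ : ℝ) {a : ℝ} (ha : 0 < a) (p : ℂ) :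
    ∫ t in Ioi (0 : ℝ), Complex.exp (-(p * t)) * (((t ^ 2 + a ^ 2) ^ (-μ) : ℝ) : ℂ) =
      ((a ^ (1 - 2 * μ) : ℝ) : ℂ) * laplaceHalf (-μ) (p * a) := by
  have h := integral_comp_mul_left_Ioi
    (fun t : ℝ => Complex.exp (-(p * t)) * (((t ^ 2 + a ^ 2) ^ (-μ) : ℝ) : ℂ)) 0 ha
  rw [mul_zero, eq_inv_smul_iff₀ ha.ne'] at h
  rw [← h, laplaceHalf, ← integral_const_mul, ← integral_smul]
  refine setIntegral_congr_fun measurableSet_Ioi fun x _ => ?_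
  have e : ((a * x) ^ 2 + a ^ 2) ^ (-μ) = a ^ (-(2 * μ)) * (1 + x ^ 2) ^ (-μ) := by
    rw [show (a * x) ^ 2 + a ^ 2 = a ^ 2 * (1 + x ^ 2) by ring, Real.mul_rpow (by positivity)
      (by positivity), ← Real.rpow_natCast, ← Real.rpow_mul ha.le]
    congr 2
    push_cast
    ring
  have e2 : a ^ (1 - 2 * μ) = a * a ^ (-(2 * μ)) := by
    rw [sub_eq_add_neg, Real.rpow_add ha, Real.rpow_one]
  simp only [e, e2, Complex.real_smul]
  push_cast
  rw [show p * (a * x) = p * a * x by ring]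
  ring

theorem inv_cpow_ofReal_sq_add_sq (μ t : ℝ) (a : ℝ) :
    (((t : ℂ) ^ 2 + (a : ℂ) ^ 2) ^ (μ : ℂ))⁻¹ = (((t ^ 2 + a ^ 2) ^ (-μ) : ℝ) : ℂ) := by
  rw [Complex.ofReal_cpow (by positivity), ← Complex.cpow_neg]
  push_cast
  rfl

theorem jIntegrand_ofReal (lam μ a t : ℝ) :
    jIntegrand lam μ a t =
      Complex.exp (-((lam : ℂ) * t)) * (((t ^ 2 + a ^ 2) ^ (-μ) : ℝ) : ℂ) := by
  rw [jIntegrand, div_eq_mul_inv, inv_cpow_ofReal_sq_add_sq]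
  push_cast
  rw [neg_mul]

/-- For `a > 0` this is the scaling `t = ax`; for complex `a` that would turn the contour, and the
identity theorem is used instead. -/
theorem J_eq_laplaceHalf {lam : ℝ} (hlam : 0 < lam) (μ : ℝ) {a : ℂ} (ha : 0 < a.re) :
    J lam μ a = a ^ ((1 - 2 * μ : ℝ) : ℂ) * laplaceHalf (-μ) (lam * a) := by
  refine eqOn_of_eq_on_real_Ioo (f := J lam μ) (g := fun a => a ^ ((1 - 2 * μ : ℝ) : ℂ) *
    laplaceHalf (-μ) (lam * a)) isOpen_re_pos isPreconnected_re_pos (differentiableOn_J hlam μ) ?_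
    zero_lt_one (fun x hx _ => by simpa using hx) (fun x hx _ => ?_) ha
  · refine DifferentiableOn.mul (fun a ha => ?_) ?_
    · exact (differentiableAt_id.cpow_const (Or.inl ha)).differentiableWithinAt
    · refine (differentiableOn_laplaceHalf (-μ)).comp (f := fun a : ℂ => (lam : ℂ) * a)
        (by fun_prop) fun a ha => ?_
      have ha : 0 < a.re := ha
      simpa using mul_pos hlam ha
  · rw [← Complex.ofReal_cpow hx.le, ← integral_exp_mul_sq_add_sq_rpow μ hx lam]
    exact setIntegral_congr_fun measurableSet_Ioi fun t _ => jIntegrand_ofReal lam μ x t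

theorem J_eq_struveK {lam μ : ℝ} (hlam : 0 < lam) (hμ : μ < 1) {a : ℂ} (ha : 0 < a.re) :
    J lam μ a = (Real.sqrt Real.pi : ℂ) * a ^ ((1 - 2 * μ : ℝ) : ℂ) * (Real.Gamma (1 - μ) : ℂ) /
      (2 * ((lam : ℂ) * a / 2) ^ ((1 / 2 - μ : ℝ) : ℂ)) * struveK (1 / 2 - μ) (lam * a) := by
  have hp : 0 < ((lam : ℂ) * a).re := by simpa using mul_pos hlam ha
  have h := laplaceHalf_eq_struveK (ν := 1 / 2 - μ) (by linarith) hp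
  rw [show 1 / 2 - μ - 1 / 2 = -μ by ring, show 1 / 2 - μ + 1 / 2 = 1 - μ by ring] at h
  rw [J_eq_laplaceHalf hlam μ ha, h, Complex.cpow_neg, Complex.ofReal_mul, Complex.ofReal_div,
    Complex.ofReal_ofNat, mul_comm (2 : ℂ), ← div_div, div_eq_mul_inv _ (_ ^ _)]
  ring

/-- Half of the exponential decay absorbs the power. -/
theorem isBigO_exp_mul_add_rpow {lam : ℝ} (R p : ℝ) (hlam : 0 < lam) :
    (fun t : ℝ => Real.exp (-(lam * t)) * (R + t) ^ p) =O[atTop]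
      fun t : ℝ => Real.exp (-(lam / 2) * t) := by
  have h := (tendsto_rpow_mul_exp_neg_mul_atTop_nhds_zero p (lam / 2) (half_pos hlam)).comp
    (tendsto_atTop_add_const_left atTop R tendsto_id)
  have h2 := (h.isBigO_one ℝ).mul (isBigO_const_mul_self (Real.exp (lam / 2 * R))
    (fun t : ℝ => Real.exp (-(lam / 2) * t)) atTop)
  refine (h2.congr_left fun t => ?_).congr_right fun t => ?_
  · simp only [Function.comp, id]
    rw [mul_assoc, ← mul_assoc (Real.exp _) (Real.exp _) (Real.exp _), ← Real.exp_add,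
      ← Real.exp_add, mul_comm]
    congr 2
    ring
  · simp

theorem summable_exp_mul_add_rpow {lam R : ℝ} (p : ℝ) (hlam : 0 < lam) :
    Summable fun n : ℕ => Real.exp (-(lam * n)) * (R + n) ^ p := by
  have hs : Summable fun n : ℕ => Real.exp (-(lam / 2) * n) := by
    simpa using Real.summable_pow_mul_exp_neg_nat_mul 0 (half_pos hlam)
  exact summable_of_isBigO_nat hs
    ((isBigO_exp_mul_add_rpow R p hlam).comp_tendsto tendsto_natCast_atTop_atTop)

theorem sTerm_eq_jIntegrand (lam μ : ℝ) (a : ℂ) (n : ℕ) :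
    sTerm lam μ a n = jIntegrand lam μ a n := by
  simp [sTerm, jIntegrand]

theorem summable_sTerm_bound {lam : ℝ} (hlam : 0 < lam) (μ r R : ℝ) :
    Summable fun n : ℕ => Real.exp (-(lam * n)) * (R + n) ^ (0 : ℝ) * (r ^ 2) ^ (-μ) +
      Real.exp (-(lam * n)) * (R + n) ^ (-(2 * μ)) :=
  ((summable_exp_mul_add_rpow 0 hlam).mul_right _).add (summable_exp_mul_add_rpow _ hlam)

theorem summable_sTerm {lam : ℝ} (hlam : 0 < lam) (μ : ℝ) {a : ℂ} (ha : 0 < a.re) :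
    Summable (sTerm lam μ a) :=
  Summable.of_norm_bounded (summable_sTerm_bound hlam μ a.re ‖a‖) fun n => by
    rw [sTerm_eq_jIntegrand]
    exact norm_jIntegrand_le ha le_rfl le_rfl n.cast_nonneg

theorem differentiableOn_tsum_of_locally_summable {U : Set ℂ} (hU : IsOpen U) {F : ℕ → ℂ → ℂ}
    (hF : ∀ k, DifferentiableOn ℂ (F k) U)
    (hb : ∀ z₀ ∈ U, ∃ u : ℕ → ℝ, Summable u ∧ ∀ᶠ z in 𝓝 z₀, ∀ k, ‖F k z‖ ≤ u k) :
    DifferentiableOn ℂ (fun z => ∑' k, F k z) U := by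
  intro z₀ hz₀
  obtain ⟨u, hu, h⟩ := hb z₀ hz₀
  obtain ⟨V, hV, hVo, hzV⟩ := eventually_nhds_iff.1 (h.and (hU.mem_nhds hz₀))
  exact ((Complex.differentiableOn_tsum_of_summable_norm hu
    (fun k => (hF k).mono fun z hz => (hV z hz).2) hVo fun k z hz => (hV z hz).1 k).differentiableAt
    (hVo.mem_nhds hzV)).differentiableWithinAt

theorem differentiableOn_S {lam : ℝ} (hlam : 0 < lam) (μ : ℝ) :
    DifferentiableOn ℂ (S lam μ) {a | 0 < a.re} := by
  refine differentiableOn_tsum_of_locally_summable isOpen_re_pos (F := fun n a => sTerm lam μ a n)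
    (fun n => ?_) fun a₀ ha₀ =>
      ⟨_, summable_sTerm_bound hlam μ (a₀.re / 2) (‖a₀‖ + 1), ?_⟩
  · have := differentiableOn_inv_cpow_ofReal_sq_add_sq n μ (Real.exp (-lam * n) : ℝ)
    simpa only [sTerm, Complex.ofReal_natCast] using this
  · filter_upwards [eventually_half_re_le ha₀, eventually_norm_le_add_one a₀] with a h1 h2 n
    rw [sTerm_eq_jIntegrand]
    exact norm_jIntegrand_le (half_pos ha₀) h1 h2 n.cast_nonneg

/-! ### Convergence and holomorphy of `H`. -/

theorem self_le_norm_sinh {z : ℂ} (hz : 0 ≤ z.re) : z.re ≤ ‖Complex.sinh z‖ := by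
  refine (Real.self_le_sinh_iff.2 hz).trans ?_
  rw [Complex.sinh, Real.sinh_eq, norm_div, Complex.norm_ofNat]
  gcongr
  refine le_trans (le_of_eq ?_) (norm_sub_norm_le _ _)
  rw [Complex.norm_exp, Complex.norm_exp, Complex.neg_re]

theorem norm_sin_le_norm_mul_exp (z : ℂ) : ‖Complex.sin z‖ ≤ ‖z‖ * Real.exp ‖z‖ := by
  have h : ∀ w : ℂ, ‖Complex.exp w - 1‖ ≤ ‖w‖ * Real.exp ‖w‖ := fun w => by
    simpa using Complex.norm_exp_sub_sum_le_norm_mul_exp w 1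
  have h1 := h (-z * Complex.I)
  have h2 := h (z * Complex.I)
  rw [norm_mul, Complex.norm_I, mul_one] at h1 h2
  rw [norm_neg] at h1
  rw [Complex.sin, norm_div, norm_mul, Complex.norm_I, mul_one, Complex.norm_ofNat,
    div_le_iff₀ two_pos, ← sub_sub_sub_cancel_right _ _ (1 : ℂ)]
  linarith [norm_sub_le (Complex.exp (-z * Complex.I) - 1) (Complex.exp (z * Complex.I) - 1)]

theorem pi_mul_mul_re (a : ℂ) (u : ℝ) : ((Real.pi : ℂ) * a * u).re = Real.pi * a.re * u := by
  rw [Complex.re_mul_ofReal, Complex.re_ofReal_mul]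

/-- Sine and hyperbolic sine both vanish linearly at `u = 0`, and the factors `u` cancel; what
remains is the singularity at `u = 1`, integrable for `μ < 1`. -/
theorem norm_hIntegrand_le (lam μ : ℝ) {a : ℂ} {r R u : ℝ} (hr : 0 < r) (hra : r ≤ a.re)
    (haR : ‖a‖ ≤ R) (hu : u ∈ Ioo (0 : ℝ) 1) :
    ‖hIntegrand lam μ a u‖ ≤
      |lam| * R * Real.exp (|lam| * R) / (Real.pi * r) * (1 - u ^ 2) ^ (-μ) := by
  have hu0 := hu.1
  have hR : 0 ≤ R := (norm_nonneg a).trans haR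
  have h1 : 0 < 1 - u ^ 2 := by nlinarith [hu.1, hu.2]
  have hpi := Real.pi_pos
  have ha : 0 < a.re := hr.trans_le hra
  rw [hIntegrand, norm_mul, norm_mul, norm_div, Complex.norm_real,
    Real.norm_of_nonneg (show 0 ≤ (1 - u ^ 2) ^ (-μ) by positivity)]
  gcongr
  have e1 : ‖Complex.exp (-(Real.pi * a * u))‖ ≤ 1 := by
    rw [Complex.norm_exp, Real.exp_le_one_iff, Complex.neg_re, pi_mul_mul_re, neg_nonpos]
    positivity
  have e2 : Real.pi * r * u ≤ ‖Complex.sinh (Real.pi * a * u)‖ := by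
    refine le_trans ?_ (self_le_norm_sinh ?_)
    · rw [pi_mul_mul_re]; gcongr
    · rw [pi_mul_mul_re]; positivity
  have e3 : ‖Complex.sin (lam * a * u)‖ ≤ |lam| * R * Real.exp (|lam| * R) * u := by
    refine (norm_sin_le_norm_mul_exp _).trans ?_
    rw [norm_mul, norm_mul, Complex.norm_real, Complex.norm_real, Real.norm_eq_abs,
      Real.norm_of_nonneg hu0.le]
    have : |lam| * ‖a‖ * u ≤ |lam| * R := by
      refine (mul_le_of_le_one_right (by positivity) hu.2.le).trans ?_
      gcongr
    calc |lam| * ‖a‖ * u * Real.exp (|lam| * ‖a‖ * u) ≤ |lam| * R * u * Real.exp (|lam| * R) := by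
          gcongr
      _ = _ := by ring
  calc _ ≤ 1 * (|lam| * R * Real.exp (|lam| * R) * u / (Real.pi * r * u)) := by gcongr
    _ = _ := by rw [one_mul, mul_div_mul_right _ _ hu0.ne']

theorem measurable_hIntegrand (lam μ : ℝ) (a : ℂ) : Measurable (hIntegrand lam μ a) := by
  unfold hIntegrand
  refine Measurable.mul (Measurable.mul (by fun_prop) (Measurable.div ?_ ?_)) (by fun_prop)
  · exact Complex.measurable_sin.comp (by fun_prop)
  · exact Complex.measurable_sinh.comp (by fun_prop)

theorem integrableOn_hIntegrand (lam : ℝ) {μ : ℝ} (hμ : μ < 1) {a : ℂ} (ha : 0 < a.re) :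
    IntegrableOn (hIntegrand lam μ a) (Ioo 0 1) :=
  Integrable.mono' ((integrableOn_one_sub_sq_rpow (s := -μ) (by linarith)).const_mul _)
    (measurable_hIntegrand lam μ a).aestronglyMeasurable
    ((ae_restrict_mem measurableSet_Ioo).mono fun _ hu =>
      norm_hIntegrand_le lam μ ha le_rfl le_rfl hu)

theorem sinh_pi_mul_mul_ne_zero {a : ℂ} (ha : 0 < a.re) {u : ℝ} (hu : 0 < u) :
    Complex.sinh (Real.pi * a * u) ≠ 0 := by
  have h : 0 < ((Real.pi : ℂ) * a * u).re := by
    rw [pi_mul_mul_re]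
    have := Real.pi_pos
    positivity
  exact norm_pos_iff.1 (h.trans_le (self_le_norm_sinh h.le))

theorem differentiableOn_cpow_const_re_pos (p : ℂ) :
    DifferentiableOn ℂ (fun a : ℂ => a ^ p) {a | 0 < a.re} := fun _ ha =>
  (differentiableAt_id.cpow_const (Or.inl ha)).differentiableWithinAt

theorem differentiableOn_hIntegrand_left (lam μ : ℝ) {u : ℝ} (hu : 0 < u) :
    DifferentiableOn ℂ (fun a => hIntegrand lam μ a u) {a | 0 < a.re} := by
  intro a ha
  have h1 : DifferentiableAt ℂ (fun a : ℂ => Complex.sin (lam * a * u)) a :=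
    (Complex.differentiable_sin _).comp (g := Complex.sin) a (by fun_prop)
  have h2 : DifferentiableAt ℂ (fun a : ℂ => Complex.sinh (Real.pi * a * u)) a :=
    (Complex.differentiable_sinh _).comp (g := Complex.sinh) a (by fun_prop)
  have h3 : DifferentiableAt ℂ (fun a : ℂ => Complex.exp (-(Real.pi * a * u))) a := by fun_prop
  exact ((h3.mul (h1.fun_div h2 (sinh_pi_mul_mul_ne_zero ha hu))).mul_const
    _).differentiableWithinAt

theorem differentiableOn_H (lam : ℝ) {μ : ℝ} (hμ : μ < 1) :
    DifferentiableOn ℂ (H lam μ) {a | 0 < a.re} := by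
  refine (differentiableOn_cpow_const_re_pos _).mul (differentiableOn_integral_of_locally_dominated
    (F := fun a u => hIntegrand lam μ a u) isOpen_re_pos measurableSet_Ioo
    (fun a => (measurable_hIntegrand lam μ a).aestronglyMeasurable)
    (fun u hu => differentiableOn_hIntegrand_left lam μ hu.1) fun a₀ ha₀ =>
      ⟨_, (integrableOn_one_sub_sq_rpow (s := -μ) (by linarith)).const_mul (|lam| * (‖a₀‖ + 1) *
        Real.exp (|lam| * (‖a₀‖ + 1)) / (Real.pi * (a₀.re / 2))), ?_⟩)
  filter_upwards [eventually_half_re_le ha₀, eventually_norm_le_add_one a₀] with a h1 h2 u hu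
  exact norm_hIntegrand_le lam μ (half_pos ha₀) h1 h2 hu

/-! ### Uniform bounds, holomorphy and decay of `T̂`. -/

theorem mul_mem_slitPlane_of_re_pos {ζ a : ℂ} (hζ : 0 < ζ.re) (ha : 0 < a.re) :
    ζ * a ∈ Complex.slitPlane := by
  rw [Complex.mem_slitPlane_iff]
  by_contra! h
  simp only [Complex.mul_re, Complex.mul_im] at h
  have h1 := mul_nonneg hζ.le (sub_nonneg.2 h.1)
  have h2 := congrArg (ζ.im * ·) h.2
  simp only [mul_zero] at h2
  linarith [mul_nonneg ha.le (mul_self_nonneg ζ.im), mul_pos (mul_pos hζ hζ) ha]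

theorem Xhat_eq (lam : ℝ) (a : ℂ) (k : ℕ) :
    Xhat lam a k = ((2 * k + 2) * Real.pi + Complex.I * lam) * a := by
  unfold Xhat
  ring

theorem Xhat_factor_re (lam : ℝ) (k : ℕ) :
    ((2 * k + 2) * Real.pi + Complex.I * lam : ℂ).re = (2 * k + 2) * Real.pi := by
  simp

theorem Xhat_factor_re_pos (lam : ℝ) (k : ℕ) :
    0 < ((2 * k + 2) * Real.pi + Complex.I * lam : ℂ).re := by
  rw [Xhat_factor_re]
  have := Real.pi_pos
  positivity

/-- For non-real `a` the real part of `X̂_k` can be negative, so the slit plane and not the half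
plane is the natural domain; two arguments below `π/2` still add up to less than `π`. -/
theorem Xhat_mem_slitPlane (lam : ℝ) {a : ℂ} (ha : 0 < a.re) (k : ℕ) :
    Xhat lam a k ∈ Complex.slitPlane := by
  rw [Xhat_eq]
  exact mul_mem_slitPlane_of_re_pos (Xhat_factor_re_pos lam k) ha

theorem Xhat_re (lam : ℝ) (a : ℂ) (k : ℕ) :
    (Xhat lam a k).re = 2 * Real.pi * a.re * (k + 1) - lam * a.im := by
  simp [Xhat]
  ring

theorem norm_le_norm_Xhat (lam : ℝ) (a : ℂ) (k : ℕ) : ‖a‖ ≤ ‖Xhat lam a k‖ := by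
  rw [Xhat_eq, norm_mul]
  refine le_mul_of_one_le_left (norm_nonneg _) (le_trans ?_ (Complex.re_le_norm _))
  rw [Xhat_factor_re]
  have h1 := Real.pi_gt_three
  have h2 : (0 : ℝ) ≤ k := k.cast_nonneg
  nlinarith

/-- The remaining power `|X̂_k|^{μ-1}` has a negative exponent and `|X̂_k| ≥ |a| ≥ r`, so the
constant depends neither on `k` nor on `lam`. -/
theorem exists_norm_kRatio_Xhat_le {μ : ℝ} (hμ : μ < 1) {c r : ℝ} (hc : 0 < c) (hr : 0 < r) :
    ∃ C : ℝ, 0 ≤ C ∧ ∀ (lam : ℝ) (a : ℂ), 0 < a.re → c ≤ 2 * a.re / ‖a‖ → r ≤ ‖a‖ → ∀ k : ℕ,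
      ‖kRatio μ (Xhat lam a k)‖ ≤ C * Real.exp (-(Xhat lam a k).re) := by
  obtain ⟨C, hC0, hC⟩ := exists_norm_laplaceK_le (s := -μ) (by linarith) hc (inv_pos.2 hr).le
  refine ⟨|Real.sqrt Real.pi * 2 ^ (μ - 1 / 2) * (Real.Gamma (1 - μ))⁻¹| * (r ^ (μ - 1) * C),
    by positivity, fun lam a ha hca hra k => ?_⟩
  have hX := Xhat_mem_slitPlane lam ha k
  have hrX := hra.trans (norm_le_norm_Xhat lam a k)
  have hK : ‖laplaceK ((-μ : ℝ) : ℂ) (Xhat lam a k)‖ ≤ C := by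
    have := hC _ a (Xhat_factor_re_pos lam k) ha hca
      (by rw [← Xhat_eq]; exact inv_anti₀ hr hrX)
    rwa [← Xhat_eq] at this
  rw [kRatio_eq hμ hX, laplaceTailExt, norm_mul, norm_mul, norm_mul, Complex.norm_real,
    Real.norm_eq_abs, Complex.norm_exp, Complex.neg_re,
    show (((1 / 2 - μ : ℝ) : ℂ) - 1 / 2) = ((-μ : ℝ) : ℂ) by push_cast; ring,
    show (-(((1 / 2 - μ : ℝ) : ℂ) + 1 / 2)) = ((μ - 1 : ℝ) : ℂ) by push_cast; ring,
    Complex.norm_cpow_real]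
  have h1 : ‖Xhat lam a k‖ ^ (μ - 1) ≤ r ^ (μ - 1) :=
    Real.rpow_le_rpow_of_nonpos hr hrX (by linarith)
  calc _ ≤ |Real.sqrt Real.pi * 2 ^ (μ - 1 / 2) * (Real.Gamma (1 - μ))⁻¹| *
        (Real.exp (-(Xhat lam a k).re) * r ^ (μ - 1) * C) := by gcongr
    _ = _ := by ring

theorem norm_exp_I_mul_pi_mul (μ : ℝ) : ‖Complex.exp (Complex.I * Real.pi * μ)‖ = 1 := by
  rw [show Complex.I * Real.pi * μ = ((Real.pi * μ : ℝ) : ℂ) * Complex.I by push_cast; ring]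
  exact Complex.norm_exp_ofReal_mul_I _

theorem norm_exp_neg_I_mul_pi_mul (μ : ℝ) : ‖Complex.exp (-(Complex.I * Real.pi * μ))‖ = 1 := by
  rw [Complex.exp_neg, norm_inv, norm_exp_I_mul_pi_mul, inv_one]

/-- Since `Re X̂_k^± = 2π(k+1) Re a ∓ λ Im a`, both exponentials are at most `e^{λ|Im a|}` times a
geometric term. -/
theorem exists_norm_tTerm_le {lam μ : ℝ} (hlam : 0 ≤ lam) (hμ : μ < 1) {c r : ℝ} (hc : 0 < c)
    (hr : 0 < r) :
    ∃ C : ℝ, 0 ≤ C ∧ ∀ a : ℂ, 0 < a.re → c ≤ 2 * a.re / ‖a‖ → r ≤ ‖a‖ → ∀ k : ℕ,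
      ‖tTerm lam μ a k‖ ≤ C * Real.exp (lam * |a.im|) *
        Real.exp (-(2 * Real.pi * a.re)) ^ (k + 1) := by
  obtain ⟨C, hC0, hC⟩ := exists_norm_kRatio_Xhat_le hμ hc hr
  refine ⟨C, hC0, fun a ha hca hra k => ?_⟩
  have hb : ∀ l : ℝ, |l| = lam → ‖kRatio μ (Xhat l a k)‖ ≤ C * Real.exp (lam * |a.im|) *
      Real.exp (-(2 * Real.pi * a.re)) ^ (k + 1) := by
    intro l hl
    refine (hC l a ha hca hra k).trans ?_
    rw [mul_assoc, ← Real.exp_nat_mul, ← Real.exp_add, Xhat_re]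
    gcongr
    have := le_abs_self (l * a.im)
    rw [abs_mul, hl] at this
    push_cast
    linarith
  have h1 := hb lam (abs_of_nonneg hlam)
  have h2 := hb (-lam) (by rw [abs_neg, abs_of_nonneg hlam])
  rw [tTerm, norm_div, Complex.norm_ofNat, div_le_iff₀ two_pos]
  refine (norm_sub_le _ _).trans ?_
  rw [norm_mul, norm_mul, norm_mul, norm_mul, Complex.norm_I, norm_exp_I_mul_pi_mul,
    norm_exp_neg_I_mul_pi_mul]
  linarith

theorem exp_neg_two_pi_mul_lt_one {x : ℝ} (hx : 0 < x) : Real.exp (-(2 * Real.pi * x)) < 1 := by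
  have := Real.pi_pos
  rw [Real.exp_lt_one_iff, neg_lt_zero]
  positivity

theorem summable_tTerm {lam μ : ℝ} (hlam : 0 ≤ lam) (hμ : μ < 1) {a : ℂ} (ha : 0 < a.re) :
    Summable (tTerm lam μ a) := by
  have hn := ha.trans_le (Complex.re_le_norm a)
  obtain ⟨C, -, hC⟩ := exists_norm_tTerm_le hlam hμ (c := 2 * a.re / ‖a‖) (by positivity) hn
  refine Summable.of_norm_bounded ?_ (hC a ha le_rfl le_rfl)
  exact ((summable_nat_add_iff 1).2 (summable_geometric_of_lt_one (Real.exp_nonneg _)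
    (exp_neg_two_pi_mul_lt_one ha))).mul_left _

theorem differentiableOn_kRatio {μ : ℝ} (hμ : μ < 1) :
    DifferentiableOn ℂ (kRatio μ) Complex.slitPlane := by
  refine DifferentiableOn.congr (DifferentiableOn.const_mul
    (differentiableOn_laplaceTailExt_right (ν := ((1 / 2 - μ : ℝ) : ℂ)) ?_) _)
    fun X hX => kRatio_eq hμ hX
  rw [Complex.ofReal_re]
  linarith

theorem differentiableOn_That {lam μ : ℝ} (hlam : 0 ≤ lam) (hμ : μ < 1) :
    DifferentiableOn ℂ (That lam μ) {a | 0 < a.re} := by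
  refine ((differentiableOn_cpow_const_re_pos _).const_mul _).mul
    (differentiableOn_tsum_of_locally_summable isOpen_re_pos (F := fun k a => tTerm lam μ a k)
      (fun k => ?_) fun a₀ ha₀ => ?_)
  · have hX : ∀ l : ℝ, DifferentiableOn ℂ (fun a => kRatio μ (Xhat l a k)) {a | 0 < a.re} :=
      fun l => (differentiableOn_kRatio hμ).comp (f := fun a => Xhat l a k)
        (by unfold Xhat; fun_prop) fun a ha => Xhat_mem_slitPlane l ha k
    exact (((hX lam).const_mul _).sub ((hX (-lam)).const_mul _)).div_const _
  · have ha₀ : 0 < a₀.re := ha₀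
    have hn := ha₀.trans_le (Complex.re_le_norm a₀)
    obtain ⟨C, hC0, hC⟩ := exists_norm_tTerm_le hlam hμ (c := a₀.re / (‖a₀‖ + 1)) (by positivity)
      (half_pos ha₀)
    refine ⟨fun k => C * Real.exp (lam * (‖a₀‖ + 1)) *
      Real.exp (-(2 * Real.pi * (a₀.re / 2))) ^ (k + 1), ?_, ?_⟩
    · exact ((summable_nat_add_iff 1).2 (summable_geometric_of_lt_one (Real.exp_nonneg _)
        (exp_neg_two_pi_mul_lt_one (half_pos ha₀)))).mul_left _
    · filter_upwards [eventually_half_re_le ha₀, eventually_norm_le_add_one a₀] with a h1 h2 k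
      have ha : 0 < a.re := (half_pos ha₀).trans_le h1
      have hna := ha.trans_le (Complex.re_le_norm a)
      have hpi := Real.pi_pos
      refine (hC a ha ?_ (h1.trans (Complex.re_le_norm a)) k).trans ?_
      · gcongr
        linarith
      · have := (Complex.abs_im_le_norm a).trans h2
        gcongr

theorem norm_That_eq (lam μ : ℝ) {a : ℂ} (q : ℝ) (hq : q = 2 ^ (3 / 2 - μ) * Real.sqrt Real.pi *
    (Real.Gamma (1 - μ) / Real.pi)) :
    ‖That lam μ a‖ = |q| * ‖a‖ ^ (1 - 2 * μ) * ‖∑' k : ℕ, tTerm lam μ a k‖ := by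
  rw [That, norm_mul, norm_mul, Complex.norm_real, Complex.norm_cpow_real, Real.norm_eq_abs, hq]

theorem isBigO_That_sector {lam μ : ℝ} (hlam : 0 ≤ lam) (hμ : μ < 1) {δ : ℝ}
    (hδ : δ < Real.pi / 2) :
    (fun a : ℂ => That lam μ a) =O[Bornology.cobounded ℂ ⊓ 𝓟 {a : ℂ | |Complex.arg a| ≤ δ}]
      (fun a : ℂ => ‖a‖ ^ (1 - 2 * μ) * Real.exp (-2 * Real.pi * a.re + lam * |a.im|)) := by
  rcases lt_or_ge δ 0 with h0 | h0
  · have : {a : ℂ | |Complex.arg a| ≤ δ} = ∅ :=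
      eq_empty_of_forall_notMem fun a ha => absurd (abs_nonneg a.arg) (by
        have : |a.arg| ≤ δ := ha
        linarith)
    rw [this, principal_empty, inf_bot_eq]
    exact IsBigO.of_bound 0 eventually_bot
  have hcos : 0 < Real.cos δ := Real.cos_pos_of_mem_Ioo ⟨by linarith, hδ⟩
  -- In the sector `Re a ≥ |a| cos δ`. For `|a| ≥ 1` the ratio `e^{-2π Re a}` is therefore at most
  -- `q₀ < 1`, and the series is bounded by a fixed multiple of its first geometric term.
  obtain ⟨C, hC0, hC⟩ := exists_norm_tTerm_le hlam hμ (c := 2 * Real.cos δ) (by positivity) one_pos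
  set q₀ := Real.exp (-(2 * Real.pi * Real.cos δ)) with hq₀
  have hq1 : q₀ < 1 := exp_neg_two_pi_mul_lt_one hcos
  refine IsBigO.of_bound (|2 ^ (3 / 2 - μ) * Real.sqrt Real.pi * (Real.Gamma (1 - μ) / Real.pi)| *
    (C * (1 - q₀)⁻¹)) ?_
  have hev : ∀ᶠ a : ℂ in Bornology.cobounded ℂ ⊓ 𝓟 {a : ℂ | |Complex.arg a| ≤ δ}, 1 ≤ ‖a‖ :=
    ((tendsto_norm_cobounded_atTop (E := ℂ)).eventually (eventually_ge_atTop 1)).filter_mono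
      inf_le_left
  have hev2 : ∀ᶠ a : ℂ in Bornology.cobounded ℂ ⊓ 𝓟 {a : ℂ | |Complex.arg a| ≤ δ},
      |Complex.arg a| ≤ δ := (eventually_principal.2 fun _ h => h).filter_mono inf_le_right
  filter_upwards [hev, hev2] with a h1 h2
  have hn : 0 < ‖a‖ := zero_lt_one.trans_le h1
  have hre : ‖a‖ * Real.cos δ ≤ a.re := by
    rw [← Complex.norm_mul_cos_arg a, ← Real.cos_abs a.arg]
    gcongr
    exact Real.cos_le_cos_of_nonneg_of_le_pi (abs_nonneg _) (by linarith [Real.pi_pos]) h2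
  have hre' : Real.cos δ ≤ a.re := le_trans (le_mul_of_one_le_left hcos.le h1) hre
  have ha : 0 < a.re := hcos.trans_le hre'
  have hb := hC a ha (by rw [le_div_iff₀ hn]; linarith) h1
  set q := Real.exp (-(2 * Real.pi * a.re)) with hq
  have hq1' : q < 1 := exp_neg_two_pi_mul_lt_one ha
  have hqq : q ≤ q₀ := by
    have := Real.pi_pos
    rw [hq, hq₀]
    gcongr
  have hq0 : 0 ≤ q := Real.exp_nonneg _
  have hs : HasSum (fun k : ℕ => C * Real.exp (lam * |a.im|) * q ^ (k + 1))
      (C * Real.exp (lam * |a.im|) * (q * (1 - q)⁻¹)) := by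
    simp only [pow_succ']
    exact ((hasSum_geometric_of_lt_one hq0 hq1').mul_left q).mul_left _
  have ht : ‖∑' k : ℕ, tTerm lam μ a k‖ ≤ C * Real.exp (lam * |a.im|) * (q * (1 - q)⁻¹) :=
    tsum_of_norm_bounded hs hb
  have hinv : (1 - q)⁻¹ ≤ (1 - q₀)⁻¹ := inv_anti₀ (by linarith) (by linarith)
  rw [norm_That_eq lam μ _ rfl, Real.norm_of_nonneg (by positivity), Real.exp_add,
    show -2 * Real.pi * a.re = -(2 * Real.pi * a.re) by ring, ← hq]
  calc _ ≤ |2 ^ (3 / 2 - μ) * Real.sqrt Real.pi * (Real.Gamma (1 - μ) / Real.pi)| *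
        ‖a‖ ^ (1 - 2 * μ) * (C * Real.exp (lam * |a.im|) * (q * (1 - q₀)⁻¹)) := by
          gcongr
          exact ht.trans (by gcongr)
    _ = _ := by ring

theorem isBigO_That_ofReal {lam μ : ℝ} (hlam : 0 ≤ lam) (hμ : μ < 1) :
    (fun a : ℝ => That lam μ (a : ℂ)) =O[atTop]
      (fun a : ℝ => a ^ (1 - 2 * μ) * Real.exp (-2 * Real.pi * a)) := by
  have ht : Tendsto (fun a : ℝ => (a : ℂ)) atTop
      (Bornology.cobounded ℂ ⊓ 𝓟 {a : ℂ | |Complex.arg a| ≤ 0}) := by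
    refine tendsto_inf.2 ⟨?_, tendsto_principal.2 ?_⟩
    · rw [← tendsto_norm_atTop_iff_cobounded]
      simpa using! tendsto_abs_atTop_atTop
    · filter_upwards [eventually_ge_atTop 0] with a ha
      simp [Complex.arg_ofReal_of_nonneg ha]
  -- The positive axis is the sector with `δ = 0`.
  have h := (isBigO_That_sector hlam hμ (half_pos Real.pi_pos)).comp_tendsto ht
  refine h.congr' (Eventually.of_forall fun _ => rfl) ?_
  filter_upwards [eventually_ge_atTop 0] with a ha
  simp [abs_of_nonneg ha]

/-! ### The real form of `T̂` for positive `a`. -/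

theorem laplaceTailExt_conj (ν : ℝ) {X : ℂ} (hX : X ∈ Complex.slitPlane) :
    laplaceTailExt ν (starRingEnd ℂ X) = starRingEnd ℂ (laplaceTailExt ν X) := by
  have h := Complex.mem_slitPlane_iff_arg.1 hX |>.1
  rw [laplaceTailExt, laplaceTailExt,
    show ((ν : ℂ) - 1 / 2) = ((ν - 1 / 2 : ℝ) : ℂ) by push_cast; ring,
    show (-((ν : ℂ) + 1 / 2)) = ((-(ν + 1 / 2) : ℝ) : ℂ) by push_cast; ring,
    laplaceK_conj hX, conj_cpow_ofReal h, ← map_neg, Complex.exp_conj]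
  simp only [map_mul]

theorem kRatio_conj {μ : ℝ} (hμ : μ < 1) {X : ℂ} (hX : X ∈ Complex.slitPlane) :
    kRatio μ (starRingEnd ℂ X) = starRingEnd ℂ (kRatio μ X) := by
  have hX' : starRingEnd ℂ X ∈ Complex.slitPlane := by
    simpa [Complex.mem_slitPlane_iff] using hX
  rw [kRatio_eq hμ hX, kRatio_eq hμ hX', map_mul, Complex.conj_ofReal, laplaceTailExt_conj _ hX]

theorem Xhat_neg_ofReal (lam a : ℝ) (k : ℕ) :
    Xhat (-lam) a k = starRingEnd ℂ (Xhat lam a k) := by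
  simp only [Xhat, map_add, map_mul, Complex.conj_ofReal, Complex.conj_I, map_natCast, map_ofNat]
  push_cast
  ring

theorem I_mul_exp_mul_re (μ : ℝ) (R : ℂ) :
    (Complex.I * Complex.exp (-(Complex.I * Real.pi * μ)) * R).re =
      Real.sin (Real.pi * μ - R.arg) * ‖R‖ := by
  have h : Complex.I * Complex.exp (-(Complex.I * Real.pi * μ)) * R =
      ‖R‖ * (Complex.I * Complex.exp (((R.arg - Real.pi * μ : ℝ) : ℂ) * Complex.I)) := by
    conv_lhs => rw [← Complex.norm_mul_exp_arg_mul_I R]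
    rw [show (((R.arg - Real.pi * μ : ℝ) : ℂ) * Complex.I) =
      -(Complex.I * Real.pi * μ) + R.arg * Complex.I by push_cast; ring, Complex.exp_add]
    ring
  rw [h, Complex.re_ofReal_mul, Complex.I_mul_re, Complex.exp_ofReal_mul_I_im, ← Real.sin_neg,
    neg_sub, mul_comm]

theorem thetaHat_eq (lam μ : ℝ) (a : ℂ) (k : ℕ) :
    thetaHat lam μ a k = (kRatio μ (Xhat lam a k)).arg := by
  rw [thetaHat, kRatio, show μ - 1 / 2 = -(1 / 2 - μ) by ring, Complex.ofReal_neg,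
    Complex.cpow_neg, inv_mul_eq_div]

/-- For `a > 0` the two contributions are complex conjugates, so half their sum is the real part of
`i e^{i(θ̂_k - πμ)}` times the modulus. -/
theorem tTerm_ofReal {lam μ : ℝ} (hμ : μ < 1) {a : ℝ} (ha : 0 < a) (k : ℕ) :
    tTerm lam μ a k = ((Real.sin (Real.pi * μ - thetaHat lam μ a k) *
      ‖kRatio μ (Xhat lam a k)‖ : ℝ) : ℂ) := by
  have hX := Xhat_mem_slitPlane lam (a := a) (by simpa using ha) k
  have hc : -(Complex.I * Complex.exp (Complex.I * Real.pi * μ) *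
      starRingEnd ℂ (kRatio μ (Xhat lam a k))) = starRingEnd ℂ (Complex.I *
        Complex.exp (-(Complex.I * Real.pi * μ)) * kRatio μ (Xhat lam a k)) := by
    simp only [map_mul, ← Complex.exp_conj, map_neg, Complex.conj_ofReal, Complex.conj_I]
    ring_nf
  rw [thetaHat_eq, ← I_mul_exp_mul_re, tTerm, Xhat_neg_ofReal, kRatio_conj hμ hX, sub_eq_add_neg,
    hc, ← Complex.re_eq_add_conj]

theorem That_ofReal {lam μ : ℝ} (hμ : μ < 1) {a : ℝ} (ha : 0 < a) :
    That lam μ a = (((2 : ℝ) ^ (3 / 2 - μ) * Real.sqrt Real.pi / a ^ (2 * μ - 1) *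
      (Real.Gamma (1 - μ) / Real.pi) * ∑' k : ℕ, Real.sin (Real.pi * μ - thetaHat lam μ a k) *
        ‖kRatio μ (Xhat lam a k)‖ : ℝ) : ℂ) := by
  rw [That, tsum_congr (tTerm_ofReal hμ ha), ← Complex.ofReal_tsum, ← Complex.ofReal_cpow ha.le,
    ← Complex.ofReal_mul, ← Complex.ofReal_mul, show 1 - 2 * μ = -(2 * μ - 1) by ring,
    Real.rpow_neg ha.le]
  congr 1
  ring

theorem Gamma_one_sub_div_pi {μ : ℝ} (h : ∀ m : ℤ, μ ≠ m) :
    Real.Gamma (1 - μ) / Real.pi = (Real.Gamma μ)⁻¹ * (Real.sin (Real.pi * μ))⁻¹ := by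
  have h1 := Real.Gamma_mul_Gamma_one_sub μ
  have h2 : Real.Gamma μ ≠ 0 := Real.Gamma_ne_zero fun m => by
    simpa using h (-m)
  have h3 : Real.sin (Real.pi * μ) ≠ 0 := by
    rw [mul_comm]
    exact sin_ofReal_mul_pi_ne_zero fun ⟨n, hn⟩ => h n hn
  have := Real.pi_ne_zero
  rw [eq_div_iff h3] at h1
  generalize Real.sin (Real.pi * μ) = σ at *
  field_simp
  linarith

theorem That_ofReal_of_not_int {lam μ : ℝ} (hμ : μ < 1) (h : ∀ m : ℤ, μ ≠ m) {a : ℝ}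
    (ha : 0 < a) :
    That lam μ a = (((2 : ℝ) ^ (3 / 2 - μ) * Real.sqrt Real.pi / (a ^ (2 * μ - 1) *
      Real.Gamma μ) * ∑' k : ℕ, Real.sin (Real.pi * μ - thetaHat lam μ a k) /
        Real.sin (Real.pi * μ) * ‖kRatio μ (Xhat lam a k)‖ : ℝ) : ℂ) := by
  rw [That_ofReal hμ ha, Gamma_one_sub_div_pi h]
  simp only [div_mul_eq_mul_div _ (Real.sin (Real.pi * μ))]
  rw [tsum_div_const]
  congr 1
  simp only [div_eq_mul_inv, mul_inv]
  ring

theorem summable_sin_mul_norm_kRatio {lam μ : ℝ} (hlam : 0 ≤ lam) (hμ : μ < 1) {a : ℝ}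
    (ha : 0 < a) :
    Summable (fun k : ℕ => Real.sin (Real.pi * μ - thetaHat lam μ a k) *
      ‖kRatio μ (Xhat lam a k)‖) := by
  have h := summable_tTerm hlam hμ (a := a) (by simpa using ha)
  rw [← Complex.summable_ofReal]
  exact h.congr fun k => (tTerm_ofReal hμ ha k)

/-! ### Fourier coefficients and Poisson summation. -/

theorem isBigO_jIntegrand {lam : ℝ} (hlam : 0 < lam) (μ : ℝ) {a : ℂ} (ha : 0 < a.re) (p : ℝ) :
    (fun t : ℝ => jIntegrand lam μ a t) =O[atTop] fun t : ℝ => t ^ p := by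
  have h := ((isBigO_exp_mul_add_rpow ‖a‖ 0 hlam).const_mul_left
    ((a.re ^ 2) ^ (-μ))).congr_left fun t => mul_comm _ _
  refine IsBigO.trans ?_ ((h.add (isBigO_exp_mul_add_rpow ‖a‖ (-(2 * μ)) hlam)).trans
    (isLittleO_exp_neg_mul_rpow_atTop (half_pos hlam) p).isBigO)
  refine IsBigO.of_norm_eventuallyLE ?_
  filter_upwards [eventually_ge_atTop 0] with t ht
  exact norm_jIntegrand_le ha le_rfl le_rfl ht

theorem continuous_jIntegrand_abs (lam μ : ℝ) {a : ℝ} (ha : 0 < a) :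
    Continuous fun x : ℝ => jIntegrand lam μ a |x| := by
  simp only [jIntegrand_ofReal]
  refine Continuous.mul (by fun_prop) (Complex.continuous_ofReal.comp ?_)
  exact Continuous.rpow_const (by fun_prop) fun x => Or.inl (by positivity)

theorem isBigO_jIntegrand_abs {lam : ℝ} (hlam : 0 < lam) (μ : ℝ) {a : ℂ} (ha : 0 < a.re) (p : ℝ) :
    (fun x : ℝ => jIntegrand lam μ a |x|) =O[cocompact ℝ] fun x : ℝ => |x| ^ p :=
  (isBigO_jIntegrand hlam μ ha p).comp_tendsto (tendsto_norm_cocompact_atTop (E := ℝ))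

theorem integral_eq_add_integral_Ioi_comp_neg {f : ℝ → ℂ} (h1 : IntegrableOn f (Ioi 0))
    (h2 : IntegrableOn (fun x => f (-x)) (Ioi 0)) :
    ∫ x, f x = (∫ x in Ioi (0 : ℝ), f x) + ∫ x in Ioi (0 : ℝ), f (-x) := by
  have h3 : IntegrableOn f (Iic 0) := by
    have := h2.comp_neg
    simp only [neg_neg, Set.neg_Ioi, neg_zero] at this
    exact (integrableOn_Iic_iff_integrableOn_Iio enorm_ne_top).2 this
  have h4 := integral_comp_neg_Iic 0 fun x => f (-x)
  simp only [neg_neg, neg_zero] at h4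
  rw [← intervalIntegral.integral_Iic_add_Ioi h3 h1, h4, add_comm]

theorem integrableOn_exp_mul_jIntegrand {lam : ℝ} (hlam : 0 < lam) (μ : ℝ) {a : ℂ} (ha : 0 < a.re)
    (w : ℝ) :
    IntegrableOn (fun t : ℝ => Complex.exp (((w * t : ℝ) : ℂ) * Complex.I) * jIntegrand lam μ a t)
      (Ioi 0) :=
  Integrable.mono' (integrableOn_jIntegrand hlam ha).norm
    (Measurable.aestronglyMeasurable
      (Measurable.mul (by fun_prop) (measurable_jIntegrand lam μ a)))
    (Eventually.of_forall fun t => by rw [norm_mul, Complex.norm_exp_ofReal_mul_I, one_mul])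

theorem integral_exp_mul_jIntegrand (lam μ : ℝ) {a : ℝ} (ha : 0 < a) (w : ℝ) :
    ∫ t in Ioi (0 : ℝ), Complex.exp (((w * t : ℝ) : ℂ) * Complex.I) * jIntegrand lam μ a t =
      ((a ^ (1 - 2 * μ) : ℝ) : ℂ) * laplaceHalf (-μ) ((lam - w * Complex.I) * a) := by
  rw [← integral_exp_mul_sq_add_sq_rpow μ ha]
  refine setIntegral_congr_fun measurableSet_Ioi fun t _ => ?_
  rw [jIntegrand_ofReal, ← mul_assoc, ← Complex.exp_add]
  congr 2
  push_cast
  ring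

theorem fourier_jIntegrand_abs {lam : ℝ} (hlam : 0 < lam) (μ : ℝ) {a : ℝ} (ha : 0 < a) (w : ℝ) :
    𝓕 (fun x : ℝ => jIntegrand lam μ a |x|) w = ((a ^ (1 - 2 * μ) : ℝ) : ℂ) *
      (laplaceHalf (-μ) ((lam + (2 * Real.pi * w : ℝ) * Complex.I) * a) +
        laplaceHalf (-μ) ((lam - (2 * Real.pi * w : ℝ) * Complex.I) * a)) := by
  have ha' : 0 < (a : ℂ).re := by simpa using ha
  have hE : ∀ σ x : ℝ, σ * |x| = -x → 0 < |x| →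
      Complex.exp (((-2 * Real.pi * x * w : ℝ) : ℂ) * Complex.I) • jIntegrand lam μ a |x| =
      Complex.exp (((2 * Real.pi * w * σ * |x| : ℝ) : ℂ) * Complex.I) * jIntegrand lam μ a |x| := by
    intro σ x h _
    rw [smul_eq_mul, mul_assoc (2 * Real.pi * w), h,
      show -2 * Real.pi * x * w = 2 * Real.pi * w * -x by ring]
  have e1 : ∀ x ∈ Ioi (0 : ℝ), Complex.exp (((2 * Real.pi * w * -1 * x : ℝ) : ℂ) * Complex.I) *
      jIntegrand lam μ a x = Complex.exp (((-2 * Real.pi * x * w : ℝ) : ℂ) * Complex.I) •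
        jIntegrand lam μ a |x| := fun x hx => by
    have hx : 0 < x := hx
    have h := hE (-1) x (by rw [abs_of_pos hx]; ring) (abs_pos.2 hx.ne')
    rw [h, abs_of_pos hx]
  have e2 : ∀ x ∈ Ioi (0 : ℝ), Complex.exp (((2 * Real.pi * w * 1 * x : ℝ) : ℂ) * Complex.I) *
      jIntegrand lam μ a x = Complex.exp (((-2 * Real.pi * (-x) * w : ℝ) : ℂ) * Complex.I) •
        jIntegrand lam μ a |(-x)| := fun x hx => by
    have hx : 0 < x := hx
    have h := hE 1 (-x) (by rw [abs_neg, abs_of_pos hx]; ring) (by rw [abs_neg]; exact abs_pos.2 hx.ne')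
    rw [h, abs_neg, abs_of_pos hx]
  rw [Real.fourier_real_eq_integral_exp_smul, integral_eq_add_integral_Ioi_comp_neg
    ((integrableOn_exp_mul_jIntegrand hlam μ ha' _).congr_fun e1 measurableSet_Ioi)
    ((integrableOn_exp_mul_jIntegrand hlam μ ha' _).congr_fun e2 measurableSet_Ioi),
    ← setIntegral_congr_fun measurableSet_Ioi e1, ← setIntegral_congr_fun measurableSet_Ioi e2,
    integral_exp_mul_jIntegrand lam μ ha, integral_exp_mul_jIntegrand lam μ ha, ← mul_add]
  push_cast
  congr 4 <;> ring

theorem laplaceHalf_conj (s : ℝ) (p : ℂ) :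
    laplaceHalf s (starRingEnd ℂ p) = starRingEnd ℂ (laplaceHalf s p) := by
  rw [laplaceHalf, laplaceHalf, ← integral_conj]
  congr 1
  ext x
  simp only [map_mul, Complex.conj_ofReal, ← Complex.exp_conj, map_neg]

theorem I_mul_laplaceUnit_re {s : ℝ} (hs : -1 < s) (X : ℂ) :
    (Complex.I * laplaceUnit s X).re =
      ∫ y in Ioo (0 : ℝ) 1, Real.exp (-(X.re * y)) * Real.sin (X.im * y) * (1 - y ^ 2) ^ s := by
  have hi : IntegrableOn (fun y : ℝ => Complex.exp (-(X * y)) * (((1 - y ^ 2) ^ s : ℝ) : ℂ))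
      (Ioo 0 1) :=
    Integrable.mono' ((integrableOn_one_sub_sq_rpow hs).const_mul _)
      (Measurable.aestronglyMeasurable (by fun_prop))
      ((ae_restrict_mem measurableSet_Ioo).mono fun y hy =>
        norm_laplaceUnit_integrand_le s le_rfl hy)
  have h := integral_im hi
  rw [Complex.I_mul_re, laplaceUnit]
  refine Eq.trans (congrArg Neg.neg h.symm) ?_
  rw [← integral_neg]
  refine setIntegral_congr_fun measurableSet_Ioo fun y _ => ?_
  simp [Complex.exp_im, Complex.mul_im]

/-- The frequencies `±w` give conjugate values. The number `p = -iX` lies in the quadrant where the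
rotation is valid, and `ip = X`. -/
theorem laplaceHalf_add_conj {s : ℝ} (hs : -1 < s) {X : ℂ} (h1 : 0 < X.re) (h2 : 0 < X.im) :
    laplaceHalf s (-Complex.I * X) + laplaceHalf s (starRingEnd ℂ (-Complex.I * X)) =
      2 * (((∫ y in Ioo (0 : ℝ) 1, Real.exp (-(X.re * y)) * Real.sin (X.im * y) *
        (1 - y ^ 2) ^ s) + (Complex.I * Complex.exp (Complex.I * Real.pi * s) *
          laplaceTail s X).re : ℝ) : ℂ) := by
  have e : Complex.I * (-Complex.I * X) = X := by
    rw [← mul_assoc, mul_neg, Complex.I_mul_I, neg_neg, one_mul]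
  have h := laplaceHalf_rotate hs (p := -Complex.I * X) (by simpa using h2) (by simpa using h1)
  rw [e] at h
  rw [laplaceHalf_conj, Complex.add_conj, h, Complex.add_re, I_mul_laplaceUnit_re hs]
  push_cast
  rfl

theorem hasSum_of_even_int {f : ℤ → ℂ} (hf : ∀ n, f (-n) = f n) {s : ℂ}
    (h : HasSum (fun n : ℕ => f (n + 1)) s) : HasSum f (f 0 + 2 * s) := by
  have h1 : HasSum (fun n : ℕ => f n) (f 0 + s) := by
    have := HasSum.zero_add (f := fun n : ℕ => f n) (by simpa using h)
    simpa using this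
  have h2 := HasSum.of_nat_of_neg_add_one h1 (h.congr_fun fun n => (hf _))
  rwa [add_assoc, ← two_mul] at h2

/-- With `q = e^{-2x}` one has `e^{-x}/sinh x = 2q/(1 - q)`, the sum of a geometric series. -/
theorem hIntegrand_ofReal (lam μ a : ℝ) (ha : 0 < a) {u : ℝ} (hu : 0 < u) :
    hIntegrand lam μ a u = ((2 * (Real.exp (-(2 * Real.pi * (a * u))) *
      (1 - Real.exp (-(2 * Real.pi * (a * u))))⁻¹ * (Real.sin (lam * a * u) *
        (1 - u ^ 2) ^ (-μ))) : ℝ) : ℂ) := by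
  have h : Real.exp (-(Real.pi * a * u)) * (Real.sinh (Real.pi * a * u))⁻¹ =
      2 * (Real.exp (-(2 * Real.pi * (a * u))) *
      (1 - Real.exp (-(2 * Real.pi * (a * u))))⁻¹) := by
    have hx : 0 < Real.pi * a * u := by
      have := Real.pi_pos
      positivity
    rw [Real.sinh_eq, show -(2 * Real.pi * (a * u)) = -(Real.pi * a * u) + -(Real.pi * a * u) by
      ring, Real.exp_add, Real.exp_neg]
    have h1 : 1 < Real.exp (Real.pi * a * u) := Real.one_lt_exp_iff.2 hx
    generalize Real.exp (Real.pi * a * u) = E at *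
    have h2 : E ≠ 0 := by positivity
    have h3 : E ^ 2 - 1 ≠ 0 := by nlinarith
    rw [show E - E⁻¹ = (E ^ 2 - 1) / E by field_simp,
      show 1 - E⁻¹ * E⁻¹ = (E ^ 2 - 1) / E ^ 2 by field_simp]
    field_simp
  rw [hIntegrand, ← mul_assoc (2 : ℝ), ← h]
  push_cast
  rw [div_eq_mul_inv]
  ring

/-- For fixed `u` the terms keep one sign in `k`, so their absolute values sum to half the modulus
of the integrand of `H`. That function is integrable, which justifies the interchange down to `u =
0`, where the ratio tends to `1`. -/
theorem hasSum_integral_exp_mul_sin (lam : ℝ) {μ : ℝ} (hμ : μ < 1) {a : ℝ} (ha : 0 < a) :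
    HasSum (fun k : ℕ => ((∫ u in Ioo (0 : ℝ) 1, Real.exp (-(2 * Real.pi * (a * u))) ^ (k + 1) *
      (Real.sin (lam * a * u) * (1 - u ^ 2) ^ (-μ)) : ℝ) : ℂ))
      (1 / 2 * ∫ u in Ioo (0 : ℝ) 1, hIntegrand lam μ a u) := by
  have hq : ∀ u ∈ Ioo (0 : ℝ) 1, Real.exp (-(2 * Real.pi * (a * u))) < 1 := fun u hu =>
    exp_neg_two_pi_mul_lt_one (mul_pos ha hu.1)
  have hs : ∀ u ∈ Ioo (0 : ℝ) 1, HasSum (fun k : ℕ => Real.exp (-(2 * Real.pi * (a * u))) ^ (k + 1))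
      (Real.exp (-(2 * Real.pi * (a * u))) * (1 - Real.exp (-(2 * Real.pi * (a * u))))⁻¹) :=
    fun u hu => by
      simp only [pow_succ']
      exact (hasSum_geometric_of_lt_one (Real.exp_nonneg _) (hq u hu)).mul_left _
  have hn : ∀ u ∈ Ioo (0 : ℝ) 1, HasSum (fun k : ℕ => ‖Real.exp (-(2 * Real.pi * (a * u))) ^ (k + 1) *
      (Real.sin (lam * a * u) * (1 - u ^ 2) ^ (-μ))‖) (1 / 2 * ‖hIntegrand lam μ a u‖) :=
    fun u hu => by
      have h1 := (hs u hu).mul_right ‖Real.sin (lam * a * u) * (1 - u ^ 2) ^ (-μ)‖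
      have h2 : 0 < 1 - Real.exp (-(2 * Real.pi * (a * u))) := sub_pos.2 (hq u hu)
      have e : 1 / 2 * ‖hIntegrand lam μ a u‖ = Real.exp (-(2 * Real.pi * (a * u))) *
          (1 - Real.exp (-(2 * Real.pi * (a * u))))⁻¹ *
            ‖Real.sin (lam * a * u) * (1 - u ^ 2) ^ (-μ)‖ := by
        rw [hIntegrand_ofReal lam μ a ha hu.1, Complex.norm_real, norm_mul, norm_mul (_ * _),
          Real.norm_of_nonneg (by positivity : (0 : ℝ) ≤ Real.exp _ * (_)⁻¹), Real.norm_ofNat]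
        ring
      rw [e]
      refine h1.congr_fun fun k => ?_
      rw [norm_mul, Real.norm_of_nonneg (by positivity)]
  have h := hasSum_integral_of_dominated_convergence (μ := volume.restrict (Ioo (0 : ℝ) 1))
    (F := fun (k : ℕ) (u : ℝ) => ((Real.exp (-(2 * Real.pi * (a * u))) ^ (k + 1) *
      (Real.sin (lam * a * u) * (1 - u ^ 2) ^ (-μ)) : ℝ) : ℂ))
    (f := fun u => 1 / 2 * hIntegrand lam μ a u)
    (fun (k : ℕ) (u : ℝ) => ‖Real.exp (-(2 * Real.pi * (a * u))) ^ (k + 1) *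
      (Real.sin (lam * a * u) * (1 - u ^ 2) ^ (-μ))‖)
    (fun k => Measurable.aestronglyMeasurable (by fun_prop))
    (fun k => Eventually.of_forall fun u => (Complex.norm_real _).le)
    ((ae_restrict_mem measurableSet_Ioo).mono fun u hu => (hn u hu).summable) ?_
    ((ae_restrict_mem measurableSet_Ioo).mono fun u hu => ?_)
  · rw [integral_const_mul] at h
    simpa only [integral_complex_ofReal] using h
  · have := ((integrableOn_hIntegrand lam hμ (a := a) (by simpa using ha)).norm.const_mul (1 / 2))
    exact this.congr ((ae_restrict_mem measurableSet_Ioo).mono fun u hu => (hn u hu).tsum_eq.symm)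
  · have := Complex.hasSum_ofReal.2 ((hs u hu).mul_right (Real.sin (lam * a * u) * (1 - u ^ 2) ^ (-μ)))
    have e : 1 / 2 * hIntegrand lam μ a u = ((Real.exp (-(2 * Real.pi * (a * u))) *
        (1 - Real.exp (-(2 * Real.pi * (a * u))))⁻¹ *
          (Real.sin (lam * a * u) * (1 - u ^ 2) ^ (-μ)) : ℝ) : ℂ) := by
      rw [hIntegrand_ofReal lam μ a ha hu.1]
      push_cast
      ring
    rw [e]
    exact this

theorem laplaceTail_Xhat_re {lam μ : ℝ} (hμ : μ < 1) {a : ℝ} (ha : 0 < a) (k : ℕ) :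
    (((Complex.I * Complex.exp (Complex.I * Real.pi * ((-μ : ℝ) : ℂ)) *
      laplaceTail (-μ) (Xhat lam a k)).re : ℝ) : ℂ) =
      ((2 ^ (1 / 2 - μ) * Real.Gamma (1 - μ) / Real.sqrt Real.pi : ℝ) : ℂ) * tTerm lam μ a k := by
  have hX := Xhat_mem_slitPlane lam (a := a) (by simpa using ha) k
  have hre : 0 < (Xhat lam a k).re := by
    rw [Xhat_re]
    have := Real.pi_pos
    simp only [Complex.ofReal_re, Complex.ofReal_im, mul_zero, sub_zero]
    positivity
  have hG := Real.Gamma_pos_of_pos (show 0 < 1 - μ by linarith)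
  have hk : kRatio μ (Xhat lam a k) = ((Real.sqrt Real.pi * 2 ^ (μ - 1 / 2) *
      (Real.Gamma (1 - μ))⁻¹ : ℝ) : ℂ) * laplaceTail (-μ) (Xhat lam a k) := by
    rw [kRatio_eq hμ hX, laplaceTail_eq_ext (by linarith) hre]
    congr 2
    push_cast
    ring
  have hc : 2 ^ (1 / 2 - μ) * Real.Gamma (1 - μ) / Real.sqrt Real.pi *
      (Real.sqrt Real.pi * 2 ^ (μ - 1 / 2) * (Real.Gamma (1 - μ))⁻¹) = 1 := by
    have h2 : (2 : ℝ) ^ (1 / 2 - μ) * 2 ^ (μ - 1 / 2) = 1 := by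
      rw [← Real.rpow_add two_pos]; simp
    have := Real.sqrt_pos.2 Real.pi_pos
    generalize (2 : ℝ) ^ (1 / 2 - μ) = P at *
    generalize (2 : ℝ) ^ (μ - 1 / 2) = Q at *
    field_simp
    exact h2
  rw [tTerm_ofReal hμ ha, thetaHat_eq, ← I_mul_exp_mul_re, hk, ← Complex.ofReal_mul]
  congr 1
  rw [mul_left_comm _ ((_ : ℝ) : ℂ), Complex.re_ofReal_mul, ← mul_assoc, hc, one_mul]
  push_cast
  ring_nf

theorem fourier_jIntegrand_abs_succ {lam μ : ℝ} (hlam : 0 < lam) (hμ : μ < 1) {a : ℝ} (ha : 0 < a)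
    (k : ℕ) :
    𝓕 (fun x : ℝ => jIntegrand lam μ a |x|) (k + 1) = ((a ^ (1 - 2 * μ) : ℝ) : ℂ) *
      (2 * (((∫ u in Ioo (0 : ℝ) 1, Real.exp (-(2 * Real.pi * (a * u))) ^ (k + 1) *
        (Real.sin (lam * a * u) * (1 - u ^ 2) ^ (-μ)) : ℝ) : ℂ) +
        ((2 ^ (1 / 2 - μ) * Real.Gamma (1 - μ) / Real.sqrt Real.pi : ℝ) : ℂ) *
          tTerm lam μ a k)) := by
  -- This identity is the origin of `X̂_k`: frequency `k + 1` corresponds to the Laplace variable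
  -- `-i X̂_k`.
  have e1 : ((lam : ℂ) - ((2 * Real.pi * (k + 1) : ℝ) : ℂ) * Complex.I) * a =
      -Complex.I * Xhat lam a k := by
    rw [Xhat]
    push_cast
    linear_combination (lam * a : ℂ) * Complex.I_sq
  have e2 : ((lam : ℂ) + ((2 * Real.pi * (k + 1) : ℝ) : ℂ) * Complex.I) * a =
      starRingEnd ℂ (-Complex.I * Xhat lam a k) := by
    rw [← e1]
    simp only [map_mul, map_sub, Complex.conj_ofReal, Complex.conj_I]
    ring
  have hre : (Xhat lam a k).re = 2 * Real.pi * a * (k + 1) := by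
    simp [Xhat_re]
  have him : (Xhat lam a k).im = lam * a := by
    simp [Xhat]
  have hpi := Real.pi_pos
  have hint : ∫ y in Ioo (0 : ℝ) 1, Real.exp (-(2 * Real.pi * a * (k + 1) * y)) *
      Real.sin (lam * a * y) * (1 - y ^ 2) ^ (-μ) =
      ∫ u in Ioo (0 : ℝ) 1, Real.exp (-(2 * Real.pi * (a * u))) ^ (k + 1) *
        (Real.sin (lam * a * u) * (1 - u ^ 2) ^ (-μ)) := by
    refine setIntegral_congr_fun measurableSet_Ioo fun u _ => ?_
    rw [← Real.exp_nat_mul, mul_assoc (Real.exp _)]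
    congr 2
    push_cast
    ring
  rw [fourier_jIntegrand_abs hlam μ ha, e1, e2, add_comm (laplaceHalf _ _),
    laplaceHalf_add_conj (by linarith) (by rw [hre]; positivity) (by rw [him]; positivity), hre, him,
    Complex.ofReal_add, laplaceTail_Xhat_re hμ ha, hint]

theorem S_ofReal {lam μ : ℝ} (hlam : 0 < lam) (hμ : μ < 1) {a : ℝ} (ha : 0 < a) :
    S lam μ a = 1 / (2 * (a : ℂ) ^ ((2 * μ : ℝ) : ℂ)) + J lam μ a + H lam μ a + That lam μ a := by
  have ha' : 0 < (a : ℂ).re := by simpa using ha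
  set g : ℝ → ℂ := fun x : ℝ => jIntegrand lam μ a |x| with hg
  -- The index `0` is counted once over the integers, so the total is `2S - a^{-2μ}`; this is where
  -- `1/(2a^{2μ})` comes from.
  have hl : HasSum (fun n : ℤ => g n) (g 0 + 2 * (S lam μ a - sTerm lam μ a 0)) := by
    have h := hasSum_of_even_int (f := fun n : ℤ => g n) (s := S lam μ a - sTerm lam μ a 0)
      (fun n => by simp [hg]) ?_
    · simpa using h
    · have := (hasSum_nat_add_iff' 1).2 (summable_sTerm hlam μ ha').hasSum
      simp only [Finset.range_one, Finset.sum_singleton] at this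
      refine this.congr_fun fun n => ?_
      rw [sTerm_eq_jIntegrand, hg]
      push_cast
      rw [abs_of_nonneg (by positivity : (0 : ℝ) ≤ (n : ℝ) + 1)]
  have hr := ((hasSum_integral_exp_mul_sin lam hμ ha).add ((summable_tTerm hlam.le hμ
    ha').hasSum.mul_left ((2 ^ (1 / 2 - μ) * Real.Gamma (1 - μ) / Real.sqrt Real.pi : ℝ) :
      ℂ))).mul_left 2 |>.mul_left ((a ^ (1 - 2 * μ) : ℝ) : ℂ)
  have hr' := hasSum_of_even_int (f := fun n : ℤ => 𝓕 g n) (fun n => by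
      simp only [hg]
      rw [fourier_jIntegrand_abs hlam μ ha, fourier_jIntegrand_abs hlam μ ha, add_comm]
      push_cast
      simp only [mul_neg, neg_mul, sub_eq_add_neg, neg_neg])
    (hr.congr_fun fun n => by
      rw [show (((n : ℤ) + 1 : ℤ) : ℝ) = (n : ℝ) + 1 by push_cast; rfl]
      exact fourier_jIntegrand_abs_succ hlam hμ ha n)
  -- Poisson summation at the point `0`; the exponential decay of `g` is used only as decay of order
  -- `|x|^{-2}`.
  have hP := Real.tsum_eq_tsum_fourier_of_rpow_decay_of_summable (f := g)
    (continuous_jIntegrand_abs lam μ ha) one_lt_two (isBigO_jIntegrand_abs hlam μ ha' (-2))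
    hr'.summable 0
  simp only [zero_add, AddCircle.coe_zero, fourier_eval_zero, mul_one] at hP
  rw [hl.tsum_eq, hr'.tsum_eq] at hP
  have h0 : sTerm lam μ a 0 = 1 / (a : ℂ) ^ ((2 * μ : ℝ) : ℂ) := by
    rw [sTerm_eq_jIntegrand, jIntegrand_ofReal, ← Complex.ofReal_cpow ha.le]
    simp only [Nat.cast_zero, Complex.ofReal_zero, mul_zero, neg_zero, Complex.exp_zero, one_mul]
    rw [zero_pow two_ne_zero, zero_add, ← Real.rpow_natCast, ← Real.rpow_mul ha.le,
      show ((2 : ℕ) : ℝ) * -μ = -(2 * μ) by push_cast; ring, Real.rpow_neg ha.le]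
    simp
  have hg0 : g 0 = sTerm lam μ a 0 := by
    rw [sTerm_eq_jIntegrand, hg]
    simp
  have hF0 : 𝓕 g ((0 : ℤ) : ℝ) = 2 * J lam μ a := by
    simp only [hg]
    rw [fourier_jIntegrand_abs hlam μ ha, J_eq_laplaceHalf hlam μ ha', Complex.ofReal_cpow ha.le]
    simp
    ring
  have hc : (((2 : ℝ) ^ (3 / 2 - μ) * Real.sqrt Real.pi * (Real.Gamma (1 - μ) / Real.pi) : ℝ) : ℂ) =
      2 * ((2 ^ (1 / 2 - μ) * Real.Gamma (1 - μ) / Real.sqrt Real.pi : ℝ) : ℂ) := by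
    rw [← Complex.ofReal_ofNat, ← Complex.ofReal_mul]
    congr 1
    rw [show (3 / 2 - μ) = 1 + (1 / 2 - μ) by ring, Real.rpow_add two_pos, Real.rpow_one]
    have h1 : Real.sqrt Real.pi ≠ 0 := (Real.sqrt_pos.2 Real.pi_pos).ne'
    have h2 : Real.pi = Real.sqrt Real.pi * Real.sqrt Real.pi :=
      (Real.mul_self_sqrt Real.pi_pos.le).symm
    generalize Real.sqrt Real.pi = σ at *
    rw [h2]
    field_simp
  rw [hg0, hF0, h0] at hP
  rw [H, That, hc, ← Complex.ofReal_cpow ha.le (1 - 2 * μ), one_div, mul_inv]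
  rw [one_div] at hP
  linear_combination hP / 2

theorem S_eq {lam μ : ℝ} (hlam : 0 < lam) (hμ : μ < 1) {a : ℂ} (ha : 0 < a.re) :
    S lam μ a = 1 / (2 * a ^ ((2 * μ : ℝ) : ℂ)) + J lam μ a + H lam μ a + That lam μ a := by
  refine eqOn_of_eq_on_real_Ioo (f := S lam μ) (g := fun a => 1 / (2 * a ^ ((2 * μ : ℝ) : ℂ)) +
    J lam μ a + H lam μ a + That lam μ a) isOpen_re_pos isPreconnected_re_pos
    (differentiableOn_S hlam μ) (DifferentiableOn.add (DifferentiableOn.add (DifferentiableOn.add ?_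
      (differentiableOn_J hlam μ)) (differentiableOn_H lam hμ)) (differentiableOn_That hlam.le hμ))
    zero_lt_one (fun x hx _ => by simpa using hx) (fun x hx _ => S_ofReal hlam hμ hx) ha
  refine DifferentiableOn.fun_div (differentiableOn_const _)
    ((differentiableOn_cpow_const_re_pos _).const_mul _) fun a ha h => ?_
  have h0 : a ≠ 0 := Complex.slitPlane_ne_zero (Or.inl ha)
  simp [Complex.cpow_eq_zero_iff, h0] at h

end MathieuExp

end

theorem mainTheorem3 (lam μ : ℝ) (hlam : 0 < lam) (hμ : μ < 1) :
    -- the exact representation in the whole sector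
    (∀ a : ℂ, a ≠ 0 → |Complex.arg a| < Real.pi / 2 →
      Summable (MathieuExp.sTerm lam μ a) ∧
      IntegrableOn (MathieuExp.jIntegrand lam μ a) (Ioi (0 : ℝ)) ∧
      IntegrableOn (MathieuExp.hIntegrand lam μ a) (Ioo (0 : ℝ) 1) ∧
      Summable (MathieuExp.tTerm lam μ a) ∧
      MathieuExp.S lam μ a =
        1 / (2 * a ^ ((2 * μ : ℝ) : ℂ)) + MathieuExp.J lam μ a + MathieuExp.H lam μ a
          + MathieuExp.That lam μ a ∧
      MathieuExp.J lam μ a =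
        (Real.sqrt Real.pi : ℂ) * a ^ ((1 - 2 * μ : ℝ) : ℂ) * (Real.Gamma (1 - μ) : ℂ) /
            (2 * ((lam : ℂ) * a / 2) ^ ((1 / 2 - μ : ℝ) : ℂ)) *
          MathieuExp.struveK (1 / 2 - μ) (lam * a)) ∧
    -- the real form of the Bessel series for positive `a`
    (∀ a : ℝ, 0 < a →
      Summable (fun k : ℕ => Real.sin (Real.pi * μ - MathieuExp.thetaHat lam μ a k) *
        ‖MathieuExp.kRatio μ (MathieuExp.Xhat lam a k)‖) ∧
      MathieuExp.That lam μ a =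
        (((2 : ℝ) ^ (3 / 2 - μ) * Real.sqrt Real.pi / a ^ (2 * μ - 1) *
          (Real.Gamma (1 - μ) / Real.pi) *
          ∑' k : ℕ, Real.sin (Real.pi * μ - MathieuExp.thetaHat lam μ a k) *
            ‖MathieuExp.kRatio μ (MathieuExp.Xhat lam a k)‖ : ℝ) : ℂ) ∧
      ((∀ m : ℤ, μ ≠ m) →
        MathieuExp.That lam μ a =
          (((2 : ℝ) ^ (3 / 2 - μ) * Real.sqrt Real.pi / (a ^ (2 * μ - 1) * Real.Gamma μ) *
            ∑' k : ℕ, Real.sin (Real.pi * μ - MathieuExp.thetaHat lam μ a k) /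
              Real.sin (Real.pi * μ) *
              ‖MathieuExp.kRatio μ (MathieuExp.Xhat lam a k)‖ : ℝ) : ℂ))) ∧
    -- the size of the Bessel series for large positive `a`, and in closed subsectors
    ((fun a : ℝ => MathieuExp.That lam μ (a : ℂ)) =O[atTop]
      (fun a : ℝ => a ^ (1 - 2 * μ) * Real.exp (-2 * Real.pi * a))) ∧
    (∀ δ : ℝ, δ < Real.pi / 2 →
      (fun a : ℂ => MathieuExp.That lam μ a)
        =O[Bornology.cobounded ℂ ⊓ 𝓟 {a : ℂ | |Complex.arg a| ≤ δ}]
      (fun a : ℂ => ‖a‖ ^ (1 - 2 * μ) *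
        Real.exp (-2 * Real.pi * a.re + lam * |a.im|))) := by
  have hre : ∀ a : ℂ, a ≠ 0 → |Complex.arg a| < Real.pi / 2 → 0 < a.re := fun a ha h =>
    (Complex.abs_arg_lt_pi_div_two_iff.1 h).resolve_right ha
  refine ⟨fun a ha h => ?_, fun a ha => ⟨?_, ?_, fun h => ?_⟩, ?_, fun δ hδ => ?_⟩
  · have h := hre a ha h
    exact ⟨MathieuExp.summable_sTerm hlam μ h, MathieuExp.integrableOn_jIntegrand hlam h,
      MathieuExp.integrableOn_hIntegrand lam hμ h, MathieuExp.summable_tTerm hlam.le hμ h,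
      MathieuExp.S_eq hlam hμ h, MathieuExp.J_eq_struveK hlam hμ h⟩
  · exact MathieuExp.summable_sin_mul_norm_kRatio hlam.le hμ ha
  · exact MathieuExp.That_ofReal hμ ha
  · exact MathieuExp.That_ofReal_of_not_int hμ h ha
  · exact MathieuExp.isBigO_That_ofReal hlam.le hμ
  · exact MathieuExp.isBigO_That_sector hlam.le hμ hδ
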